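/- Let $G$ be a compact Lie group with Lie algebra $\mathfrak g$, let $EG\to BG$ be a universal principal $G$-bundle and $b_0\in BG$ a base point. Let $\mathfrak g_{EG}=EG\times_G\mathfrak g\to BG$ be the adjoint bundle and $\bar{\mathfrak g}=\mathfrak g_{EG}-\underline{\mathbb R}^{\dim G}$ the reduced adjoint bundle, where $\underline{\mathbb R}^{\dim G}$ is identified with the trivial bundle whose fibre is that of $\mathfrak g_{EG}$ at $b_0$, so that $\bar{\mathfrak g}$ is a based map from $BG$ to $\mathbb Z\times BO=\Omega^\infty ko$. Let $\mathrm{Gr}_n(\mathbb R^N)$ be the Grassmannian of oriented $n$-planes, $V_n$ its tautological bundle and $Q=V_n^\perp$ its quotient bundle. Let $MTSO_n$ be the Thom spectrum of $-V_n\to BSO_n$, with $N$-th space the Thom space $\mathrm{Gr}_n(\mathbb R^N)^{Q}$, and present the suspension spectrum of $(BSO_n)_+$ as the spectrum with $N$-th space $\mathrm{Gr}_n(\mathbb R^N)^{Q\oplus V_n}=\mathrm{Gr}_n(\mathbb R^N)_+\wedge S^N$. Consider $$\Sigma^{-1}MTSO_1\wedge BG\xrightarrow{\ b\ }MTSO_2\wedge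 BG\xrightarrow{\ q\ }(MTSO_2,\Sigma^{-1}MTSO_1)\wedge BG\simeq (BSO_2)_+\wedge BG ,$$ where $b$ is induced by $L\mapsto \mathbb R\oplus L$, and $q$, the quotient map of this cofibration, is induced by the inclusion $Q\subset Q\oplus V_2$; the composite $q\circ b$ has the canonical null homotopy which moves vectors to infinity along the trivial summand $\mathbb R$ of $\mathbb R\oplus L$. The reduced universal de Rham symbol $\bar\sigma_{\mathrm{univ}}\in KO^0(MTSO_2\wedge BG)$ is the class of the symbol complexes $\bigl(\Lambda^\bullet (V_2\otimes\mathbb C),\epsilon(i\xi)\bigr)\otimes\bar{\mathfrak g}_{\mathbb C}$, $\xi\in V_2$, which is a Real class with compact vertical supports on $iV_2$, transported by the Thom isomorphisms $KR^0(X^{iV})\cong KR^0(X^{iV\oplus Q\oplus iQ})=KR^0(X^{Q}\wedge S^{i\mathbb R^N})=KO^N(X^Q)=KO^0(X^{-V})$, the first of which is multiplication by the Koszul–Thom class $(\Lambda^\bullet(Q\otimes\mathbb C),\epsilon(\theta))$, $\theta\in Q\oplus iQ$, where $V\oplus Q=\underline{\mathbb R}^N$. It is regarded as a map of spectra $MTSO_2\wedge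 BG\to KO$. (It lifts to $ko$, uniquely up to homotopy, since $MTSO_2\wedge BG$ is sufficiently connected; maps into $ko$ are compared with $\bar\sigma_{\mathrm{univ}}$ through $j\colon ko\to KO$.) Let $\bar\sigma'_{\mathrm{univ}}\colon (BSO_2)_+\wedge BG\to ko$ be the map of spectra induced by the trivial real line bundle over $BSO_2$ (the trivial representation of $SO_2$) smash the reduced adjoint bundle $\bar{\mathfrak g}$ over $BG$, and let $j\colon ko\to KO$ be the canonical map; in terms of Koszul complexes $j$ sends the class of $W$ at $x\in\mathbb R^N$ to $(\Lambda^\bullet\mathbb C^N,\epsilon(x+i\zeta))\otimes W_{\mathbb C}$, $\zeta\in\mathbb R^N$. Then $b$, $q$, $\bar\sigma'_{\mathrm{univ}}$ and $\bar\sigma_{\mathrm{univ}}$ are maps of spectra, and the triangle commutes up to homotopy: $$ j\circ\bar\sigma'_{\mathrm{univ}}\circ q\;\simeq\;\bar\sigma_{\mathrm{univ}} .$$ The homotopy can be chosen canonically, namely given by one formula in terms of the fibres of the adjoint bundle at $b$ and $b_0$, uniformly in $G$, $EG$, $b_0$ and the embedding of $\mathfrak g_{EG}$ in a trivial bundle with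 fibre a real Hilbert space which is used to represent $\bar{\mathfrak g}$. Running this homotopy (composed with $b$) backwards and following it by the image under $j\circ\bar\sigma'_{\mathrm{univ}}$ of the canonical null homotopy of $q\circ b$ gives a canonical null homotopy of $\bar\sigma_{\mathrm{univ}}\circ b$. -/

import Mathlib

open scoped Manifold ContDiff UniformConvergence Topology Kronecker

noncomputable section

namespace KOSymbol

/-! ### Spectra -/

/-- A sequence of based spaces with structure maps `S¹ ∧ X N → X (N+1)`.  The `N`-th based space is
presented as a pair: the subspace `carrier N` of `X N`, with its subspace `base N` (which contains
`pt N`) collapsed to the base point.  The circle is `OnePoint ℝ`, based at `∞`. -/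
structure Spec where
  X : ℕ → Type*
  top : ∀ N, TopologicalSpace (X N)
  carrier : ∀ N, Set (X N)
  base : ∀ N, Set (X N)
  pt : ∀ N, X N
  str : ∀ N, X N → OnePoint ℝ → X (N + 1)

attribute [instance] Spec.top

/-- `f` is a map of spectra: continuous maps of pairs, compatible with the structure maps. -/
def IsMap (E F : Spec) (f : ∀ N, E.X N → F.X N) : Prop :=
  ∀ N, ContinuousOn (f N) (E.carrier N) ∧ Set.MapsTo (f N) (E.carrier N) (F.carrier N) ∧
    Set.MapsTo (f N) (E.base N) (F.base N) ∧
    ∀ x ∈ E.carrier N, ∀ t : OnePoint ℝ, f (N + 1) (E.str N x t) = F.str N (f N x) t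

/-- `h` is a homotopy through maps of spectra, starting at `f`. -/
def IsHomotopyFrom (E F : Spec) (h : ∀ N, E.X N → unitInterval → F.X N)
    (f : ∀ N, E.X N → F.X N) : Prop :=
  (∀ N, ContinuousOn (fun p : E.X N × unitInterval => h N p.1 p.2) (E.carrier N ×ˢ Set.univ)) ∧
  (∀ s, IsMap E F (fun N x => h N x s)) ∧
  ∀ N, ∀ x ∈ E.carrier N, h N x 0 = f N x

/-- `h` is a homotopy of maps of spectra from `f` to `g`. -/
def IsHomotopy (E F : Spec) (h : ∀ N, E.X N → unitInterval → F.X N)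
    (f g : ∀ N, E.X N → F.X N) : Prop :=
  IsHomotopyFrom E F h f ∧ ∀ N, ∀ x ∈ E.carrier N, h N x 1 = g N x

/-- `h` is a null homotopy of the map of spectra `f`. -/
def IsNullHomotopy (E F : Spec) (h : ∀ N, E.X N → unitInterval → F.X N)
    (f : ∀ N, E.X N → F.X N) : Prop :=
  IsHomotopyFrom E F h f ∧ ∀ N, ∀ x ∈ E.carrier N, h N x 1 ∈ F.base N

/-- The path `h` run backwards, followed by the path `k`. -/
def backThen {Y : Type*} (h k : unitInterval → Y) (s : unitInterval) : Y :=
  if (s : ℝ) ≤ 1 / 2 then h (Set.projIcc 0 1 zero_le_one (1 - 2 * (s : ℝ)))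
  else k (Set.projIcc 0 1 zero_le_one (2 * (s : ℝ) - 1))

/-- The smash product `E ∧ B` with a space `B` based at `b₀`. -/
def smash (E : Spec) (B : Type*) [TopologicalSpace B] (b₀ : B) : Spec where
  X N := E.X N × B
  top _ := inferInstance
  carrier N := E.carrier N ×ˢ Set.univ
  base N := {p | p.1 ∈ E.base N ∨ (p.1 ∈ E.carrier N ∧ p.2 = b₀)}
  pt N := (E.pt N, b₀)
  str N p t := (E.str N p.1 t, p.2)

/-- The spaces of the desuspension `Σ⁻¹E`: the `N`-th space is the `(N-1)`-st space of `E`. -/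
def desuspX (E : Spec) : ℕ → Type _
  | 0 => PUnit
  | N + 1 => E.X N

/-- The desuspension `Σ⁻¹E`. -/
def desusp (E : Spec) : Spec where
  X := desuspX E
  top N := match N with
    | 0 => (inferInstance : TopologicalSpace PUnit)
    | N + 1 => E.top N
  carrier N := match N with
    | 0 => (Set.univ : Set PUnit)
    | N + 1 => E.carrier N
  base N := match N with
    | 0 => (Set.univ : Set PUnit)
    | N + 1 => E.base N
  pt N := match N with
    | 0 => PUnit.unit
    | N + 1 => E.pt N
  str N := match N with
    | 0 => fun _ _ => E.pt 0
    | N + 1 => E.str N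

/-! ### Oriented Grassmannians and Madsen–Tillmann spectra -/

/-- Euclidean space `ℝᴺ`. -/
abbrev Eu (N : ℕ) : Type := EuclideanSpace ℝ (Fin N)

/-- The vector `(x, t)` of `ℝᴺ⁺¹`. -/
def snocE {N : ℕ} (x : Eu N) (t : ℝ) : Eu (N + 1) :=
  WithLp.toLp 2 (Fin.snoc (α := fun _ => ℝ) (fun i => x i) t)

/-- The vector `(t, x)` of `ℝᴺ⁺¹`. -/
def consE {N : ℕ} (t : ℝ) (x : Eu N) : Eu (N + 1) :=
  WithLp.toLp 2 (Fin.cons (α := fun _ => ℝ) t (fun i => x i))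

/-- Orthonormal `n`-frames in `ℝᴺ`. -/
abbrev Frame (n N : ℕ) : Type := {f : Fin n → Eu N // Orthonormal ℝ f}

/-- Two frames differ by an element of `SO n`. -/
def frameRel (n N : ℕ) (f g : Frame n N) : Prop :=
  ∃ A : Matrix.specialOrthogonalGroup (Fin n) ℝ, ∀ i, g.1 i = ∑ j, (A : Matrix _ _ ℝ) i j • f.1 j

lemma inner_snocE {N : ℕ} (x y : Eu N) (s t : ℝ) :
    inner ℝ (snocE x s) (snocE y t) = inner ℝ x y + s * t := by
  simp [snocE, PiLp.inner_apply, Fin.sum_univ_castSucc, mul_comm]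

lemma inner_consE {N : ℕ} (x y : Eu N) (s t : ℝ) :
    inner ℝ (consE s x) (consE t y) = s * t + inner ℝ x y := by
  simp [consE, PiLp.inner_apply, Fin.sum_univ_succ, mul_comm]

lemma snocE_sum {N n : ℕ} (c : Fin n → ℝ) (f : Fin n → Eu N) :
    snocE (∑ j, c j • f j) 0 = ∑ j, c j • snocE (f j) 0 := by
  ext k
  refine Fin.lastCases ?_ (fun k => ?_) k <;> simp [snocE]

lemma consE_sum {N n : ℕ} (c : Fin n → ℝ) (f : Fin n → Eu N) :
    consE 0 (∑ j, c j • f j) = ∑ j, c j • consE 0 (f j) := by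
  ext k
  refine Fin.cases ?_ (fun k => ?_) k <;> simp [consE]

lemma span_frame_eq {n N : ℕ} (f g : Frame n N) (h : frameRel n N f g) :
    Submodule.span ℝ (Set.range f.1) = Submodule.span ℝ (Set.range g.1) := by
  obtain ⟨A, hA⟩ := h
  symm
  apply Submodule.eq_of_le_of_finrank_eq
  · rw [Submodule.span_le]
    rintro _ ⟨i, rfl⟩
    rw [hA i]
    exact Submodule.sum_mem _ fun j _ =>
      Submodule.smul_mem _ _ (Submodule.subset_span ⟨j, rfl⟩)
  · rw [finrank_span_eq_card g.2.linearIndependent, finrank_span_eq_card f.2.linearIndependent]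

/-- The frame `(f₁, 0), …, (fₙ, 0)`. -/
def Frame.incl {n N : ℕ} (f : Frame n N) : Frame n (N + 1) :=
  ⟨fun i => snocE (f.1 i) 0, by
    rw [orthonormal_iff_ite]
    intro i j
    rw [inner_snocE, (orthonormal_iff_ite.1 f.2)]
    simp⟩

/-- The frame `(1, 0), (0, f₁), …, (0, fₙ)`. -/
def Frame.addLine {n N : ℕ} (f : Frame n N) : Frame (n + 1) (N + 1) :=
  ⟨Fin.cons (consE 1 0) fun i => consE 0 (f.1 i), by
    rw [orthonormal_iff_ite]
    intro i j
    refine Fin.cases ?_ (fun i => ?_) i <;> refine Fin.cases ?_ (fun j => ?_) j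
    · simp only [Fin.cons_zero, inner_consE]
      simp
    · simp [inner_consE, (Fin.succ_ne_zero j).symm]
    · simp [inner_consE, Fin.succ_ne_zero i]
    · simp only [Fin.cons_succ, inner_consE, Fin.succ_inj]
      rw [(orthonormal_iff_ite.1 f.2)]
      simp⟩

lemma frameRel_incl {n N : ℕ} (f g : Frame n N) (h : frameRel n N f g) :
    frameRel n (N + 1) f.incl g.incl := by
  obtain ⟨A, hA⟩ := h
  exact ⟨A, fun i => by simp only [Frame.incl, hA i, snocE_sum]⟩

lemma frameRel_addLine {n N : ℕ} (f g : Frame n N) (h : frameRel n N f g) :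
    frameRel (n + 1) (N + 1) f.addLine g.addLine := by
  obtain ⟨⟨A, hA⟩, hfg⟩ := h
  rw [Matrix.mem_specialUnitaryGroup_iff, Matrix.mem_unitaryGroup_iff] at hA
  let B : Matrix (Fin (n + 1)) (Fin (n + 1)) ℝ :=
    Matrix.of (Fin.cons (Fin.cons 1 0) fun i => Fin.cons 0 (A i))
  have h00 : B 0 0 = 1 := rfl
  have h0s : ∀ j : Fin n, B 0 j.succ = 0 := fun j => rfl
  have hs0 : ∀ i : Fin n, B i.succ 0 = 0 := fun i => rfl
  have hss : ∀ i j : Fin n, B i.succ j.succ = A i j := fun i j => rfl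
  have hB : B ∈ Matrix.specialOrthogonalGroup (Fin (n + 1)) ℝ := by
    rw [Matrix.mem_specialUnitaryGroup_iff, Matrix.mem_unitaryGroup_iff]
    constructor
    · ext i j
      have hA' := fun i j => congrFun (congrFun hA.1 i) j
      refine Fin.cases ?_ (fun i => ?_) i <;> refine Fin.cases ?_ (fun j => ?_) j
      · simp [Matrix.mul_apply, Fin.sum_univ_succ, Matrix.star_apply, h00, h0s]
      · simp [Matrix.mul_apply, Fin.sum_univ_succ, Matrix.star_apply, h00, h0s, hs0,
          (Fin.succ_ne_zero j).symm]
      · simp [Matrix.mul_apply, Fin.sum_univ_succ, Matrix.star_apply, h00, h0s, hs0]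
      · have := hA' i j
        simp only [Matrix.mul_apply, Matrix.star_apply, Matrix.one_apply] at this
        simp [Matrix.mul_apply, Fin.sum_univ_succ, Matrix.star_apply, hs0, hss, Matrix.one_apply]
        simpa using this
    · rw [Matrix.det_succ_row_zero, Fin.sum_univ_succ]
      simp only [h00, h0s]
      have : B.submatrix Fin.succ (Fin.succAbove 0) = A := by
        ext i j
        simp [hss]
      rw [this, hA.2]
      simp
  refine ⟨⟨B, hB⟩, fun i => ?_⟩
  refine Fin.cases ?_ (fun i => ?_) i
  · simp [Frame.addLine, Fin.sum_univ_succ, h00, h0s]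
  · simp only [Frame.addLine, Fin.cons_succ, Fin.sum_univ_succ, Fin.cons_zero, hs0, hss, hfg i,
      consE_sum, zero_smul, zero_add]

/-- The Grassmannian of oriented `n`-planes in `ℝᴺ`, with the quotient topology. -/
def Gr (n N : ℕ) : Type := Quot (frameRel n N)

instance (n N : ℕ) : TopologicalSpace (Gr n N) :=
  inferInstanceAs (TopologicalSpace (Quot (frameRel n N)))

/-- The `n`-plane underlying an oriented `n`-plane. -/
def plane {n N : ℕ} (L : Gr n N) : Submodule ℝ (Eu N) :=
  Quot.lift (fun f : Frame n N => Submodule.span ℝ (Set.range f.1)) span_frame_eq L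

/-- The inclusion `Gr n N → Gr n (N+1)` induced by `x ↦ (x, 0)`. -/
def Gr.incl {n N : ℕ} (L : Gr n N) : Gr n (N + 1) := Quot.map Frame.incl frameRel_incl L

/-- The inclusion `Gr n N → Gr (n+1) (N+1)`, `L ↦ ℝe ⊕ L`, where `e = (1, 0)`. -/
def Gr.addLine {n N : ℕ} (L : Gr n N) : Gr (n + 1) (N + 1) :=
  Quot.map Frame.addLine frameRel_addLine L

lemma mem_span_orth {n N : ℕ} (f : Fin n → Eu N) (w : Eu N) :
    w ∈ (Submodule.span ℝ (Set.range f))ᗮ ↔ ∀ i, inner ℝ (f i) w = 0 := by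
  rw [Submodule.mem_orthogonal]
  constructor
  · exact fun h i => h _ (Submodule.subset_span ⟨i, rfl⟩)
  · intro h u hu
    induction hu using Submodule.span_induction with
    | mem x hx => obtain ⟨i, rfl⟩ := hx; exact h i
    | zero => simp
    | add x y _ _ hx hy => rw [inner_add_left, hx, hy, add_zero]
    | smul a x _ hx => rw [inner_smul_left, hx, mul_zero]

/-- The total space of the quotient bundle `Q`, identified with the orthogonal complement of the
tautological bundle `V`. -/
abbrev QTot (n N : ℕ) : Type := {p : Gr n N × Eu N // p.2 ∈ (plane p.1)ᗮ}

lemma snoc_mem {n N : ℕ} (p : QTot n N) (t : ℝ) : snocE p.1.2 t ∈ (plane p.1.1.incl)ᗮ := by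
  obtain ⟨⟨⟨f⟩, w⟩, h⟩ := p
  refine (mem_span_orth _ _).2 fun i => ?_
  have := (mem_span_orth f.1 w).1 h i
  simp [Frame.incl, inner_snocE, this]

lemma cons_mem {n N : ℕ} (p : QTot n N) : consE 0 p.1.2 ∈ (plane p.1.1.addLine)ᗮ := by
  obtain ⟨⟨⟨f⟩, w⟩, h⟩ := p
  refine (mem_span_orth _ _).2 fun i => ?_
  refine Fin.cases ?_ (fun i => ?_) i
  · simp [Frame.addLine, inner_consE]
  · have := (mem_span_orth f.1 w).1 h i
    simp [Frame.addLine, inner_consE, this]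

/-- The Madsen–Tillmann spectrum `MTSO n`: its `N`-th space is the Thom space of `Q → Gr n N`, that
is, the one-point compactification of the total space (the base is compact). -/
def MTSO (n : ℕ) : Spec where
  X N := OnePoint (QTot n N)
  top _ := inferInstance
  carrier _ := Set.univ
  base _ := {OnePoint.infty}
  pt _ := OnePoint.infty
  str _ z t := z.elim OnePoint.infty fun p => t.elim OnePoint.infty fun t =>
    OnePoint.some ⟨(p.1.1.incl, snocE p.1.2 t), snoc_mem p t⟩

/-- The suspension spectrum of `(BSO n)₊`: its `N`-th space is `(Gr n N)₊ ∧ Sᴺ`, the Thom space of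
the trivial bundle `V ⊕ Q`. -/
def BSOplus (n : ℕ) : Spec where
  X N := OnePoint (Gr n N × Eu N)
  top _ := inferInstance
  carrier _ := Set.univ
  base _ := {OnePoint.infty}
  pt _ := OnePoint.infty
  str _ z t := z.elim OnePoint.infty fun p => t.elim OnePoint.infty fun t =>
    OnePoint.some (p.1.incl, snocE p.2 t)

section Cofibration

variable (n : ℕ) {B : Type*} [TopologicalSpace B] (b₀ : B)

/-- `b : Σ⁻¹MTSO n ∧ B → MTSO (n+1) ∧ B`, induced by `L ↦ ℝe ⊕ L`. -/
def bMap : ∀ N, (smash (desusp (MTSO n)) B b₀).X N → (smash (MTSO (n + 1)) B b₀).X N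
  | 0, p => (OnePoint.infty, p.2)
  | _ + 1, p => (OnePoint.elim p.1 OnePoint.infty fun (z : QTot n _) =>
      OnePoint.some ⟨(z.1.1.addLine, consE 0 z.1.2), cons_mem z⟩, p.2)

/-- `q : MTSO n ∧ B → (BSO n)₊ ∧ B`, the quotient map under the identification of
`(MTSO n, Σ⁻¹MTSO (n-1))` with `(BSO n)₊`: it is induced by the inclusion `Q → V ⊕ Q`. -/
def qMap : ∀ N, (smash (MTSO n) B b₀).X N → (smash (BSOplus n) B b₀).X N :=
  fun _ p => (OnePoint.elim p.1 OnePoint.infty fun z => OnePoint.some z.1, p.2)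

/-- The canonical null homotopy of `q ∘ b`: the vector `w ⊥ e` is moved to infinity along
`w + s/(1-s) e`. -/
def qbNull : ∀ N, (smash (desusp (MTSO n)) B b₀).X N → unitInterval →
    (smash (BSOplus (n + 1)) B b₀).X N
  | 0, p, _ => (OnePoint.infty, p.2)
  | _ + 1, p, s => (OnePoint.elim p.1 OnePoint.infty fun (z : QTot n _) =>
      if (s : ℝ) = 1 then OnePoint.infty
      else OnePoint.some (z.1.1.addLine, consE ((s : ℝ) / (1 - s)) z.1.2), p.2)

end Cofibration

/-! ### Graded Hilbert spaces with real structure -/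

/-- The Hilbert sum of copies of `V` indexed by `ι`.  Its real structure is `star`, the entrywise
conjugation. -/
abbrev L2 (ι V : Type) [NormedAddCommGroup V] : Type := lp (fun _ : ι => V) 2

/-- The diagonal operator on a Hilbert sum with given isometric entries. -/
def diagOp {ι V : Type} [NormedAddCommGroup V] [InnerProductSpace ℂ V]
    (A : ι → V →ₗᵢ[ℂ] V) : L2 ι V →ₗᵢ[ℂ] L2 ι V where
  toFun f := ⟨fun i => A i (f i), by
    refine (memℓp_gen_iff (by norm_num)).2 ?_
    have h := (memℓp_gen_iff (by norm_num)).1 (lp.memℓp f)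
    simpa using h⟩
  map_add' f g := by ext i; exact map_add (A i) (f i) (g i)
  map_smul' c f := by ext i; exact map_smul (A i) c (f i)
  norm_map' f := by
    rw [lp.norm_eq_tsum_rpow (by norm_num), lp.norm_eq_tsum_rpow (by norm_num)]
    simp

/-- `(-1)ᵏ A` -/
def signed {V : Type} [NormedAddCommGroup V] [InnerProductSpace ℂ V] (k : ℕ) (A : V →ₗᵢ[ℂ] V) :
    V →ₗᵢ[ℂ] V :=
  if Even k then A else (LinearIsometryEquiv.neg ℂ).toLinearIsometry.comp A

/-- The inclusion of the `i`-th summand. -/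
def ins {ι V : Type} [NormedAddCommGroup V] [InnerProductSpace ℂ V] (i : ι) : V →L[ℂ] L2 ι V := by
  classical exact lp.singleContinuousLinearMap ℂ (fun _ : ι => V) 2 i

/-- The projection onto the `i`-th summand. -/
def prj {ι V : Type} [NormedAddCommGroup V] [InnerProductSpace ℂ V] (i : ι) : L2 ι V →L[ℂ] V :=
  lp.evalCLM ℂ (fun _ : ι => V) 2 i

/-- The real Hilbert space in which real vector bundles are embedded. -/
abbrev HR : Type := lp (fun _ : ℕ => ℝ) 2

/-- The complexification of `HR`. -/
abbrev HC : Type := L2 ℕ ℂ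

/-- `HC ⊕ HC`, with the summand `false` even and the summand `true` odd. -/
abbrev HK : Type := L2 Bool HC

/-- `Λ^•ℂ^∞ ⊗ HK`, with `Λ^•ℂ^∞` the Hilbert space with orthonormal basis
`e_T = e_{t₁} ∧ … ∧ e_{tₖ}`, `T = {t₁ < … < tₖ}`. -/
abbrev HU : Type := L2 (Finset ℕ) HK

/-- `HU ⊗ Λ^•ℂᴺ` -/
abbrev HN (N : ℕ) : Type := L2 (Finset (Fin N)) HU

/-- The grading operator of `HK`. -/
def gradK : HK →ₗᵢ[ℂ] HK := diagOp fun b => signed (if b then 1 else 0) LinearIsometry.id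

/-- The grading operator of `HU`. -/
def gradU : HU →ₗᵢ[ℂ] HU := diagOp fun T => signed T.card gradK

/-- The grading operator of `HN N`. -/
def gradN (N : ℕ) : HN N →ₗᵢ[ℂ] HN N := diagOp fun S => signed S.card gradU

/-! ### K-theory spaces -/

section Classes

variable {V : Type} [NormedAddCommGroup V] [InnerProductSpace ℂ V] [CompleteSpace V]

/-- The based space (base point `0`) of compact self-adjoint operators `Q` on a Hilbert space with
grading operator `γ` which satisfy `2Q² = Qγ + γQ`.  The point `Q` stands for the odd self-adjoint
operator `D` on the graded subspace `(ker Q)ᗮ` with `Q = (γ + D)⁻¹`, thought of as `D = ∞` on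
`ker Q`.  Equivalently `(1 + 2Q - γ)/2` is an orthogonal projection whose difference from the
projection onto the odd part is compact, namely `Q`: for `D` with even-to-odd part
`D₊ : E₀ → E₁` it is the projection onto `graph D₊ ⊕ (V₁ ⊖ E₁)`.  If both parts of `V` are infinite
dimensional this is a classifying space for `K⁰` (for `KR⁰`, with the conjugation). -/
def KSpace (γ : V →ₗᵢ[ℂ] V) : Set (V →L[ℂ] V) :=
  {Q | IsCompactOperator Q ∧ IsSelfAdjoint Q ∧
    (2 : ℂ) • (Q * Q) = Q * γ.toContinuousLinearMap + γ.toContinuousLinearMap * Q}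

/-- `Q (1 + r Q²)⁻¹`, for `r ≥ 0` -/
def damp (Q : V →L[ℂ] V) (r : ℝ) : V →L[ℂ] V := Q * Ring.inverse (1 + (r : ℂ) • (Q * Q))

/-- `γ Q² (1 + r Q²)⁻¹`, for `r ≥ 0` -/
def dampSq (γ : V →ₗᵢ[ℂ] V) (Q : V →L[ℂ] V) (r : ℝ) : V →L[ℂ] V :=
  γ.toContinuousLinearMap * Q * damp Q r

/-- The external product of the class of `Q` on `(V, γ)` and of an odd self-adjoint matrix `d` with
`d² = r` on the range, invariant under `d` and the grading `g`, of the projection matrix `P`.  If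
`Q = (γ + D)⁻¹` this is `(γ ⊗ g + D ⊗ 1 + γ ⊗ d)⁻¹` on that subspace, and `0` on its complement.
It is returned as a block matrix of operators on `V`. -/
def extProd {ι : Type} [Fintype ι] [DecidableEq ι] (γ : V →ₗᵢ[ℂ] V) (Q : V →L[ℂ] V)
    (P d g : Matrix ι ι ℂ) (r : ℝ) (i j : ι) : V →L[ℂ] V :=
  P i j • damp Q r + ((d + g - 1) * P) i j • dampSq γ Q r

end Classes

/-! ### Koszul complexes -/

/-- Exterior multiplication `ε(v)` on `Λ^•ℂᴺ` in the basis `e_S`. -/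
def wedge {N : ℕ} (v : Fin N → ℂ) : Matrix (Finset (Fin N)) (Finset (Fin N)) ℂ :=
  fun S T => ∑ i, if i ∉ T ∧ S = insert i T then (-1) ^ (T.filter (· < i)).card * v i else 0

/-- The Koszul complex `(Λ^•ℂᴺ, ε(v))`, rolled up to the odd self-adjoint operator
`ε(v) + ε(v)^*`. -/
def koszul {N : ℕ} (v : Fin N → ℂ) : Matrix (Finset (Fin N)) (Finset (Fin N)) ℂ :=
  wedge v + (wedge v).conjTranspose

/-- The grading of `Λ^•ℂᴺ`. -/
def gradExt (N : ℕ) : Matrix (Finset (Fin N)) (Finset (Fin N)) ℂ :=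
  Matrix.diagonal fun S => (-1) ^ S.card

/-- The vector `x + iy` of `ℂᴺ`. -/
def cplx {N : ℕ} (x y : Eu N) : Fin N → ℂ := fun k => (x k : ℂ) + Complex.I * (y k : ℂ)

/-- `Λ^•(L ⊗ ℂ) ⊆ Λ^•ℂᴺ`, the smallest subspace that contains `e_∅ = 1` and is closed under
exterior multiplication by vectors of `L`. -/
def extSub {N : ℕ} (L : Submodule ℝ (Eu N)) : Submodule ℂ (EuclideanSpace ℂ (Finset (Fin N))) :=
  sInf {W | EuclideanSpace.single ∅ 1 ∈ W ∧
    ∀ u ∈ L, ∀ x ∈ W, WithLp.toLp 2 ((wedge (cplx u 0)).mulVec x.ofLp) ∈ W}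

/-- The matrix of the orthogonal projection onto `Λ^•(L ⊗ ℂ)`. -/
def extProj {N : ℕ} (L : Submodule ℝ (Eu N)) : Matrix (Finset (Fin N)) (Finset (Fin N)) ℂ :=
  fun S T => (extSub L).starProjection (EuclideanSpace.single T 1) S

/-! ### The spectra `KO` and `ko` -/

/-- The inclusion `HN N → HN (N+1)`, `x ↦ x`. -/
def incE (N : ℕ) : HN N →L[ℂ] HN (N + 1) :=
  ∑ S : Finset (Fin N), (ins (S.map Fin.castSuccEmb)).comp (prj S)

/-- The inclusion `HN N → HN (N+1)`, `x ↦ x ∧ e` with `e` the last basis vector of `ℂᴺ⁺¹`. -/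
def incO (N : ℕ) : HN N →L[ℂ] HN (N + 1) :=
  ∑ S : Finset (Fin N), (ins (insert (Fin.last N) (S.map Fin.castSuccEmb))).comp (prj S)

/-- The external product of `Q` on `HN N` with the Bott class `(Λ^•ℂ, ε(z))`, on
`HN (N+1) = HN N ⊗ Λ^•ℂ`. -/
def bottMul {N : ℕ} (Q : HN N →L[ℂ] HN N) (z : ℂ) : HN (N + 1) →L[ℂ] HN (N + 1) :=
  let X := damp Q (‖z‖ ^ 2)
  let Y := dampSq (gradN N) Q (‖z‖ ^ 2)
  incE N ∘L X ∘L (incE N).adjoint + incO N ∘L (X - (2 : ℂ) • Y) ∘L (incO N).adjoint +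
    z • (incO N ∘L Y ∘L (incE N).adjoint) + (starRingEnd ℂ z) • (incE N ∘L Y ∘L (incO N).adjoint)

/-- The spectrum `KO`.  Its `N`-th space represents `KOᴺ(Y) = KR⁰(Y ∧ S^{iℝᴺ})`: it consists of the
based maps `ζ ↦ Q ζ` from the one-point compactification of `iℝᴺ` to `KSpace` which are equivariant
for the complex conjugations, with the uniform topology.  The structure maps are the external
products with the Bott class of `ℂ = ℝ ⊕ iℝ`. -/
def KO : Spec where
  X N := Eu N →ᵤ (HN N →L[ℂ] HN N)
  top _ := inferInstance
  carrier N := {a | (∀ ζ, UniformFun.toFun a ζ ∈ KSpace (gradN N)) ∧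
    (∀ ζ v, UniformFun.toFun a (-ζ) (star v) = star (UniformFun.toFun a ζ v)) ∧
    Continuous (UniformFun.toFun a) ∧
    Filter.Tendsto (UniformFun.toFun a) (Filter.cocompact (Eu N)) (𝓝 0)}
  base _ := {UniformFun.ofFun 0}
  pt _ := UniformFun.ofFun 0
  str N a t := UniformFun.ofFun fun ζ => t.elim 0 fun t =>
    bottMul (UniformFun.toFun a (WithLp.toLp 2 (Fin.init (α := fun _ => ℝ) ζ.ofLp)))
      ((t : ℂ) + Complex.I * (ζ (Fin.last N) : ℂ))

/-- The connective spectrum `ko`.  Its `N`-th space is the space of finite configurations in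
`Sᴺ = ℝᴺ ∪ {∞}`, based at `∞`, with pairwise orthogonal labels in the zeroth space
`ℤ × BO` of real operators in `KSpace`.  The topology is such that `m` is near `m'` if
`∑ f(x) m(x)` is near `∑ f(x) m'(x)` for finitely many given functions `f` on `ℝᴺ` vanishing at
infinity.  So labels add when points collide, and points vanish at infinity. -/
def ko : Spec where
  X N := Eu N → (HU →L[ℂ] HU)
  top N := TopologicalSpace.induced
    (fun m (f : ZeroAtInftyContinuousMap (Eu N) ℝ) => ∑ᶠ x, ((f x : ℝ) : ℂ) • m x) inferInstance
  carrier _ := {m | m.support.Finite ∧ (∀ x, m x ∈ KSpace gradU) ∧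
    (∀ x v, m x (star v) = star (m x v)) ∧ ∀ x y, x ≠ y → m x * m y = 0}
  base _ := {0}
  pt _ := 0
  str N m t := fun y => t.elim 0 fun t =>
    if y (Fin.last N) = t then m (WithLp.toLp 2 (Fin.init (α := fun _ => ℝ) y.ofLp)) else 0

/-- The map `ko → KO`: a point `x` with label `Q` goes to the external product of `Q` with the Bott
class `(Λ^•ℂᴺ, ε(x + iζ))`. -/
def koToKO : ∀ N, ko.X N → KO.X N := fun N m => UniformFun.ofFun fun ζ =>
  ∑ᶠ x, ∑ S, ∑ S', ins S ∘L
    extProd gradU (m x) 1 (koszul (cplx x ζ)) (gradExt N) (‖x‖ ^ 2 + ‖ζ‖ ^ 2) S S' ∘L prj S'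

/-! ### The maps defined by representations -/

/-- The orthogonal projection of `HC` onto the closure of the complexification of `W`. -/
def projC (W : Submodule ℝ HR) : HC →L[ℂ] HC :=
  (Submodule.span ℂ {x : HC | ∃ y ∈ W, ∀ k, x k = ((y k : ℝ) : ℂ)}).topologicalClosure.starProjection

/-- The class `W - W₀` of the difference of two real vector spaces: `x ↦ ((1 - p₀)x, p₀x)` embeds
`HC`, graded with odd part `W₀`, in `HK`, and the class is the image of `p - p₀`, where `p`, `p₀`
are the projections onto `W`, `W₀`.  It is the base point if `W = W₀`. -/
def diffClass (W W₀ : Submodule ℝ HR) : HK →L[ℂ] HK :=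
  let T : HC →L[ℂ] HK := ins false ∘L (1 - projC W₀) + ins true ∘L projC W₀
  T ∘L (projC W - projC W₀) ∘L T.adjoint

/-- The universal symbol of the de Rham complex with coefficients in the virtual real vector space
`W - W₀`.  Over `L` the symbol of the de Rham complex at `iξ`, `ξ ∈ L`, is `(Λ^•L_ℂ, ε(iξ))`, a Real
class with compact supports on `iL`.  Under
`KR⁰(X^{iL}) ≅ KR⁰(X^{iL ⊕ Q_ℂ}) = KR⁰(X^Q ∧ S^{iℝᴺ}) = KOᴺ(X^Q) = KO⁰(X^{-L})`,
where the first map is multiplication with the Thom class `(Λ^•Q_ℂ, ε(w + iη))` and `L ⊕ Q = ℝᴺ`,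
it becomes the following: at `w ∈ Q`, `ζ = ξ + η ∈ L ⊕ Q`, the external product of the three
classes `W - W₀`, `(Λ^•L_ℂ, ε(iξ))` with `Λ^•L_ℂ ⊆ Λ^•ℂ^∞`, and `(Λ^•Q_ℂ, ε(w + iη))` with
`Λ^•Q_ℂ ⊆ Λ^•ℂᴺ`. -/
def deRhamSymbol {n N : ℕ} (W W₀ : Submodule ℝ HR) (z : OnePoint (QTot n N)) : KO.X N :=
  UniformFun.ofFun fun ζ => z.elim 0 fun p =>
    let L := plane p.1.1
    let w := p.1.2
    let dL := koszul (cplx 0 (L.starProjection ζ))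
    let dQ := koszul (cplx w (Lᗮ.starProjection ζ))
    ∑ a : Finset (Fin N) × Finset (Fin N), ∑ a' : Finset (Fin N) × Finset (Fin N),
      ins a.2 ∘L ins (a.1.map Fin.valEmbedding) ∘L
        extProd gradK (diffClass W W₀) (extProj L ⊗ₖ extProj Lᗮ) (dL ⊗ₖ 1 + gradExt N ⊗ₖ dQ)
          (gradExt N ⊗ₖ gradExt N) (‖w‖ ^ 2 + ‖ζ‖ ^ 2) a a' ∘L
        prj (a'.1.map Fin.valEmbedding) ∘L prj a'.2

section Reduced

variable (n : ℕ) {B : Type*} [TopologicalSpace B] (b₀ : B) (W : B → Submodule ℝ HR)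

/-- The reduced universal de Rham symbol `MTSO n ∧ B → KO` with coefficients in the reduction
`W - W_{b₀}` of a family `W` of subspaces over `B`. -/
def sigmaBar : ∀ N, (smash (MTSO n) B b₀).X N → KO.X N :=
  fun _ p => deRhamSymbol (W p.2) (W b₀) p.1

/-- The map `(BSO n)₊ ∧ B → ko` induced by the trivial real line over `BSO n` (embedded as
`Λ⁰ ⊆ Λ^•ℂ^∞`) and the reduction `W - W_{b₀}` of a family `W` of subspaces over `B`: the adjoint of
the map of spaces `B → ko₀`. -/
def sigmaBar' : ∀ N, (smash (BSOplus n) B b₀).X N → ko.X N :=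
  fun _ p => OnePoint.elim p.1 (fun _ => 0) fun (z : Gr n _ × Eu _) x => by
    classical exact if x = z.2 then ins ∅ ∘L diffClass (W p.2) (W b₀) ∘L prj ∅ else 0

end Reduced

/-! ### Classifying spaces and the adjoint representation -/

/-- `P` is a universal principal `G`-bundle: it is contractible, and locally over the orbit space
there is an equivariant continuous map to `G`. -/
structure IsUniversalBundle (G P : Type*) [Group G] [TopologicalSpace G] [TopologicalSpace P]
    [MulAction G P] : Prop where
  contractible : ContractibleSpace P
  locallyTrivial : ∀ p : P, ∃ U : Set P, IsOpen U ∧ p ∈ U ∧ (∀ g : G, ∀ x ∈ U, g • x ∈ U) ∧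
    ∃ τ : P → G, ContinuousOn τ U ∧ ∀ g : G, ∀ x ∈ U, τ (g • x) = g * τ x

section Adjoint

variable {E : Type*} [NormedAddCommGroup E] [NormedSpace ℝ E]
  {G : Type*} [TopologicalSpace G] [ChartedSpace E G] [Group G]

/-- The adjoint representation: the derivative at `1` of conjugation by `g`. -/
def Ad (g : G) : GroupLieAlgebra 𝓘(ℝ, E) G →L[ℝ] GroupLieAlgebra 𝓘(ℝ, E) G :=
  (mfderiv 𝓘(ℝ, E) 𝓘(ℝ, E) (fun x : G => g * x * g⁻¹) 1 : E →L[ℝ] E)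

/-- `φ` embeds the adjoint bundle `P ×_G 𝔤` in the trivial bundle with fibre `HR`. -/
structure IsAdjointEmbedding {P : Type*} [TopologicalSpace P] [MulAction G P]
    (φ : P → GroupLieAlgebra 𝓘(ℝ, E) G →L[ℝ] HR) : Prop where
  continuous : Continuous φ
  injective : ∀ p, Function.Injective (φ p)
  equivariant : ∀ (g : G) p v, φ (g • p) (Ad g v) = φ p v

/-- The fibres of the embedded adjoint bundle, as a family over `BG = P/G`. -/
def adFibre {P : Type*} [TopologicalSpace P] [MulAction G P]
    (φ : P → GroupLieAlgebra 𝓘(ℝ, E) G →L[ℝ] HR) (b : MulAction.orbitRel.Quotient G P) :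
    Submodule ℝ HR :=
  ⨆ (p : P) (_ : (Quotient.mk _ p : MulAction.orbitRel.Quotient G P) = b),
    LinearMap.range (φ p).toLinearMap

end Adjoint

end KOSymbol

end

open KOSymbol

/-!
The homotopy is a rotation, given by one formula. A point of `KSpace` stands for `(γ + D)⁻¹` with
`D` odd and self-adjoint; in these terms the label of the adjoint bundle at `b` is
`diffClass W W₀`, where `W` and `W₀` are its fibres at `b` and `b₀`. Over an oriented plane
`L ⊆ ℝᴺ`, a vector `x : ℝᴺ` and `ζ : ℝᴺ`, take the external product of this class with the Koszul
complex `(Λ^•ℂᴺ, ε(x + iζ))`, and place it in `HK ⊗ Λ^•ℂ^∞ ⊗ Λ^•ℂᴺ` along the isometry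
`rotFrame (projMat L) s : Λ^•ℂᴺ → Λ^•ℂᴺ ⊗ Λ^•ℂᴺ = Λ^•(ℂᴺ ⊕ ℂᴺ)`. This is the restriction to
`1 ⊗ Λ^•ℂᴺ` of the action of the rotation by the angle `s · π/2` which at `s = 1` takes `(0, v)` to
`(v, 0)`, for `v ∈ L`, and which is the identity on `Lᗮ ⊕ Lᗮ`. The result is `rotProd`, and
`rotClass` as a family on `(BSO n)₊ ∧ B`.

* At `s = 0` the isometry is `y ↦ 1 ⊗ y`, and the family is `j ∘ σ̄'` (`koToKO_sigmaBar'`).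
* At `s = 1` its range is `Λ^•L_ℂ ⊗ Λ^•(Lᗮ)_ℂ` (`rotFrame_one_mul_conjTranspose`), and if `x ⊥ L`
  it carries the Koszul complex of `x + iζ` to the product of the Koszul complexes of `iξ` on `L_ℂ`
  and of `x + iη` on `(Lᗮ)_ℂ`, where `ζ = ξ + η` (`koszul_mul_rotFrame_one`). This is the de Rham
  symbol, multiplied by the Thom class of the quotient bundle (`rotClass_one`).

So the homotopy which starts at `j ∘ σ̄'` exists on all of `(BSO 2)₊ ∧ B`, and only its end needs
`x ⊥ L`, that is, the restriction along `q`.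

That `rotClass` is a homotopy of maps of spectra (`isHomotopyFrom_rotClass`) rests on three facts.
The external product stays in `KSpace`: by the canonical anticommutation relations the square of
`γ ⊗ g + D ⊗ 1 + γ ⊗ d` is `1 + D² + r`, with `r = ‖x‖² + ‖ζ‖²`, so that the inverse is a
combination of the damped resolvents `Q (1 + r Q²)⁻¹` and `γ Q² (1 + r Q²)⁻¹` of `Q = (γ + D)⁻¹`
(`extK_mul_extK`, `extK_mem_KSpace`). It is compatible with the Bott structure maps: damping by `r`
and then by `t` is damping by `r + t` (`damp_extK`), the Koszul complex on `ℂᴺ⁺¹` is the product of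
those on `ℂᴺ` and `ℂ` (`kosz_succ`), and the rotation is stable in `N` (`rotFrame_stab`); together
these give `bottMul_rotProd`. It is continuous, also at infinity and uniformly in `ζ`: the norm of
`rotProd` is at most a constant over `R` once `‖x‖ ≥ R` or `‖ζ‖ ≥ R`, whatever the other arguments
are (`norm_rotProd_le`). Continuity in `b` comes from the formula `A (A^* A)⁻¹ A^*` for the
projection onto the fibre of the adjoint bundle, with `A` a frame of this fibre
(`continuous_diffClass_adFibre`). At `b₀` the label, and with it the family, is zero.

The null homotopy of `σ̄ ∘ b` is then formal: precompose with `b`, run backwards, and follow by the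
image of the null homotopy of `q ∘ b` (`IsHomotopy.backThen`).
-/

noncomputable section

namespace KOSymbol

/-! ### Maps and homotopies of spectra -/

lemma IsMap.comp {E F K : Spec} {g : ∀ N, F.X N → K.X N} {f : ∀ N, E.X N → F.X N}
    (hg : IsMap F K g) (hf : IsMap E F f) : IsMap E K fun N x => g N (f N x) := by
  intro N
  obtain ⟨cf, mf, bf, sf⟩ := hf N
  obtain ⟨cg, mg, bg, sg⟩ := hg N
  exact ⟨cg.comp cf mf, mg.comp mf, bg.comp bf, fun x hx t => by
    beta_reduce; rw [sf x hx, sg _ (mf hx)]⟩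

lemma IsHomotopyFrom.comp_map {E F K : Spec} {h : ∀ N, F.X N → unitInterval → K.X N}
    {g : ∀ N, F.X N → K.X N} {f : ∀ N, E.X N → F.X N} (hh : IsHomotopyFrom F K h g)
    (hf : IsMap E F f) :
    IsHomotopyFrom E K (fun N x s => h N (f N x) s) fun N x => g N (f N x) := by
  refine ⟨fun N => ?_, fun s => (hh.2.1 s).comp hf, fun N _ hx => hh.2.2 N _ ((hf N).2.1 hx)⟩
  refine (hh.1 N).comp (f := fun p : E.X N × unitInterval => (f N p.1, p.2)) ?_ ?_
  · exact ((hf N).1.comp continuousOn_fst fun p hp => hp.1).prodMk continuousOn_snd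
  · exact fun p hp => ⟨(hf N).2.1 hp.1, trivial⟩

lemma IsHomotopyFrom.map_comp {E F K : Spec} {h : ∀ N, E.X N → unitInterval → F.X N}
    {f : ∀ N, E.X N → F.X N} {g : ∀ N, F.X N → K.X N} (hg : IsMap F K g)
    (hh : IsHomotopyFrom E F h f) :
    IsHomotopyFrom E K (fun N x s => g N (h N x s)) fun N x => g N (f N x) := by
  refine ⟨fun N => ?_, fun s => hg.comp (hh.2.1 s), fun N _ hx => by simp only [hh.2.2 N _ hx]⟩
  exact (hg N).1.comp (hh.1 N) fun p hp => (hh.2.1 p.2 N).2.1 hp.1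

lemma IsHomotopy.comp_map {E F K : Spec} {h : ∀ N, F.X N → unitInterval → K.X N}
    {g g' : ∀ N, F.X N → K.X N} {f : ∀ N, E.X N → F.X N} (hh : IsHomotopy F K h g g')
    (hf : IsMap E F f) :
    IsHomotopy E K (fun N x s => h N (f N x) s) (fun N x => g N (f N x))
      fun N x => g' N (f N x) :=
  ⟨hh.1.comp_map hf, fun N _ hx => hh.2 N _ ((hf N).2.1 hx)⟩

lemma IsNullHomotopy.map_comp {E F K : Spec} {h : ∀ N, E.X N → unitInterval → F.X N}
    {f : ∀ N, E.X N → F.X N} {g : ∀ N, F.X N → K.X N} (hg : IsMap F K g)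
    (hh : IsNullHomotopy E F h f) :
    IsNullHomotopy E K (fun N x s => g N (h N x s)) fun N x => g N (f N x) :=
  ⟨hh.1.map_comp hg, fun N x hx => (hg N).2.2.1 (hh.2 N x hx)⟩

/-- The end of a homotopy of maps of spectra is a map of spectra, also if it is only known
pointwise. -/
lemma IsHomotopy.isMap_right {E F : Spec} {h : ∀ N, E.X N → unitInterval → F.X N}
    {f g : ∀ N, E.X N → F.X N} (hE : ∀ N, E.carrier N = Set.univ) (hh : IsHomotopy E F h f g) :
    IsMap E F g := by
  have : g = fun N x => h N x 1 := by
    funext N x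
    exact (hh.2 N x (by rw [hE]; trivial)).symm
  rw [this]
  exact hh.1.2.1 1

/-- A homotopy from `f` to `g` run backwards, followed by a null homotopy of `f`, is a null
homotopy of `g`. -/
lemma IsHomotopy.backThen {E F : Spec} {h k : ∀ N, E.X N → unitInterval → F.X N}
    {f g : ∀ N, E.X N → F.X N} (hh : IsHomotopy E F h f g) (hk : IsNullHomotopy E F k f) :
    IsNullHomotopy E F (fun N x => KOSymbol.backThen (h N x) (k N x)) g := by
  have h01 : (0 : ℝ) ≤ 1 := zero_le_one
  refine ⟨⟨fun N => ?_, fun s => ?_, fun N x hx => ?_⟩, fun N x hx => ?_⟩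
  · have hs : Continuous fun p : E.X N × unitInterval => (p.2 : ℝ) :=
      continuous_subtype_val.comp continuous_snd
    have ch : ContinuousOn (fun p : E.X N × unitInterval =>
        h N p.1 (Set.projIcc 0 1 h01 (1 - 2 * (p.2 : ℝ)))) (E.carrier N ×ˢ Set.univ) := by
      refine (hh.1.1 N).comp (f := fun p : E.X N × unitInterval =>
        (p.1, Set.projIcc 0 1 h01 (1 - 2 * (p.2 : ℝ)))) ?_ fun p hp => ⟨hp.1, trivial⟩
      exact (continuous_fst.prodMk (continuous_projIcc.comp (by fun_prop))).continuousOn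
    have ck : ContinuousOn (fun p : E.X N × unitInterval =>
        k N p.1 (Set.projIcc 0 1 h01 (2 * (p.2 : ℝ) - 1))) (E.carrier N ×ˢ Set.univ) := by
      refine (hk.1.1 N).comp (f := fun p : E.X N × unitInterval =>
        (p.1, Set.projIcc 0 1 h01 (2 * (p.2 : ℝ) - 1))) ?_ fun p hp => ⟨hp.1, trivial⟩
      exact (continuous_fst.prodMk (continuous_projIcc.comp (by fun_prop))).continuousOn
    rw [continuousOn_iff_continuous_domRestrict] at ch ck ⊢
    refine Continuous.if_le (f := fun p : ↥(E.carrier N ×ˢ (Set.univ : Set unitInterval)) =>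
      ((p.1.2 : unitInterval) : ℝ)) (g := fun _ => 1 / 2) ch ck (hs.comp continuous_subtype_val)
      continuous_const ?_
    rintro ⟨⟨x, s⟩, hx⟩ hs'
    have hs2 : (s : ℝ) = 1 / 2 := hs'
    have e1 : Set.projIcc (0 : ℝ) 1 h01 (1 - 2 * (s : ℝ)) = 0 := by
      rw [hs2]; norm_num
    have e2 : Set.projIcc (0 : ℝ) 1 h01 (2 * (s : ℝ) - 1) = 0 := by
      rw [hs2]; norm_num
    rw [e1, e2, hh.1.2.2 N x hx.1, hk.1.2.2 N x hx.1]
  · by_cases hs : (s : ℝ) ≤ 1 / 2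
    · simpa only [KOSymbol.backThen, if_pos hs] using hh.1.2.1 _
    · simpa only [KOSymbol.backThen, if_neg hs] using hk.1.2.1 _
  · have : (((0 : unitInterval) : ℝ)) ≤ 1 / 2 := by norm_num
    simp only [KOSymbol.backThen, if_pos this]
    rw [← hh.2 N x hx]
    congr 1
    simp
  · have : ¬ (((1 : unitInterval) : ℝ)) ≤ 1 / 2 := by norm_num
    simp only [KOSymbol.backThen, if_neg this]
    have e : Set.projIcc (0 : ℝ) 1 h01 (2 * ((1 : unitInterval) : ℝ) - 1) = 1 := by
      norm_num
    rw [e]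
    exact hk.2 N x hx

/-! ### Exterior multiplication and the canonical anticommutation relations -/

section Exterior

variable {N : ℕ}

/-- The index in `Fin (N+1)` of a basis vector `e_S` of `Λ^•ℂᴺ ⊆ Λ^•ℂᴺ⁺¹`. -/
def castS (S : Finset (Fin N)) : Finset (Fin (N + 1)) := S.map Fin.castSuccEmb

/-- The index of the basis vector `e_S ∧ e_N` of `Λ^•ℂᴺ⁺¹`. -/
def lastS (S : Finset (Fin N)) : Finset (Fin (N + 1)) := insert (Fin.last N) (castS S)

@[simp] lemma castSucc_mem_castS {S : Finset (Fin N)} {i : Fin N} :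
    i.castSucc ∈ castS S ↔ i ∈ S := by
  simp [castS]

@[simp] lemma last_notMem_castS {S : Finset (Fin N)} : Fin.last N ∉ castS S := by
  simp [castS, Fin.castSucc_ne_last]

@[simp] lemma castSucc_mem_lastS {S : Finset (Fin N)} {i : Fin N} :
    i.castSucc ∈ lastS S ↔ i ∈ S := by
  simp [lastS, Fin.castSucc_ne_last]

@[simp] lemma last_mem_lastS {S : Finset (Fin N)} : Fin.last N ∈ lastS S := by
  simp [lastS]

lemma finset_ext_iff_castSucc {S T : Finset (Fin (N + 1))} :
    S = T ↔ (∀ i : Fin N, i.castSucc ∈ S ↔ i.castSucc ∈ T) ∧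
      (Fin.last N ∈ S ↔ Fin.last N ∈ T) := by
  rw [Finset.ext_iff]
  constructor
  · exact fun h => ⟨fun i => h _, h _⟩
  · rintro ⟨h, h'⟩ i
    exact Fin.lastCases h' h i

@[simp] lemma castS_inj {S T : Finset (Fin N)} : castS S = castS T ↔ S = T := by
  simp [castS]

@[simp] lemma lastS_inj {S T : Finset (Fin N)} : lastS S = lastS T ↔ S = T := by
  rw [finset_ext_iff_castSucc, Finset.ext_iff]
  simp

@[simp] lemma castS_ne_lastS {S T : Finset (Fin N)} : castS S ≠ lastS T := by
  intro h
  have := last_mem_lastS (S := T)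
  rw [← h] at this
  exact last_notMem_castS this

@[simp] lemma lastS_ne_castS {S T : Finset (Fin N)} : lastS S ≠ castS T :=
  castS_ne_lastS.symm

@[simp] lemma card_castS (S : Finset (Fin N)) : (castS S).card = S.card := by
  simp [castS]

@[simp] lemma card_lastS (S : Finset (Fin N)) : (lastS S).card = S.card + 1 := by
  rw [lastS, Finset.card_insert_of_notMem last_notMem_castS, card_castS]

@[simp] lemma castS_empty : castS (∅ : Finset (Fin N)) = ∅ := by
  simp [castS]

@[simp] lemma castS_insert (i : Fin N) (S : Finset (Fin N)) :
    castS (insert i S) = insert i.castSucc (castS S) := by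
  simp [castS, Finset.map_insert]

lemma map_val_castS (S : Finset (Fin N)) :
    (castS S).map Fin.valEmbedding = S.map Fin.valEmbedding := by
  rw [castS, Finset.map_map]
  rfl

/-- `Λ^•ℂᴺ⁺¹ = Λ^•ℂᴺ ⊕ Λ^•ℂᴺ ∧ e_N`, on the level of bases. -/
def splitS (N : ℕ) : Finset (Fin N) ⊕ Finset (Fin N) ≃ Finset (Fin (N + 1)) :=
  Equiv.ofBijective (Sum.elim castS lastS) <| by
    constructor
    · rintro (S | S) (T | T) h <;> simp at h <;> simp [h]
    · intro S
      let T : Finset (Fin N) := Finset.univ.filter fun i => i.castSucc ∈ S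
      by_cases h : Fin.last N ∈ S
      · exact ⟨Sum.inr T, by rw [finset_ext_iff_castSucc]; simp [T, h]⟩
      · exact ⟨Sum.inl T, by rw [finset_ext_iff_castSucc]; simp [T, h]⟩

@[simp] lemma splitS_inl (S : Finset (Fin N)) : splitS N (Sum.inl S) = castS S := rfl

@[simp] lemma splitS_inr (S : Finset (Fin N)) : splitS N (Sum.inr S) = lastS S := rfl

lemma sum_splitS {M : Type*} [AddCommMonoid M] (f : Finset (Fin (N + 1)) → M) :
    ∑ S, f S = ∑ S, f (castS S) + ∑ S, f (lastS S) := by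
  rw [← (splitS N).sum_comp, Fintype.sum_sum_type]
  rfl

/-- `fromBlocks`, in the basis of `Λ^•ℂᴺ⁺¹`. -/
def blocks (A B C D : Matrix (Finset (Fin N)) (Finset (Fin N)) ℂ) :
    Matrix (Finset (Fin (N + 1))) (Finset (Fin (N + 1))) ℂ :=
  Matrix.reindex (splitS N) (splitS N) (Matrix.fromBlocks A B C D)

lemma blocks_mul (A B C D A' B' C' D' : Matrix (Finset (Fin N)) (Finset (Fin N)) ℂ) :
    blocks A B C D * blocks A' B' C' D' =
      blocks (A * A' + B * C') (A * B' + B * D') (C * A' + D * C') (C * B' + D * D') := by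
  rw [blocks, blocks, blocks, ← Matrix.fromBlocks_multiply]
  simp

lemma blocks_add (A B C D A' B' C' D' : Matrix (Finset (Fin N)) (Finset (Fin N)) ℂ) :
    blocks A B C D + blocks A' B' C' D' =
      blocks (A + A') (B + B') (C + C') (D + D') := by
  rw [blocks, blocks, blocks, ← Matrix.fromBlocks_add]
  rfl

lemma blocks_conjTranspose (A B C D : Matrix (Finset (Fin N)) (Finset (Fin N)) ℂ) :
    (blocks A B C D).conjTranspose =
      blocks A.conjTranspose C.conjTranspose B.conjTranspose D.conjTranspose := by
  rw [blocks, blocks, ← Matrix.fromBlocks_conjTranspose]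
  rfl

lemma blocks_one : blocks (1 : Matrix (Finset (Fin N)) (Finset (Fin N)) ℂ) 0 0 1 = 1 := by
  rw [blocks, Matrix.fromBlocks_one]
  simp

lemma blocks_zero : blocks (0 : Matrix (Finset (Fin N)) (Finset (Fin N)) ℂ) 0 0 0 = 0 := by
  rw [blocks, Matrix.fromBlocks_zero]
  simp

lemma blocks_smul (c : ℂ) (A B C D : Matrix (Finset (Fin N)) (Finset (Fin N)) ℂ) :
    c • blocks A B C D = blocks (c • A) (c • B) (c • C) (c • D) := by
  rw [blocks, blocks, ← Matrix.fromBlocks_smul]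
  rfl

@[simp] lemma blocks_cc (A B C D : Matrix (Finset (Fin N)) (Finset (Fin N)) ℂ) (S T) :
    blocks A B C D (castS S) (castS T) = A S T := by
  rw [← splitS_inl, ← splitS_inl]; simp [blocks, -splitS_inl]

@[simp] lemma blocks_cl (A B C D : Matrix (Finset (Fin N)) (Finset (Fin N)) ℂ) (S T) :
    blocks A B C D (castS S) (lastS T) = B S T := by
  rw [← splitS_inl, ← splitS_inr]; simp [blocks, -splitS_inl, -splitS_inr]

@[simp] lemma blocks_lc (A B C D : Matrix (Finset (Fin N)) (Finset (Fin N)) ℂ) (S T) :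
    blocks A B C D (lastS S) (castS T) = C S T := by
  rw [← splitS_inl, ← splitS_inr]; simp [blocks, -splitS_inl, -splitS_inr]

@[simp] lemma blocks_ll (A B C D : Matrix (Finset (Fin N)) (Finset (Fin N)) ℂ) (S T) :
    blocks A B C D (lastS S) (lastS T) = D S T := by
  rw [← splitS_inr, ← splitS_inr]; simp [blocks, -splitS_inr]

lemma ext_blocks {A B : Matrix (Finset (Fin (N + 1))) (Finset (Fin (N + 1))) ℂ}
    (h1 : ∀ S T, A (castS S) (castS T) = B (castS S) (castS T))
    (h2 : ∀ S T, A (castS S) (lastS T) = B (castS S) (lastS T))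
    (h3 : ∀ S T, A (lastS S) (castS T) = B (lastS S) (castS T))
    (h4 : ∀ S T, A (lastS S) (lastS T) = B (lastS S) (lastS T)) : A = B := by
  ext S T
  obtain ⟨S | S, rfl⟩ := (splitS N).surjective S <;>
    obtain ⟨T | T, rfl⟩ := (splitS N).surjective T
  exacts [h1 S T, h2 S T, h3 S T, h4 S T]

lemma gradExt_succ : gradExt (N + 1) = blocks (gradExt N) 0 0 (-gradExt N) := by
  refine ext_blocks (fun S T => ?_) (fun S T => ?_) (fun S T => ?_) (fun S T => ?_) <;>
    simp [gradExt, Matrix.diagonal_apply, pow_succ]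

lemma filter_castSucc_card (S : Finset (Fin N)) (i : Fin N) :
    ((castS S).filter (· < i.castSucc)).card = (S.filter (· < i)).card := by
  rw [castS, Finset.filter_map, Finset.card_map]
  congr 1

lemma wedge_succ (v : Fin (N + 1) → ℂ) :
    wedge v = blocks (wedge fun i => v i.castSucc) 0 (v (Fin.last N) • gradExt N)
      (wedge fun i => v i.castSucc) := by
  have h3 : ∀ (S : Finset (Fin N)) (i : Fin N),
      ((lastS S).filter (· < i.castSucc)).card = (S.filter (· < i)).card := by
    intro S i
    rw [lastS, Finset.filter_insert, if_neg (by simp [Fin.le_last]), filter_castSucc_card]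
  have h4 : ∀ S : Finset (Fin N), ((castS S).filter (· < Fin.last N)).card = S.card := by
    intro S
    rw [Finset.filter_true_of_mem, card_castS]
    intro i hi
    simp only [castS, Finset.mem_map, Fin.castSuccEmb_apply] at hi
    obtain ⟨j, -, rfl⟩ := hi
    exact Fin.castSucc_lt_last j
  have e1 : ∀ (i : Fin N) (S : Finset (Fin N)),
      insert i.castSucc (castS S) = castS (insert i S) := fun i S => (castS_insert i S).symm
  have e2 : ∀ (i : Fin N) (S : Finset (Fin N)),
      insert i.castSucc (lastS S) = lastS (insert i S) := fun i S => by
    rw [lastS, Finset.insert_comm, e1, lastS]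
  have e3 : ∀ (S : Finset (Fin N)), insert (Fin.last N) (castS S) = lastS S := fun S => rfl
  refine ext_blocks (fun S T => ?_) (fun S T => ?_) (fun S T => ?_) (fun S T => ?_) <;>
    simp only [wedge, blocks_cc, blocks_cl, blocks_lc, blocks_ll, Fin.sum_univ_castSucc,
      castSucc_mem_castS, castSucc_mem_lastS, last_notMem_castS, last_mem_lastS, e1, e2, e3,
      filter_castSucc_card, h3, h4, castS_inj, lastS_inj, castS_ne_lastS, lastS_ne_castS]
  · simp
  · simp
  · simp [gradExt, Matrix.diagonal_apply, mul_comm]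
    split_ifs with h
    · rw [h]
    · rfl
  · simp

lemma wedge_zero_dim (v : Fin 0 → ℂ) : wedge v = 0 := by
  ext S T
  simp [wedge]

@[simp] lemma gradExt_mul_self (N : ℕ) : gradExt N * gradExt N = 1 := by
  rw [gradExt, Matrix.diagonal_mul_diagonal, ← Matrix.diagonal_one]
  congr 1
  ext S
  rw [← mul_pow]
  simp

@[simp] lemma gradExt_conjTranspose (N : ℕ) : (gradExt N).conjTranspose = gradExt N := by
  rw [gradExt, Matrix.diagonal_conjTranspose]
  congr 1
  ext S
  simp

lemma wedge_add (u v : Fin N → ℂ) : wedge (u + v) = wedge u + wedge v := by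
  ext S T
  simp only [wedge, Matrix.add_apply, ← Finset.sum_add_distrib, Pi.add_apply]
  exact Finset.sum_congr rfl fun i _ => by split_ifs <;> ring

lemma wedge_smul (c : ℂ) (v : Fin N → ℂ) : wedge (c • v) = c • wedge v := by
  ext S T
  simp only [wedge, Matrix.smul_apply, Pi.smul_apply, smul_eq_mul, Finset.mul_sum]
  exact Finset.sum_congr rfl fun i _ => by split_ifs <;> ring

lemma wedge_eq_sum (v : Fin N → ℂ) : wedge v = ∑ i, v i • wedge (Pi.single i 1) := by
  let w : (Fin N → ℂ) →ₗ[ℂ] Matrix (Finset (Fin N)) (Finset (Fin N)) ℂ :=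
    { toFun := wedge, map_add' := wedge_add, map_smul' := wedge_smul }
  have := w.pi_apply_eq_sum_univ v
  simp only [w, LinearMap.coe_mk, AddHom.coe_mk] at this
  rw [this]
  refine Finset.sum_congr rfl fun i _ => ?_
  congr 2
  ext j
  simp [Pi.single_apply, eq_comm]

lemma gradExt_mul_wedge (v : Fin N → ℂ) : gradExt N * wedge v = -(wedge v * gradExt N) := by
  induction N with
  | zero => simp [wedge_zero_dim]
  | succ N ih =>
    rw [gradExt_succ, wedge_succ, blocks_mul, blocks_mul,
      ← neg_one_smul ℂ (blocks ((wedge _) * _ + _) _ _ _), blocks_smul]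
    simp [ih]

lemma wedge_mul_wedge (u v : Fin N → ℂ) : wedge u * wedge v + wedge v * wedge u = 0 := by
  induction N with
  | zero => simp [wedge_zero_dim]
  | succ N ih =>
    rw [wedge_succ u, wedge_succ v, blocks_mul, blocks_mul, blocks_add, ← blocks_zero]
    congr 1
    · simpa using ih _ _
    · simp
    · simp only [Matrix.smul_mul, Matrix.mul_smul, gradExt_mul_wedge]
      module
    · simpa using ih _ _

lemma wedge_mul_conjTranspose (u v : Fin N → ℂ) :
    wedge u * (wedge v).conjTranspose + (wedge v).conjTranspose * wedge u =
      (∑ k, u k * star (v k)) • 1 := by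
  induction N with
  | zero => simp [wedge_zero_dim]
  | succ N ih =>
    have h : (wedge fun i : Fin N => v i.castSucc).conjTranspose * gradExt N =
        -(gradExt N * (wedge fun i : Fin N => v i.castSucc).conjTranspose) := by
      have := congrArg Matrix.conjTranspose (gradExt_mul_wedge fun i : Fin N => v i.castSucc)
      simpa [Matrix.conjTranspose_mul] using this
    have hi := ih (fun i => u i.castSucc) fun i => v i.castSucc
    rw [wedge_succ u, wedge_succ v, blocks_conjTranspose, blocks_mul, blocks_mul, blocks_add,
      ← blocks_one, blocks_smul]
    simp only [Matrix.conjTranspose_smul, gradExt_conjTranspose, Matrix.smul_mul, Matrix.mul_smul,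
      Matrix.conjTranspose_zero, Matrix.mul_zero, Matrix.zero_mul, gradExt_mul_self, add_zero,
      zero_add, Fin.sum_univ_castSucc, add_smul, smul_zero, h, gradExt_mul_wedge, ← hi]
    congr 1
    · module
    · module
    · module
    · module

lemma koszul_conjTranspose (v : Fin N → ℂ) : (koszul v).conjTranspose = koszul v := by
  simp [koszul, add_comm]

lemma conjTranspose_wedge_mul_gradExt (v : Fin N → ℂ) :
    (wedge v).conjTranspose * gradExt N = -(gradExt N * (wedge v).conjTranspose) := by
  have := congrArg Matrix.conjTranspose (gradExt_mul_wedge v)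
  simpa [Matrix.conjTranspose_mul] using this

lemma koszul_mul_gradExt (v : Fin N → ℂ) :
    koszul v * gradExt N = -(gradExt N * koszul v) := by
  rw [koszul, add_mul, mul_add, conjTranspose_wedge_mul_gradExt, gradExt_mul_wedge]
  abel

lemma koszul_mul_self (v : Fin N → ℂ) :
    koszul v * koszul v = (∑ k, v k * star (v k)) • 1 := by
  have h1 : wedge v * wedge v = 0 := by
    have := wedge_mul_wedge v v
    rwa [← two_smul ℂ, smul_eq_zero_iff_right two_ne_zero] at this
  have h2 := congrArg Matrix.conjTranspose h1
  rw [Matrix.conjTranspose_mul, Matrix.conjTranspose_zero] at h2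
  rw [← wedge_mul_conjTranspose, koszul, add_mul, mul_add, mul_add, h1, h2]
  abel

lemma koszul_succ (v : Fin (N + 1) → ℂ) :
    koszul v = blocks (koszul fun i => v i.castSucc) (star (v (Fin.last N)) • gradExt N)
      (v (Fin.last N) • gradExt N) (koszul fun i => v i.castSucc) := by
  rw [koszul, wedge_succ, blocks_conjTranspose, blocks_add]
  simp [koszul]

/-- `koszul v + g - 1`, the matrix `d + g - 1` of the external product with a Koszul complex. -/
def kosz (v : Fin N → ℂ) : Matrix (Finset (Fin N)) (Finset (Fin N)) ℂ :=
  koszul v + gradExt N - 1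

lemma kosz_conjTranspose (v : Fin N → ℂ) : (kosz v).conjTranspose = kosz v := by
  simp [kosz, koszul_conjTranspose]

lemma kosz_mul_self (v : Fin N → ℂ) :
    kosz v * kosz v = (∑ k, v k * star (v k)) • 1 - (2 : ℂ) • kosz v := by
  have h := koszul_mul_gradExt v
  have h2 := koszul_mul_self v
  have h3 := gradExt_mul_self N
  simp only [kosz, add_mul, sub_mul, mul_add, mul_sub, h, h2, h3, one_mul, mul_one]
  module

lemma kosz_mul_gradExt (v : Fin N → ℂ) :
    kosz v * gradExt N + gradExt N * kosz v = -((2 : ℂ) • (gradExt N - 1)) := by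
  have h := koszul_mul_gradExt v
  have h3 := gradExt_mul_self N
  simp only [kosz, add_mul, sub_mul, mul_add, mul_sub, h, h3, one_mul, mul_one]
  module

lemma kosz_succ (v : Fin (N + 1) → ℂ) :
    kosz v = blocks (kosz fun i => v i.castSucc) (star (v (Fin.last N)) • gradExt N)
      (v (Fin.last N) • gradExt N)
      ((kosz fun i => v i.castSucc) - (2 : ℂ) • gradExt N) := by
  have : (-1 : Matrix (Finset (Fin (N + 1))) (Finset (Fin (N + 1))) ℂ) = blocks (-1) 0 0 (-1) := by
    rw [← blocks_one, ← neg_one_smul ℂ, blocks_smul]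
    simp
  rw [kosz, koszul_succ, gradExt_succ, sub_eq_add_neg, this, blocks_add, blocks_add]
  simp only [kosz, add_zero, sub_eq_add_neg]
  congr 1
  module

lemma wedge_map_star (v : Fin N → ℂ) : (wedge v).map star = wedge (star v) := by
  ext S T
  simp only [wedge, Matrix.map_apply, Pi.star_apply, star_sum]
  refine Finset.sum_congr rfl fun i _ => ?_
  split_ifs <;> simp

lemma kosz_star_apply (v : Fin N → ℂ) (S T : Finset (Fin N)) :
    kosz (star v) S T = star (kosz v S T) := by
  simp only [kosz, koszul, Matrix.sub_apply, Matrix.add_apply, Matrix.conjTranspose_apply,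
    ← wedge_map_star, Matrix.map_apply, star_sub, star_add, star_star]
  congr 2
  · rw [gradExt, Matrix.diagonal_apply]
    split_ifs <;> simp
  · rw [Matrix.one_apply]
    split_ifs <;> simp

lemma sum_cplx (x y : Eu N) : ∑ k, cplx x y k * star (cplx x y k) =
    ((‖x‖ ^ 2 + ‖y‖ ^ 2 : ℝ) : ℂ) := by
  rw [EuclideanSpace.norm_sq_eq, EuclideanSpace.norm_sq_eq, ← Finset.sum_add_distrib]
  push_cast
  refine Finset.sum_congr rfl fun k _ => ?_
  simp only [cplx, Real.norm_eq_abs, ← Complex.ofReal_pow, sq_abs, star_add, star_mul']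
  simp only [Complex.star_def, Complex.conj_ofReal, Complex.conj_I]
  push_cast
  linear_combination (-(y k : ℂ) ^ 2) * Complex.I_sq

lemma star_cplx (x y : Eu N) : star (cplx x y) = cplx x (-y) := by
  ext k
  simp [cplx]

/-- `Λ^•ℂᴺ` is generated by `1` under exterior multiplication by real vectors. -/
lemma mem_of_wedge_mem (W : Submodule ℂ (Finset (Fin N) → ℂ)) (h0 : Pi.single ∅ 1 ∈ W)
    (hW : ∀ i, ∀ x ∈ W, (wedge (Pi.single i 1)).mulVec x ∈ W) (x : Finset (Fin N) → ℂ) :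
    x ∈ W := by
  have h : ∀ S : Finset (Fin N), (Pi.single S 1 : Finset (Fin N) → ℂ) ∈ W := by
    intro S
    induction S using Finset.induction_on with
    | empty => exact h0
    | insert i S hi ih =>
      have h1 := hW i _ ih
      have h2 : (wedge (Pi.single i 1)).mulVec (Pi.single S 1) =
          ((-1) ^ (S.filter (· < i)).card : ℂ) • (Pi.single (insert i S) 1 : _ → ℂ) := by
        ext T
        rw [Matrix.mulVec_single_one]
        simp only [Matrix.col_apply, wedge, Pi.smul_apply, Pi.single_apply, smul_eq_mul]
        rw [Finset.sum_eq_single i]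
        · simp [hi]
        · intro j _ hj
          simp [hj]
        · simp
      rw [h2] at h1
      have h3 := W.smul_mem ((-1) ^ (S.filter (· < i)).card : ℂ) h1
      rwa [smul_smul, ← mul_pow, neg_one_mul, neg_neg, one_pow, one_smul] at h3
  have : x = ∑ S, x S • (Pi.single S 1 : Finset (Fin N) → ℂ) := by
    ext T
    simp [Pi.single_apply]
  rw [this]
  exact Submodule.sum_mem _ fun S _ => W.smul_mem _ (h S)

end Exterior

/-! ### The rotation of `L ⊆ ℝᴺ` into a second copy of `ℝᴺ` -/

section Rotation

variable {N : ℕ}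

/-- The square matrices on `Λ^•ℂᴺ ⊗ Λ^•ℂᴺ = Λ^•(ℂᴺ ⊕ ℂᴺ)`. -/
abbrev Mat2 (N : ℕ) : Type :=
  Matrix (Finset (Fin N) × Finset (Fin N)) (Finset (Fin N) × Finset (Fin N)) ℂ

/-- Exterior multiplication by `(v, 0)` on `Λ^•(ℂᴺ ⊕ ℂᴺ)`. -/
def cre1 (v : Fin N → ℂ) : Mat2 N := wedge v ⊗ₖ 1

/-- Exterior multiplication by `(0, v)` on `Λ^•(ℂᴺ ⊕ ℂᴺ)`. -/
def cre2 (v : Fin N → ℂ) : Mat2 N := gradExt N ⊗ₖ wedge v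

lemma cre1_add (u v : Fin N → ℂ) : cre1 (u + v) = cre1 u + cre1 v := by
  rw [cre1, wedge_add, Matrix.add_kronecker]; rfl

lemma cre2_add (u v : Fin N → ℂ) : cre2 (u + v) = cre2 u + cre2 v := by
  rw [cre2, wedge_add, Matrix.kronecker_add]; rfl

lemma cre1_eq_sum (v : Fin N → ℂ) :
    cre1 v = ∑ i, v i • (wedge (Pi.single i 1) ⊗ₖ (1 : Matrix _ _ ℂ)) := by
  ext a b
  rw [cre1, wedge_eq_sum]
  simp [Matrix.kroneckerMap_apply, Matrix.sum_apply, Finset.sum_mul, mul_assoc]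

lemma cre2_eq_sum (v : Fin N → ℂ) :
    cre2 v = ∑ i, v i • (gradExt N ⊗ₖ wedge (Pi.single i 1)) := by
  ext a b
  rw [cre2, wedge_eq_sum]
  simp [Matrix.kroneckerMap_apply, Matrix.sum_apply, Finset.mul_sum, mul_left_comm]

/-- The operator `∑ pᵢⱼ a₁(eᵢ) a₂(eⱼ)^*` on `Λ^•(ℂᴺ ⊕ ℂᴺ)`, with `a₁ = cre1`, `a₂ = cre2`. -/
def rotC (p : Matrix (Fin N) (Fin N) ℝ) : Mat2 N :=
  ∑ i, ∑ j, (p i j : ℂ) •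
    ((wedge (Pi.single i 1) * gradExt N) ⊗ₖ (wedge (Pi.single j 1)).conjTranspose)

/-- The infinitesimal generator of the rotations `(0, v) ↦ (sin t · v, cos t · v)`, for `v` in the
range of the projection matrix `p`, on `Λ^•(ℂᴺ ⊕ ℂᴺ)`. -/
def rotK (p : Matrix (Fin N) (Fin N) ℝ) : Mat2 N := rotC p - (rotC p).conjTranspose

/-- The action of the rotation by the angle `s · π/2` on `Λ^•(ℂᴺ ⊕ ℂᴺ)`. -/
def rot (p : Matrix (Fin N) (Fin N) ℝ) (s : ℝ) : Mat2 N :=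
  NormedSpace.exp (((s * (Real.pi / 2) : ℝ) : ℂ) • rotK p)

lemma rotC_conjTranspose (p : Matrix (Fin N) (Fin N) ℝ) :
    (rotC p).conjTranspose = ∑ i, ∑ j, (p i j : ℂ) •
      ((gradExt N * (wedge (Pi.single i 1)).conjTranspose) ⊗ₖ wedge (Pi.single j 1)) := by
  simp only [rotC, Matrix.conjTranspose_sum, Matrix.conjTranspose_smul,
    Matrix.conjTranspose_kronecker, Matrix.conjTranspose_mul, gradExt_conjTranspose,
    Matrix.conjTranspose_conjTranspose, Complex.star_def, Complex.conj_ofReal]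

lemma conjTranspose_single_mul_wedge (j : Fin N) (v : Fin N → ℂ) :
    (wedge (Pi.single j 1)).conjTranspose * wedge v =
      v j • 1 - wedge v * (wedge (Pi.single j 1)).conjTranspose := by
  rw [eq_sub_iff_add_eq', wedge_mul_conjTranspose]
  congr 1
  simp [Pi.single_apply, apply_ite]

lemma rotC_mul_cre2 (p : Matrix (Fin N) (Fin N) ℝ) (v : Fin N → ℂ) :
    rotC p * cre2 v = cre2 v * rotC p + cre1 ((p.map Complex.ofReal).mulVec v) := by
  have h1 : cre1 ((p.map Complex.ofReal).mulVec v) =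
      ∑ i, ∑ j, (p i j : ℂ) • (v j • (wedge (Pi.single i 1) ⊗ₖ (1 : Matrix _ _ ℂ))) := by
    rw [cre1_eq_sum]
    simp [Matrix.mulVec, dotProduct, Finset.sum_smul, mul_smul]
  rw [h1, rotC, Finset.sum_mul, Finset.mul_sum, ← Finset.sum_add_distrib]
  refine Finset.sum_congr rfl fun i _ => ?_
  rw [Finset.sum_mul, Finset.mul_sum, ← Finset.sum_add_distrib]
  refine Finset.sum_congr rfl fun j _ => ?_
  rw [smul_mul_assoc, mul_smul_comm, ← smul_add, cre2, ← Matrix.mul_kronecker_mul,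
    ← Matrix.mul_kronecker_mul, conjTranspose_single_mul_wedge, mul_assoc, gradExt_mul_self,
    mul_one, ← mul_assoc, gradExt_mul_wedge, neg_mul, mul_assoc, gradExt_mul_self, mul_one,
    sub_eq_add_neg, Matrix.kronecker_add, Matrix.kronecker_smul, ← neg_one_smul ℂ (_ * _),
    ← neg_one_smul ℂ (wedge (Pi.single i 1)), Matrix.kronecker_smul, Matrix.smul_kronecker]
  congr 1
  abel

lemma rotC_conjTranspose_mul_cre2 (p : Matrix (Fin N) (Fin N) ℝ) (v : Fin N → ℂ) :
    (rotC p).conjTranspose * cre2 v = cre2 v * (rotC p).conjTranspose := by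
  rw [rotC_conjTranspose, Finset.sum_mul, Finset.mul_sum]
  refine Finset.sum_congr rfl fun i _ => ?_
  rw [Finset.sum_mul, Finset.mul_sum]
  refine Finset.sum_congr rfl fun j _ => ?_
  have h : wedge (Pi.single j 1) * wedge v = -(wedge v * wedge (Pi.single j 1)) :=
    eq_neg_of_add_eq_zero_left (wedge_mul_wedge _ _)
  rw [smul_mul_assoc, mul_smul_comm, cre2, ← Matrix.mul_kronecker_mul,
    ← Matrix.mul_kronecker_mul, mul_assoc, conjTranspose_wedge_mul_gradExt, mul_neg, h,
    ← neg_one_smul ℂ (_ * _), ← neg_one_smul ℂ (wedge v * _), Matrix.kronecker_smul,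
    Matrix.smul_kronecker, smul_smul]
  simp

lemma rotC_mul_cre1 (p : Matrix (Fin N) (Fin N) ℝ) (v : Fin N → ℂ) :
    rotC p * cre1 v = cre1 v * rotC p := by
  rw [rotC, Finset.sum_mul, Finset.mul_sum]
  refine Finset.sum_congr rfl fun i _ => ?_
  rw [Finset.sum_mul, Finset.mul_sum]
  refine Finset.sum_congr rfl fun j _ => ?_
  have h : wedge (Pi.single i 1) * wedge v = -(wedge v * wedge (Pi.single i 1)) :=
    eq_neg_of_add_eq_zero_left (wedge_mul_wedge _ _)
  rw [smul_mul_assoc, mul_smul_comm, cre1, ← Matrix.mul_kronecker_mul,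
    ← Matrix.mul_kronecker_mul, mul_assoc, gradExt_mul_wedge, mul_neg, ← mul_assoc, h, neg_mul,
    neg_neg, mul_one, one_mul, mul_assoc]

lemma rotC_conjTranspose_mul_cre1 (p : Matrix (Fin N) (Fin N) ℝ) (v : Fin N → ℂ) :
    (rotC p).conjTranspose * cre1 v =
      cre1 v * (rotC p).conjTranspose + cre2 ((p.transpose.map Complex.ofReal).mulVec v) := by
  have h1 : cre2 ((p.transpose.map Complex.ofReal).mulVec v) =
      ∑ i, ∑ j, (p i j : ℂ) • (v i • (gradExt N ⊗ₖ (wedge (Pi.single j 1)))) := by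
    rw [Finset.sum_comm, cre2_eq_sum]
    simp [Matrix.mulVec, dotProduct, Finset.sum_smul, mul_smul]
  rw [h1, rotC_conjTranspose, Finset.sum_mul, Finset.mul_sum, ← Finset.sum_add_distrib]
  refine Finset.sum_congr rfl fun i _ => ?_
  rw [Finset.sum_mul, Finset.mul_sum, ← Finset.sum_add_distrib]
  refine Finset.sum_congr rfl fun j _ => ?_
  rw [smul_mul_assoc, mul_smul_comm, ← smul_add, cre1, ← Matrix.mul_kronecker_mul,
    ← Matrix.mul_kronecker_mul, mul_assoc, conjTranspose_single_mul_wedge, ← mul_assoc,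
    show wedge v * gradExt N = -(gradExt N * wedge v) by rw [gradExt_mul_wedge, neg_neg],
    mul_sub, neg_mul, mul_assoc, mul_one, one_mul, mul_smul_comm, mul_one, sub_eq_add_neg,
    Matrix.add_kronecker, Matrix.smul_kronecker]
  congr 1
  abel

lemma rotK_mul_cre2 (p : Matrix (Fin N) (Fin N) ℝ) (v : Fin N → ℂ) :
    rotK p * cre2 v = cre2 v * rotK p + cre1 ((p.map Complex.ofReal).mulVec v) := by
  rw [rotK, sub_mul, mul_sub, rotC_mul_cre2, rotC_conjTranspose_mul_cre2]
  abel

lemma rotK_mul_cre1 (p : Matrix (Fin N) (Fin N) ℝ) (v : Fin N → ℂ) :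
    rotK p * cre1 v = cre1 v * rotK p - cre2 ((p.transpose.map Complex.ofReal).mulVec v) := by
  rw [rotK, sub_mul, mul_sub, rotC_mul_cre1, rotC_conjTranspose_mul_cre1]
  abel

lemma hasSum_matrix_exp {k : Type*} [Fintype k] [DecidableEq k] (A : Matrix k k ℂ) :
    HasSum (fun j : ℕ => ((j.factorial : ℂ)⁻¹) • A ^ j) (NormedSpace.exp A) := by
  open scoped Matrix.Norms.Operator in exact NormedSpace.exp_series_hasSum_exp' A

/-- An intertwiner of two matrices intertwines their exponentials. -/
lemma exp_mul_of_mul_eq {m n : Type*} [Fintype m] [Fintype n] [DecidableEq m] [DecidableEq n]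
    {A : Matrix m m ℂ} {B : Matrix n n ℂ} {E : Matrix m n ℂ} (h : A * E = E * B) :
    NormedSpace.exp A * E = E * NormedSpace.exp B := by
  have hp : ∀ j : ℕ, A ^ j * E = E * B ^ j := by
    intro j
    induction j with
    | zero => simp
    | succ j ih => rw [pow_succ', pow_succ', Matrix.mul_assoc, ih, ← Matrix.mul_assoc, h,
        Matrix.mul_assoc]
  have h1 : HasSum (fun j : ℕ => ((j.factorial : ℂ)⁻¹ • A ^ j) * E) (NormedSpace.exp A * E) :=
    (hasSum_matrix_exp A).map (Matrix.addMonoidHomMulRight E)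
      (continuous_id.matrix_mul continuous_const)
  have h2 : HasSum (fun j : ℕ => E * ((j.factorial : ℂ)⁻¹ • B ^ j)) (E * NormedSpace.exp B) :=
    (hasSum_matrix_exp B).map (Matrix.addMonoidHomMulLeft E)
      (continuous_const.matrix_mul continuous_id)
  refine h1.unique ?_
  simpa only [Matrix.smul_mul, Matrix.mul_smul, hp] using h2

lemma rotK_conjTranspose (p : Matrix (Fin N) (Fin N) ℝ) :
    (rotK p).conjTranspose = -rotK p := by
  simp [rotK]

lemma rot_conjTranspose_mul_self (p : Matrix (Fin N) (Fin N) ℝ) (s : ℝ) :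
    (rot p s).conjTranspose * rot p s = 1 := by
  rw [rot, ← Matrix.exp_conjTranspose, ← Matrix.exp_add_of_commute, Matrix.conjTranspose_smul,
    rotK_conjTranspose, Complex.star_def, Complex.conj_ofReal, smul_neg, neg_add_cancel,
    NormedSpace.exp_zero]
  rw [Matrix.conjTranspose_smul, rotK_conjTranspose, Complex.star_def, Complex.conj_ofReal,
    smul_neg]
  exact (Commute.refl _).neg_left

lemma rot_mul_conjTranspose_self (p : Matrix (Fin N) (Fin N) ℝ) (s : ℝ) :
    rot p s * (rot p s).conjTranspose = 1 :=
  mul_eq_one_comm.1 (rot_conjTranspose_mul_self p s)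

lemma rot_zero (p : Matrix (Fin N) (Fin N) ℝ) : rot p 0 = 1 := by
  simp [rot]

lemma rot_mul_of_commute {p : Matrix (Fin N) (Fin N) ℝ} {E : Mat2 N}
    (h : rotK p * E = E * rotK p) (s : ℝ) : rot p s * E = E * rot p s :=
  exp_mul_of_mul_eq (by rw [smul_mul_assoc, mul_smul_comm, h])

lemma rot_mul_grad (p : Matrix (Fin N) (Fin N) ℝ) (s : ℝ) :
    rot p s * (gradExt N ⊗ₖ gradExt N) = (gradExt N ⊗ₖ gradExt N) * rot p s := by
  refine rot_mul_of_commute ?_ s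
  have h : rotC p * (gradExt N ⊗ₖ gradExt N) = (gradExt N ⊗ₖ gradExt N) * rotC p := by
    rw [rotC, Finset.sum_mul, Finset.mul_sum]
    refine Finset.sum_congr rfl fun i _ => ?_
    rw [Finset.sum_mul, Finset.mul_sum]
    refine Finset.sum_congr rfl fun j _ => ?_
    rw [smul_mul_assoc, mul_smul_comm, ← Matrix.mul_kronecker_mul, ← Matrix.mul_kronecker_mul,
      conjTranspose_wedge_mul_gradExt, ← mul_assoc (gradExt N) _ (gradExt N), gradExt_mul_wedge,
      neg_mul, ← neg_one_smul ℂ (gradExt N * _), ← neg_one_smul ℂ (_ * gradExt N * gradExt N),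
      Matrix.kronecker_smul, Matrix.smul_kronecker]
  have h' := congrArg Matrix.conjTranspose h
  rw [Matrix.conjTranspose_mul, Matrix.conjTranspose_mul, Matrix.conjTranspose_kronecker,
    gradExt_conjTranspose] at h'
  rw [rotK, sub_mul, mul_sub, h, h']

/-- The rotation by a right angle takes exterior multiplication by `(0, v)` to that by `(v, 0)`, for
`v` in the range of `p`: on the span of these two, the commutator with `rotK p` is a generator of the
plane rotations. -/
lemma rot_one_mul_cre2 {p : Matrix (Fin N) (Fin N) ℝ} (hp : p.transpose = p) {v : Fin N → ℂ}
    (hv : (p.map Complex.ofReal).mulVec v = v) : rot p 1 * cre2 v = cre1 v * rot p 1 := by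
  -- `cre2 v ± i cre1 v` are eigenvectors of the commutator with `rotK p`
  have key : ∀ ε : ℂ, ε * ε = -1 →
      rot p 1 * (cre2 v - ε • cre1 v) =
        Complex.exp (((1 * (Real.pi / 2) : ℝ) : ℂ) * ε) • ((cre2 v - ε • cre1 v) * rot p 1) := by
    intro ε hε
    have h1 : rotK p * (cre2 v - ε • cre1 v) = (cre2 v - ε • cre1 v) * (rotK p + ε • 1) := by
      rw [mul_sub, mul_smul_comm, rotK_mul_cre2, rotK_mul_cre1, hp, hv, mul_add, mul_smul_comm,
        mul_one, sub_mul, smul_mul_assoc, smul_sub, smul_sub, smul_smul, hε]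
      module
    have h2 := exp_mul_of_mul_eq (A := ((1 * (Real.pi / 2) : ℝ) : ℂ) • rotK p)
      (B := ((1 * (Real.pi / 2) : ℝ) : ℂ) • (rotK p + ε • 1)) (E := cre2 v - ε • cre1 v)
      (by rw [smul_mul_assoc, mul_smul_comm, h1])
    rw [rot, h2, smul_add, Matrix.exp_add_of_commute, smul_smul,
      show ((((1 * (Real.pi / 2) : ℝ) : ℂ) * ε) • (1 : Mat2 N)) =
        Matrix.diagonal fun _ => ((1 * (Real.pi / 2) : ℝ) : ℂ) * ε by
          rw [← Matrix.diagonal_one, ← Matrix.diagonal_smul]; congr 1; ext; simp,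
      Matrix.exp_diagonal]
    · have : (NormedSpace.exp fun _ : Finset (Fin N) × Finset (Fin N) =>
          ((1 * (Real.pi / 2) : ℝ) : ℂ) * ε) =
          fun _ => Complex.exp (((1 * (Real.pi / 2) : ℝ) : ℂ) * ε) := by
        ext i
        rw [Pi.coe_exp, Complex.exp_eq_exp_ℂ]
      rw [this, ← mul_assoc, ← Matrix.smul_one_eq_diagonal, mul_smul_comm, mul_one]
    · rw [smul_smul]
      exact ((Commute.one_right _).smul_right _)
  have e1 := key Complex.I Complex.I_mul_I
  have e2 := key (-Complex.I) (by rw [neg_mul_neg, Complex.I_mul_I])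
  have x1 : Complex.exp (((1 * (Real.pi / 2) : ℝ) : ℂ) * Complex.I) = Complex.I := by
    push_cast
    rw [one_mul, Complex.exp_pi_div_two_mul_I]
  have x2 : Complex.exp (((1 * (Real.pi / 2) : ℝ) : ℂ) * -Complex.I) = -Complex.I := by
    push_cast
    rw [one_mul, mul_neg, ← neg_mul, ← neg_div, Complex.exp_neg_pi_div_two_mul_I]
  rw [x1] at e1
  rw [x2] at e2
  have e3 := congrArg (fun X => (1 / 2 : ℂ) • X) (congrArg₂ (· + ·) e1 e2)
  simp only [mul_sub, sub_mul, mul_smul_comm, smul_mul_assoc, smul_sub, smul_smul, neg_mul,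
    mul_neg, Complex.I_mul_I] at e3
  have l : rot p 1 * cre2 v = (1 / 2 : ℂ) • (rot p 1 * cre2 v - Complex.I • (rot p 1 * cre1 v) +
    (rot p 1 * cre2 v - (-Complex.I) • (rot p 1 * cre1 v))) := by module
  rw [l, e3]
  module

/-- The rotation fixes the second copy of the kernel of `p`. -/
lemma rot_mul_cre2_of_mulVec_eq_zero {p : Matrix (Fin N) (Fin N) ℝ} {v : Fin N → ℂ}
    (hv : (p.map Complex.ofReal).mulVec v = 0) (s : ℝ) :
    rot p s * cre2 v = cre2 v * rot p s := by
  refine rot_mul_of_commute ?_ s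
  rw [rotK_mul_cre2, hv]
  have : cre1 (0 : Fin N → ℂ) = 0 := by
    have := cre1_add (0 : Fin N → ℂ) 0
    simpa using this
  rw [this, add_zero]

end Rotation

section RotationFrame

variable {N : ℕ}

lemma continuous_rotC : Continuous (rotC : Matrix (Fin N) (Fin N) ℝ → Mat2 N) := by
  unfold rotC
  refine continuous_finsetSum _ fun i _ => continuous_finsetSum _ fun j _ => ?_
  exact (Complex.continuous_ofReal.comp (continuous_apply_apply i j)).smul continuous_const

lemma continuous_rot :
    Continuous fun q : Matrix (Fin N) (Fin N) ℝ × ℝ => rot q.1 q.2 := by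
  have he : Continuous (NormedSpace.exp : Mat2 N → Mat2 N) := by
    open scoped Matrix.Norms.Operator in exact NormedSpace.exp_continuous
  have hC := (continuous_rotC (N := N)).comp
    (continuous_fst (X := Matrix (Fin N) (Fin N) ℝ) (Y := ℝ))
  have hc : Continuous fun q : Matrix (Fin N) (Fin N) ℝ × ℝ =>
      ((q.2 * (Real.pi / 2) : ℝ) : ℂ) := by fun_prop
  exact he.comp (hc.smul (hC.sub hC.matrix_conjTranspose))

lemma star_wedge_single (i : Fin N) (S T : Finset (Fin N)) :
    star (wedge (Pi.single i 1) S T) = wedge (Pi.single i 1) S T := by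
  have h : star (Pi.single i 1 : Fin N → ℂ) = Pi.single i 1 := by
    ext j
    by_cases h : j = i <;> simp [h]
  rw [← Matrix.map_apply (f := star) (M := wedge _), wedge_map_star, h]

lemma star_gradExt (S T : Finset (Fin N)) : star (gradExt N S T) = gradExt N S T := by
  rw [gradExt, Matrix.diagonal_apply]
  split_ifs <;> simp

lemma star_rotC (p : Matrix (Fin N) (Fin N) ℝ) (a b) : star (rotC p a b) = rotC p a b := by
  simp only [rotC, Matrix.sum_apply, star_sum, Matrix.smul_apply, Matrix.kroneckerMap_apply,
    smul_eq_mul, star_mul', Complex.star_def, Complex.conj_ofReal, Matrix.mul_apply,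
    Matrix.conjTranspose_apply]
  simp only [← Complex.star_def, star_wedge_single, star_gradExt]

lemma star_rot (p : Matrix (Fin N) (Fin N) ℝ) (s : ℝ) (a b) :
    star (rot p s a b) = rot p s a b := by
  have h : (rotK p).transpose = (rotK p).conjTranspose := by
    ext a b
    simp only [rotK, Matrix.transpose_apply, Matrix.conjTranspose_apply, Matrix.sub_apply,
      star_sub, star_rotC]
  have h2 : (rot p s).transpose = (rot p s).conjTranspose := by
    rw [rot, ← Matrix.exp_transpose, ← Matrix.exp_conjTranspose, Matrix.transpose_smul, h,
      Matrix.conjTranspose_smul, Complex.star_def, Complex.conj_ofReal]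
  exact (congrFun (congrFun h2 b) a).symm

/-! ### Stabilisation of the rotation -/

/-- The matrix of the inclusion `Λ^•ℂᴺ → Λ^•ℂᴺ⁺¹`, `x ↦ x`. -/
def incM (N : ℕ) : Matrix (Finset (Fin (N + 1))) (Finset (Fin N)) ℂ :=
  fun b S => if b = castS S then 1 else 0

/-- The matrix of the inclusion `Λ^•ℂᴺ → Λ^•ℂᴺ⁺¹`, `x ↦ x ∧ e_N`. -/
def lasM (N : ℕ) : Matrix (Finset (Fin (N + 1))) (Finset (Fin N)) ℂ :=
  fun b S => if b = lastS S then 1 else 0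

lemma blocks_mul_incM (A B C D : Matrix (Finset (Fin N)) (Finset (Fin N)) ℂ) :
    blocks A B C D * incM N = incM N * A + lasM N * C := by
  ext b S
  obtain ⟨b | b, rfl⟩ := (splitS N).surjective b <;>
    simp [Matrix.mul_apply, incM, lasM]

lemma blocks_mul_lasM (A B C D : Matrix (Finset (Fin N)) (Finset (Fin N)) ℂ) :
    blocks A B C D * lasM N = incM N * B + lasM N * D := by
  ext b S
  obtain ⟨b | b, rfl⟩ := (splitS N).surjective b <;>
    simp [Matrix.mul_apply, incM, lasM]

lemma wedge_single_castSucc (i : Fin N) :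
    wedge (Pi.single i.castSucc 1 : Fin (N + 1) → ℂ) =
      blocks (wedge (Pi.single i 1)) 0 0 (wedge (Pi.single i 1)) := by
  have : (fun j : Fin N => (Pi.single i.castSucc 1 : Fin (N + 1) → ℂ) j.castSucc) =
      Pi.single i 1 := by
    ext j
    simp [Pi.single_apply]
  rw [wedge_succ, this]
  simp [(Fin.castSucc_ne_last i).symm]

/-- `p'` is the matrix `p`, enlarged by a zero row and column. -/
def IsExtend (p : Matrix (Fin N) (Fin N) ℝ) (p' : Matrix (Fin (N + 1)) (Fin (N + 1)) ℝ) : Prop :=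
  (∀ i j, p' i.castSucc j.castSucc = p i j) ∧ (∀ i, p' i (Fin.last N) = 0) ∧
    ∀ i, p' (Fin.last N) i = 0

/-- The rotation in `ℂᴺ⁺¹` restricts to that in `ℂᴺ`, both on `Λ^•ℂᴺ` and on `Λ^•ℂᴺ ∧ e_N` in the
second factor: the last coordinate is not rotated. -/
lemma rot_mul_incM_kronecker {p : Matrix (Fin N) (Fin N) ℝ}
    {p' : Matrix (Fin (N + 1)) (Fin (N + 1)) ℝ} (hp : IsExtend p p')
    {X : Matrix (Finset (Fin (N + 1))) (Finset (Fin N)) ℂ} (hX : X = incM N ∨ X = lasM N) (s : ℝ) :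
    rot p' s * (incM N ⊗ₖ X) = (incM N ⊗ₖ X) * rot p s := by
  have hX1 : ∀ j : Fin N, wedge (Pi.single j.castSucc 1) * X = X * wedge (Pi.single j 1) := by
    intro j
    rcases hX with rfl | rfl <;> simp [wedge_single_castSucc, blocks_mul_incM, blocks_mul_lasM]
  have hX2 : ∀ j : Fin N, (wedge (Pi.single j.castSucc 1)).conjTranspose * X =
      X * (wedge (Pi.single j 1)).conjTranspose := by
    intro j
    rcases hX with rfl | rfl <;>
      simp [wedge_single_castSucc, blocks_conjTranspose, blocks_mul_incM, blocks_mul_lasM]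
  have h1 : ∀ i : Fin N, wedge (Pi.single i.castSucc 1) * gradExt (N + 1) * incM N =
      incM N * (wedge (Pi.single i 1) * gradExt N) := by
    intro i
    simp [wedge_single_castSucc, gradExt_succ, blocks_mul, blocks_mul_incM]
  have h2 : ∀ i : Fin N, gradExt (N + 1) * (wedge (Pi.single i.castSucc 1)).conjTranspose *
      incM N = incM N * (gradExt N * (wedge (Pi.single i 1)).conjTranspose) := by
    intro i
    simp [wedge_single_castSucc, gradExt_succ, blocks_mul, blocks_conjTranspose, blocks_mul_incM]
  have hC : rotC p' * (incM N ⊗ₖ X) = (incM N ⊗ₖ X) * rotC p := by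
    simp only [rotC, Fin.sum_univ_castSucc, hp.1, hp.2.1, hp.2.2, Complex.ofReal_zero, zero_smul,
      Finset.sum_const_zero, add_zero, Matrix.sum_mul, Matrix.mul_sum, Matrix.smul_mul,
      Matrix.mul_smul, ← Matrix.mul_kronecker_mul, h1, hX2]
  have hC' : (rotC p').conjTranspose * (incM N ⊗ₖ X) =
      (incM N ⊗ₖ X) * (rotC p).conjTranspose := by
    simp only [rotC_conjTranspose, Fin.sum_univ_castSucc, hp.1, hp.2.1, hp.2.2,
      Complex.ofReal_zero, zero_smul, Finset.sum_const_zero, add_zero, Matrix.sum_mul,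
      Matrix.mul_sum, Matrix.smul_mul, Matrix.mul_smul, ← Matrix.mul_kronecker_mul, h2, hX1]
  refine exp_mul_of_mul_eq ?_
  rw [Matrix.smul_mul, Matrix.mul_smul, rotK, rotK, Matrix.sub_mul, Matrix.mul_sub, hC, hC']

/-! ### The end of the rotation -/

/-- The restriction of `rot p s` to `1 ⊗ Λ^•ℂᴺ`. -/
def rotFrame (p : Matrix (Fin N) (Fin N) ℝ) (s : ℝ) :
    Matrix (Finset (Fin N) × Finset (Fin N)) (Finset (Fin N)) ℂ :=
  fun a S => rot p s a (∅, S)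

/-- The matrix of the inclusion `Λ^•ℂᴺ → Λ^•ℂᴺ ⊗ Λ^•ℂᴺ`, `x ↦ 1 ⊗ x`. -/
def vacM (N : ℕ) : Matrix (Finset (Fin N) × Finset (Fin N)) (Finset (Fin N)) ℂ :=
  fun a S => if a = (∅, S) then 1 else 0

lemma rotFrame_eq (p : Matrix (Fin N) (Fin N) ℝ) (s : ℝ) : rotFrame p s = rot p s * vacM N := by
  ext a S
  simp [Matrix.mul_apply, rotFrame, vacM]

lemma rotFrame_zero (p : Matrix (Fin N) (Fin N) ℝ) : rotFrame p 0 = vacM N := by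
  rw [rotFrame_eq, rot_zero, Matrix.one_mul]

lemma grad_kronecker_mul_vacM (X : Matrix (Finset (Fin N)) (Finset (Fin N)) ℂ) :
    (gradExt N ⊗ₖ X) * vacM N = vacM N * X := by
  ext a S
  have h : ∀ x : Finset (Fin N), (a = (∅, x)) ↔ (a.1 = ∅ ∧ x = a.2) := fun x => by
    rw [Prod.ext_iff]; simp [eq_comm]
  simp only [Matrix.mul_apply, vacM, Matrix.kroneckerMap_apply, mul_ite, mul_one, mul_zero,
    Finset.sum_ite_eq', Finset.mem_univ, if_true, h, ite_and, ite_mul, one_mul, zero_mul]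
  rw [Finset.sum_ite_irrel]
  simp only [gradExt, Matrix.diagonal_apply]
  by_cases h1 : a.1 = ∅ <;> simp [h1]

lemma vacM_conjTranspose_mul_self : (vacM N).conjTranspose * vacM N = 1 := by
  ext S T
  simp [Matrix.mul_apply, vacM, Matrix.one_apply, apply_ite, eq_comm]

lemma rotFrame_conjTranspose_mul_self (p : Matrix (Fin N) (Fin N) ℝ) (s : ℝ) :
    (rotFrame p s).conjTranspose * rotFrame p s = 1 := by
  rw [rotFrame_eq, Matrix.conjTranspose_mul, Matrix.mul_assoc,
    ← Matrix.mul_assoc (rot p s).conjTranspose, rot_conjTranspose_mul_self, Matrix.one_mul,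
    vacM_conjTranspose_mul_self]

lemma grad_mul_rotFrame (p : Matrix (Fin N) (Fin N) ℝ) (s : ℝ) :
    (gradExt N ⊗ₖ gradExt N) * rotFrame p s = rotFrame p s * gradExt N := by
  rw [rotFrame_eq, ← Matrix.mul_assoc, ← rot_mul_grad, Matrix.mul_assoc, grad_kronecker_mul_vacM,
    Matrix.mul_assoc]

lemma rotK_mul_vacuum (p : Matrix (Fin N) (Fin N) ℝ) :
    (rotK p).mulVec (Pi.single (∅, ∅) 1) = 0 := by
  have h : ∀ (v : Fin N → ℂ) T, wedge v ∅ T = 0 := by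
    intro v T
    simp [wedge, (Finset.insert_ne_empty _ _).symm]
  ext a
  rw [Matrix.mulVec_single_one, Matrix.col_apply, rotK, Matrix.sub_apply, rotC_conjTranspose, rotC]
  simp [Matrix.sum_apply, Matrix.kroneckerMap_apply, Matrix.mul_apply, h]

lemma rot_mul_vacuum (p : Matrix (Fin N) (Fin N) ℝ) (s : ℝ) :
    (rot p s).mulVec (Pi.single (∅, ∅) 1) = Pi.single (∅, ∅) 1 := by
  have h := exp_mul_of_mul_eq (A := (((s * (Real.pi / 2) : ℝ) : ℂ) • rotK p))
    (B := (0 : Matrix Unit Unit ℂ)) (E := Matrix.replicateCol Unit (Pi.single (∅, ∅) 1)) (by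
      rw [← Matrix.replicateCol_mulVec, Matrix.smul_mulVec, rotK_mul_vacuum]
      ext; simp)
  rw [NormedSpace.exp_zero, Matrix.mul_one, ← Matrix.replicateCol_mulVec] at h
  exact Matrix.replicateCol_injective h

/-- The matrix of the orthogonal projection onto `L`. -/
def projMat (L : Submodule ℝ (Eu N)) : Matrix (Fin N) (Fin N) ℝ :=
  fun i j => L.starProjection (EuclideanSpace.single j 1) i

lemma sum_projMat (L : Submodule ℝ (Eu N)) (x : Eu N) (i : Fin N) :
    ∑ j, projMat L i j * x j = L.starProjection x i := by
  have : x = ∑ j, x j • EuclideanSpace.single j (1 : ℝ) := by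
    ext k
    simp [Pi.single_apply]
  conv_rhs => rw [this, map_sum]
  simp [projMat, mul_comm]

lemma projMat_transpose (L : Submodule ℝ (Eu N)) : (projMat L).transpose = projMat L := by
  ext i j
  have := L.starProjection_isSymmetric (EuclideanSpace.single i (1 : ℝ)) (EuclideanSpace.single j 1)
  simpa [EuclideanSpace.inner_single_right, EuclideanSpace.inner_single_left, projMat] using this

lemma projMat_mulVec_cplx (L : Submodule ℝ (Eu N)) (x y : Eu N) :
    ((projMat L).map Complex.ofReal).mulVec (cplx x y) =
      cplx (L.starProjection x) (L.starProjection y) := by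
  ext i
  simp only [Matrix.mulVec, dotProduct, Matrix.map_apply, cplx, ← sum_projMat]
  push_cast
  rw [Finset.mul_sum, ← Finset.sum_add_distrib]
  exact Finset.sum_congr rfl fun j _ => by ring

lemma cplx_add (x y x' y' : Eu N) : cplx (x + x') (y + y') = cplx x y + cplx x' y' := by
  ext k
  simp only [cplx, Pi.add_apply, PiLp.add_apply]
  push_cast
  ring

lemma rot_one_mul_cre2_of_mem {L : Submodule ℝ (Eu N)} {x y : Eu N} (hx : x ∈ L) (hy : y ∈ L) :
    rot (projMat L) 1 * cre2 (cplx x y) = cre1 (cplx x y) * rot (projMat L) 1 := by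
  refine rot_one_mul_cre2 (projMat_transpose L) ?_
  rw [projMat_mulVec_cplx, Submodule.starProjection_eq_self_iff.2 hx,
    Submodule.starProjection_eq_self_iff.2 hy]

lemma rot_mul_cre2_of_mem_orthogonal {L : Submodule ℝ (Eu N)} {x y : Eu N} (hx : x ∈ Lᗮ)
    (hy : y ∈ Lᗮ) (s : ℝ) :
    rot (projMat L) s * cre2 (cplx x y) = cre2 (cplx x y) * rot (projMat L) s := by
  refine rot_mul_cre2_of_mulVec_eq_zero ?_ s
  rw [projMat_mulVec_cplx, (Submodule.starProjection_apply_eq_zero_iff L).2 hx,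
    (Submodule.starProjection_apply_eq_zero_iff L).2 hy]
  ext k
  simp [cplx]

/-- A unitary which intertwines `A` and `B` intertwines their adjoints. This passes from exterior
multiplications, where the rotation is computed, to the operators of the Koszul complexes. -/
lemma mul_conjTranspose_of_mul_eq {U A B : Mat2 N} (hU : U.conjTranspose * U = 1)
    (h : U * A = B * U) : U * A.conjTranspose = B.conjTranspose * U := by
  have hU' := mul_eq_one_comm.1 hU
  have h1 : A * U.conjTranspose = U.conjTranspose * B := by
    calc A * U.conjTranspose = U.conjTranspose * (U * A) * U.conjTranspose := by
          rw [← mul_assoc, hU, one_mul]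
      _ = U.conjTranspose * B := by rw [h, mul_assoc, mul_assoc, hU', mul_one]
  have := congrArg Matrix.conjTranspose h1
  simpa only [Matrix.conjTranspose_mul, Matrix.conjTranspose_conjTranspose] using this

lemma cre2_add_conjTranspose (v : Fin N → ℂ) :
    cre2 v + (cre2 v).conjTranspose = gradExt N ⊗ₖ koszul v := by
  rw [cre2, Matrix.conjTranspose_kronecker, gradExt_conjTranspose, koszul, Matrix.kronecker_add]

lemma cre1_add_conjTranspose (v : Fin N → ℂ) :
    cre1 v + (cre1 v).conjTranspose = koszul v ⊗ₖ 1 := by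
  rw [cre1, Matrix.conjTranspose_kronecker, Matrix.conjTranspose_one, koszul,
    Matrix.add_kronecker]

/-- At the end of the rotation, the Koszul complex on `ℂᴺ` has become the product of the Koszul
complexes on `L_ℂ` and on its complement. -/
lemma koszul_mul_rotFrame_one {L : Submodule ℝ (Eu N)} {x : Eu N} (hx : x ∈ Lᗮ) (y : Eu N) :
    (koszul (cplx 0 (L.starProjection y)) ⊗ₖ 1 +
        gradExt N ⊗ₖ koszul (cplx x (Lᗮ.starProjection y))) * rotFrame (projMat L) 1 =
      rotFrame (projMat L) 1 * koszul (cplx x y) := by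
  have h1 := rot_one_mul_cre2_of_mem (L := L) (Submodule.zero_mem L) (L.starProjection_apply_mem y)
  have h2 := rot_mul_cre2_of_mem_orthogonal (L := L) hx (Lᗮ.starProjection_apply_mem y) 1
  have h1' := mul_conjTranspose_of_mul_eq (rot_conjTranspose_mul_self _ _) h1
  have h2' := mul_conjTranspose_of_mul_eq (rot_conjTranspose_mul_self _ _) h2
  have h3 : cplx x y = cplx 0 (L.starProjection y) + cplx x (Lᗮ.starProjection y) := by
    rw [← cplx_add, zero_add, Submodule.starProjection_add_starProjection_orthogonal]
  rw [rotFrame_eq, Matrix.mul_assoc, ← grad_kronecker_mul_vacM, ← Matrix.mul_assoc,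
    ← Matrix.mul_assoc]
  congr 1
  rw [← cre2_add_conjTranspose, ← cre2_add_conjTranspose, ← cre1_add_conjTranspose, h3, cre2_add,
    Matrix.conjTranspose_add]
  simp only [add_mul, mul_add, h1, h2, h1', h2']
  abel

/-- The tensor product of two vectors. -/
def tensV (x y : Finset (Fin N) → ℂ) : Finset (Fin N) × Finset (Fin N) → ℂ :=
  fun a => x a.1 * y a.2

lemma kronecker_mulVec_tensV (A B : Matrix (Finset (Fin N)) (Finset (Fin N)) ℂ)
    (x y : Finset (Fin N) → ℂ) :
    (A ⊗ₖ B).mulVec (tensV x y) = tensV (A.mulVec x) (B.mulVec y) := by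
  ext a
  simp only [Matrix.mulVec, dotProduct, tensV, Fintype.sum_prod_type, Finset.sum_mul_sum,
    Matrix.kroneckerMap_apply]
  exact Finset.sum_congr rfl fun _ _ => Finset.sum_congr rfl fun _ _ => by ring

lemma tensV_single (S T : Finset (Fin N)) :
    tensV (Pi.single S 1) (Pi.single T 1) = Pi.single (S, T) 1 := by
  ext a
  simp only [tensV, Pi.single_apply, Prod.ext_iff, ite_and, mul_ite, mul_one, mul_zero]
  split_ifs <;> rfl

lemma extProj_mulVec (L : Submodule ℝ (Eu N)) (x : Finset (Fin N) → ℂ) :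
    (extProj L).mulVec x = ((extSub L).starProjection (WithLp.toLp 2 x)).ofLp := by
  have : (WithLp.toLp 2 x : EuclideanSpace ℂ (Finset (Fin N))) =
      ∑ T, x T • EuclideanSpace.single T (1 : ℂ) := by
    ext T
    simp [Pi.single_apply]
  rw [this, map_sum]
  ext S
  simp [Matrix.mulVec, dotProduct, extProj, mul_comm]

lemma extProj_mulVec_eq_self {L : Submodule ℝ (Eu N)} {x : Finset (Fin N) → ℂ} :
    (extProj L).mulVec x = x ↔ WithLp.toLp 2 x ∈ extSub L := by
  rw [extProj_mulVec, ← Submodule.starProjection_eq_self_iff]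
  constructor
  · intro h
    exact (WithLp.ofLp_injective 2) h
  · intro h
    rw [h]

lemma extProj_mulVec_mem (L : Submodule ℝ (Eu N)) (x : Finset (Fin N) → ℂ) :
    WithLp.toLp 2 ((extProj L).mulVec x) ∈ extSub L := by
  rw [extProj_mulVec]
  exact Submodule.starProjection_apply_mem _ _

lemma extProj_conjTranspose (L : Submodule ℝ (Eu N)) :
    (extProj L).conjTranspose = extProj L := by
  ext S T
  have := (extSub L).starProjection_isSymmetric (EuclideanSpace.single S (1 : ℂ))
    (EuclideanSpace.single T 1)
  simpa [EuclideanSpace.inner_single_right, EuclideanSpace.inner_single_left, extProj] using this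

lemma single_mem_extSub (L : Submodule ℝ (Eu N)) :
    WithLp.toLp 2 (Pi.single ∅ 1 : Finset (Fin N) → ℂ) ∈ extSub L := by
  refine Submodule.mem_sInf.2 fun W hW => ?_
  exact hW.1

lemma wedge_mem_extSub {L : Submodule ℝ (Eu N)} {u : Eu N} (hu : u ∈ L)
    {x : Finset (Fin N) → ℂ} (hx : WithLp.toLp 2 x ∈ extSub L) :
    WithLp.toLp 2 ((wedge (cplx u 0)).mulVec x) ∈ extSub L := by
  refine Submodule.mem_sInf.2 fun W hW => ?_
  exact hW.2 u hu _ (Submodule.mem_sInf.1 hx W hW)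

/-- `Λ^•L_ℂ` is the smallest subspace which contains `1` and is closed under exterior multiplication
by `L`. -/
lemma extSub_induction {L : Submodule ℝ (Eu N)} (W : Submodule ℂ (Finset (Fin N) → ℂ))
    (h0 : Pi.single ∅ 1 ∈ W)
    (hW : ∀ u ∈ L, ∀ x ∈ W, (wedge (cplx u 0)).mulVec x ∈ W) {x : Finset (Fin N) → ℂ}
    (hx : WithLp.toLp 2 x ∈ extSub L) : x ∈ W := by
  have := Submodule.mem_sInf.1 hx
    (W.comap (WithLp.linearEquiv 2 ℂ (Finset (Fin N) → ℂ)).toLinearMap) ⟨h0, fun u hu x hx =>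
      hW u hu _ hx⟩
  exact this

lemma matrix_ext_mulVec {m n : Type*} [Fintype n] [DecidableEq n] {A B : Matrix m n ℂ}
    (h : ∀ x, A.mulVec x = B.mulVec x) : A = B := by
  ext i j
  have := congrFun (h (Pi.single j 1)) i
  simpa using this

lemma gradExt_mem_extSub {L : Submodule ℝ (Eu N)} {x : Finset (Fin N) → ℂ}
    (hx : WithLp.toLp 2 x ∈ extSub L) : WithLp.toLp 2 ((gradExt N).mulVec x) ∈ extSub L := by
  refine extSub_induction (((extSub L).comap
    (WithLp.linearEquiv 2 ℂ (Finset (Fin N) → ℂ)).symm.toLinearMap).comap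
    (gradExt N).mulVecLin) ?_ ?_ hx
  · have : (gradExt N).mulVec (Pi.single ∅ 1) = Pi.single ∅ 1 := by
      ext S
      simp only [Matrix.mulVec_single_one, Matrix.col_apply, gradExt, Matrix.diagonal_apply,
        Pi.single_apply]
      split_ifs with h <;> simp [h]
    change WithLp.toLp 2 ((gradExt N).mulVec _) ∈ extSub L
    rw [this]
    exact single_mem_extSub L
  · intro u hu x hx
    change WithLp.toLp 2 ((gradExt N).mulVec _) ∈ extSub L
    rw [Matrix.mulVec_mulVec, gradExt_mul_wedge, Matrix.neg_mulVec, ← Matrix.mulVec_mulVec]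
    exact (extSub L).neg_mem (wedge_mem_extSub hu hx)

lemma extProj_mul_self (L : Submodule ℝ (Eu N)) : extProj L * extProj L = extProj L := by
  refine matrix_ext_mulVec fun x => ?_
  rw [← Matrix.mulVec_mulVec, extProj_mulVec_eq_self]
  exact extProj_mulVec_mem L x

lemma extProj_mul_wedge_mul {L : Submodule ℝ (Eu N)} {u : Eu N} (hu : u ∈ L) :
    extProj L * (wedge (cplx u 0) * extProj L) = wedge (cplx u 0) * extProj L := by
  refine matrix_ext_mulVec fun x => ?_
  rw [← Matrix.mulVec_mulVec, ← Matrix.mulVec_mulVec, extProj_mulVec_eq_self]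
  exact wedge_mem_extSub hu (extProj_mulVec_mem L x)

lemma extProj_mul_gradExt_mul (L : Submodule ℝ (Eu N)) :
    extProj L * (gradExt N * extProj L) = gradExt N * extProj L := by
  refine matrix_ext_mulVec fun x => ?_
  rw [← Matrix.mulVec_mulVec, ← Matrix.mulVec_mulVec, extProj_mulVec_eq_self]
  exact gradExt_mem_extSub (extProj_mulVec_mem L x)

/-- The rotation takes `1 ⊗ Λ^•ℂᴺ` into `Λ^•L_ℂ ⊗ Λ^•(Lᗮ)_ℂ`. This holds
for the vacuum, and is inherited under exterior multiplication by `e = a + b` with `a ∈ L`,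
`b ∈ Lᗮ`, which becomes exterior multiplication by `(a, b)`. -/
lemma extProj_kronecker_mul_rotFrame (L : Submodule ℝ (Eu N)) :
    (extProj L ⊗ₖ extProj Lᗮ) * rotFrame (projMat L) 1 = rotFrame (projMat L) 1 := by
  refine matrix_ext_mulVec fun x => ?_
  refine mem_of_wedge_mem (LinearMap.eqLocus
    (Matrix.mulVecLin ((extProj L ⊗ₖ extProj Lᗮ) * rotFrame (projMat L) 1))
    (Matrix.mulVecLin (rotFrame (projMat L) 1))) ?_ ?_ x
  · have h : (rotFrame (projMat L) 1).mulVec (Pi.single ∅ 1) = Pi.single (∅, ∅) 1 := by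
      rw [← rot_mul_vacuum (projMat L) 1]
      ext a
      simp [rotFrame]
    rw [LinearMap.mem_eqLocus, Matrix.mulVecLin_apply, Matrix.mulVecLin_apply,
      ← Matrix.mulVec_mulVec, h, ← tensV_single, kronecker_mulVec_tensV,
      extProj_mulVec_eq_self.2 (single_mem_extSub L),
      extProj_mulVec_eq_self.2 (single_mem_extSub _)]
  · intro i x hx
    rw [LinearMap.mem_eqLocus, Matrix.mulVecLin_apply, Matrix.mulVecLin_apply] at hx ⊢
    let e : Eu N := EuclideanSpace.single i 1
    let a := L.starProjection e
    let b := Lᗮ.starProjection e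
    have ha : a ∈ L := L.starProjection_apply_mem e
    have hb : b ∈ Lᗮ := Lᗮ.starProjection_apply_mem e
    have he : (Pi.single i 1 : Fin N → ℂ) = cplx a 0 + cplx b 0 := by
      rw [← cplx_add, Submodule.starProjection_add_starProjection_orthogonal]
      ext k
      simp [e, cplx, Pi.single_apply, apply_ite]
    have h1 : rotFrame (projMat L) 1 * wedge (Pi.single i 1) =
        (cre1 (cplx a 0) + cre2 (cplx b 0)) * rotFrame (projMat L) 1 := by
      rw [rotFrame_eq, Matrix.mul_assoc, ← grad_kronecker_mul_vacM, ← Matrix.mul_assoc,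
        ← Matrix.mul_assoc, ← cre2, he, cre2_add, mul_add,
        rot_one_mul_cre2_of_mem ha (Submodule.zero_mem L),
        rot_mul_cre2_of_mem_orthogonal hb (Submodule.zero_mem _), add_mul]
    have h2 : (extProj L ⊗ₖ extProj Lᗮ) * ((cre1 (cplx a 0) + cre2 (cplx b 0)) *
        (extProj L ⊗ₖ extProj Lᗮ)) =
        (cre1 (cplx a 0) + cre2 (cplx b 0)) * (extProj L ⊗ₖ extProj Lᗮ) := by
      rw [add_mul, mul_add, cre1, cre2]
      simp only [← Matrix.mul_kronecker_mul, extProj_mul_wedge_mul ha, extProj_mul_wedge_mul hb,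
        extProj_mul_gradExt_mul, one_mul, extProj_mul_self]
    rw [← Matrix.mulVec_mulVec] at hx ⊢
    rw [Matrix.mulVec_mulVec x, h1, ← Matrix.mulVec_mulVec, ← hx]
    simp only [Matrix.mulVec_mulVec, ← Matrix.mul_assoc] at h2 ⊢
    rw [h2]

/-- At the end of the rotation, `1 ⊗ Λ^•ℂᴺ` has become `Λ^•L_ℂ ⊗ Λ^•(Lᗮ)_ℂ`. -/
lemma rotFrame_one_mul_conjTranspose (L : Submodule ℝ (Eu N)) :
    rotFrame (projMat L) 1 * (rotFrame (projMat L) 1).conjTranspose =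
      extProj L ⊗ₖ extProj Lᗮ := by
  set V := rotFrame (projMat L) 1 with hV
  set R := V * V.conjTranspose with hR
  set U := rot (projMat L) 1 with hU
  have hUU : U * U.conjTranspose = 1 := rot_mul_conjTranspose_self _ _
  have hUU' : U.conjTranspose * U = 1 := rot_conjTranspose_mul_self _ _
  have hR' : R = U * (vacM N * (vacM N).conjTranspose) * U.conjTranspose := by
    rw [hR, hV, rotFrame_eq, Matrix.conjTranspose_mul]
    simp only [Matrix.mul_assoc]
    rfl
  have hvac : ∀ v, (vacM N * (vacM N).conjTranspose) * cre2 v =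
      cre2 v * (vacM N * (vacM N).conjTranspose) := by
    intro v
    have h := congrArg Matrix.conjTranspose (grad_kronecker_mul_vacM (wedge v).conjTranspose)
    simp only [Matrix.conjTranspose_mul, Matrix.conjTranspose_kronecker, gradExt_conjTranspose,
      Matrix.conjTranspose_conjTranspose] at h
    rw [Matrix.mul_assoc, cre2, h, ← Matrix.mul_assoc, ← Matrix.mul_assoc,
      grad_kronecker_mul_vacM]
  have hconj : ∀ {A B : Mat2 N}, U * A = B * U →
      (vacM N * (vacM N).conjTranspose) * A = A * (vacM N * (vacM N).conjTranspose) →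
      R * B = B * R := by
    intro A B hAB hA
    have h1 : U.conjTranspose * B = A * U.conjTranspose := by
      calc U.conjTranspose * B = U.conjTranspose * (B * U) * U.conjTranspose := by
            rw [mul_assoc, mul_assoc, hUU, mul_one]
        _ = A * U.conjTranspose := by rw [← hAB, ← mul_assoc, hUU', one_mul]
    rw [hR', mul_assoc, h1, ← mul_assoc, mul_assoc U, hA, ← mul_assoc, hAB]
    simp only [mul_assoc]
  have hRa : ∀ u ∈ L, R * cre1 (cplx u 0) = cre1 (cplx u 0) * R := fun u hu =>
    hconj (rot_one_mul_cre2_of_mem hu (Submodule.zero_mem L)) (hvac _)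
  have hRb : ∀ u ∈ Lᗮ, R * cre2 (cplx u 0) = cre2 (cplx u 0) * R := fun u hu =>
    hconj (rot_mul_cre2_of_mem_orthogonal hu (Submodule.zero_mem _) 1) (hvac _)
  have hR0 : R.mulVec (tensV (Pi.single ∅ 1) (Pi.single ∅ 1)) =
      tensV (Pi.single ∅ 1) (Pi.single ∅ 1) := by
    rw [tensV_single]
    have h1 : U.conjTranspose.mulVec (Pi.single (∅, ∅) 1) = Pi.single (∅, ∅) 1 := by
      conv_lhs => rw [← rot_mul_vacuum (projMat L) 1, Matrix.mulVec_mulVec, ← hU, hUU',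
        Matrix.one_mulVec]
    have h2 : (vacM N * (vacM N).conjTranspose).mulVec (Pi.single (∅, ∅) 1) =
        Pi.single (∅, ∅) 1 := by
      ext a
      simp [Matrix.mul_apply, vacM, Pi.single_apply, apply_ite]
    rw [hR', ← Matrix.mulVec_mulVec, ← Matrix.mulVec_mulVec, h1, h2, hU, rot_mul_vacuum]
  have step2 : ∀ y, WithLp.toLp 2 y ∈ extSub Lᗮ →
      R.mulVec (tensV (Pi.single ∅ 1) y) = tensV (Pi.single ∅ 1) y := by
    intro y hy
    let F : (Finset (Fin N) → ℂ) →ₗ[ℂ] (Finset (Fin N) × Finset (Fin N) → ℂ) :=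
      { toFun := fun y => tensV (Pi.single ∅ 1) y
        map_add' := fun y z => by ext a; simp [tensV, mul_add]
        map_smul' := fun c y => by ext a; simp [tensV]; ring }
    refine extSub_induction (LinearMap.eqLocus (R.mulVecLin ∘ₗ F) F) hR0 ?_ hy
    intro u hu z hz
    change R.mulVec (tensV _ _) = tensV _ _ at hz ⊢
    have h1 : tensV (Pi.single ∅ 1) ((wedge (cplx u 0)).mulVec z) =
        (cre2 (cplx u 0)).mulVec (tensV (Pi.single ∅ 1) z) := by
      rw [cre2, kronecker_mulVec_tensV]
      congr 1
      ext S
      simp only [Matrix.mulVec_single_one, Matrix.col_apply, gradExt, Matrix.diagonal_apply,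
        Pi.single_apply]
      split_ifs with h <;> simp [h]
    rw [h1, Matrix.mulVec_mulVec, hRb u hu, ← Matrix.mulVec_mulVec, hz]
  have step1 : ∀ y, WithLp.toLp 2 y ∈ extSub Lᗮ → ∀ x, WithLp.toLp 2 x ∈ extSub L →
      R.mulVec (tensV x y) = tensV x y := by
    intro y hy x hx
    let F : (Finset (Fin N) → ℂ) →ₗ[ℂ] (Finset (Fin N) × Finset (Fin N) → ℂ) :=
      { toFun := fun x => tensV x y
        map_add' := fun x z => by ext a; simp [tensV, add_mul]
        map_smul' := fun c x => by ext a; simp [tensV]; ring }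
    refine extSub_induction (LinearMap.eqLocus (R.mulVecLin ∘ₗ F) F) (step2 y hy) ?_ hx
    intro u hu z hz
    change R.mulVec (tensV _ _) = tensV _ _ at hz ⊢
    have h1 : tensV ((wedge (cplx u 0)).mulVec z) y =
        (cre1 (cplx u 0)).mulVec (tensV z y) := by
      rw [cre1, kronecker_mulVec_tensV, Matrix.one_mulVec]
    rw [h1, Matrix.mulVec_mulVec, hRa u hu, ← Matrix.mulVec_mulVec, hz]
  -- two hermitian matrices with `S R = R` and `R S = S` are equal
  have hRS : R * (extProj L ⊗ₖ extProj Lᗮ) = extProj L ⊗ₖ extProj Lᗮ := by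
    ext a b
    have h1 : (extProj L ⊗ₖ extProj Lᗮ).mulVec (Pi.single b 1) =
        tensV ((extProj L).mulVec (Pi.single b.1 1)) ((extProj Lᗮ).mulVec (Pi.single b.2 1)) := by
      rw [← kronecker_mulVec_tensV, tensV_single]
    have h2 := step1 _ (extProj_mulVec_mem Lᗮ (Pi.single b.2 1)) _
      (extProj_mulVec_mem L (Pi.single b.1 1))
    rw [← h1, Matrix.mulVec_mulVec] at h2
    simpa using congrFun h2 a
  have hSR : (extProj L ⊗ₖ extProj Lᗮ) * R = R := by
    rw [hR, ← Matrix.mul_assoc, extProj_kronecker_mul_rotFrame]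
  have h3 := congrArg Matrix.conjTranspose hSR
  rw [Matrix.conjTranspose_mul, Matrix.conjTranspose_kronecker, extProj_conjTranspose,
    extProj_conjTranspose, show R.conjTranspose = R by
      rw [hR, Matrix.conjTranspose_mul, Matrix.conjTranspose_conjTranspose], hRS] at h3
  exact h3.symm

end RotationFrame

/-! ### Points of `KSpace` and their damped resolvents -/

section Damp

set_option linter.unusedSectionVars false

variable {V : Type} [NormedAddCommGroup V] [InnerProductSpace ℂ V] [CompleteSpace V]

/-- `(1 + r Q²)⁻¹` -/
def res (Q : V →L[ℂ] V) (r : ℝ) : V →L[ℂ] V := Ring.inverse (1 + (r : ℂ) • (Q * Q))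

lemma damp_eq (Q : V →L[ℂ] V) (r : ℝ) : damp Q r = Q * res Q r := rfl

lemma isUnit_one_add_smul_sq {Q : V →L[ℂ] V} (hQ : IsSelfAdjoint Q) {r : ℝ} (hr : 0 ≤ r) :
    IsUnit (1 + (r : ℂ) • (Q * Q)) := by
  -- `1 + r Q² = (1 + i √r Q) (1 - i √r Q)`, and the spectrum of `Q` is real
  have h1 : ∀ z : ℂ, z.im ≠ 0 → IsUnit (1 - z⁻¹ • Q) := by
    intro z hz
    have hz0 : z ≠ 0 := fun h => hz (by simp [h])
    have h2 : z ∉ spectrum ℂ Q := by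
      intro h
      have := hQ.mem_spectrum_eq_re h
      rw [this] at hz
      simp at hz
    rw [spectrum.mem_iff, not_not] at h2
    have h3 : (1 : V →L[ℂ] V) - z⁻¹ • Q = z⁻¹ • (algebraMap ℂ (V →L[ℂ] V) z - Q) := by
      rw [Algebra.algebraMap_eq_smul_one, smul_sub, smul_smul, inv_mul_cancel₀ hz0, one_smul]
    rw [h3]
    exact (h2.smul (Units.mk0 z⁻¹ (inv_ne_zero hz0)) : _)
  rcases hr.eq_or_lt with rfl | hr
  · simp
  · have hs : 0 < √r := Real.sqrt_pos.2 hr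
    have e : 1 + (r : ℂ) • (Q * Q) =
        (1 - (Complex.I / √r : ℂ)⁻¹ • Q) * (1 - (-(Complex.I / √r) : ℂ)⁻¹ • Q) := by
      have h4 : (r : ℂ) = (√r : ℂ) * (√r : ℂ) := by
        rw [← Complex.ofReal_mul, Real.mul_self_sqrt hr.le]
      have h5 : ((Complex.I / √r : ℂ)⁻¹) * ((Complex.I / √r : ℂ)⁻¹) = -(r : ℂ) := by
        rw [inv_div, Complex.div_I, h4]
        linear_combination ((√r : ℂ) * √r) * Complex.I_mul_I
      rw [inv_neg, neg_smul, sub_neg_eq_add, sub_mul, mul_add, mul_add, one_mul, one_mul, mul_one,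
        smul_mul_smul_comm, h5]
      module
    rw [e]
    have him : (Complex.I / (√r : ℂ)).im ≠ 0 := by
      rw [Complex.div_ofReal_im, Complex.I_im]
      positivity
    exact (h1 _ him).mul (h1 _ (by rw [Complex.neg_im]; exact neg_ne_zero.2 him))

lemma res_mul_cancel {Q : V →L[ℂ] V} (hQ : IsSelfAdjoint Q) {r : ℝ} (hr : 0 ≤ r) :
    res Q r * (1 + (r : ℂ) • (Q * Q)) = 1 :=
  Ring.inverse_mul_cancel _ (isUnit_one_add_smul_sq hQ hr)

lemma mul_res_cancel {Q : V →L[ℂ] V} (hQ : IsSelfAdjoint Q) {r : ℝ} (hr : 0 ≤ r) :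
    (1 + (r : ℂ) • (Q * Q)) * res Q r = 1 :=
  Ring.mul_inverse_cancel _ (isUnit_one_add_smul_sq hQ hr)

lemma commute_res {Q B : V →L[ℂ] V} (hB : Commute B (Q * Q)) (r : ℝ) : Commute B (res Q r) := by
  have h : Commute B (1 + (r : ℂ) • (Q * Q)) :=
    (Commute.one_right _).add_right (hB.smul_right _)
  by_cases hu : IsUnit (1 + (r : ℂ) • (Q * Q))
  · obtain ⟨u, hu⟩ := hu
    rw [← hu] at h
    rw [res, ← hu, Ring.inverse_unit]
    exact h.units_inv_right
  · rw [res, Ring.inverse_non_unit _ hu]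
    exact Commute.zero_right _

lemma commute_self_res (Q : V →L[ℂ] V) (r : ℝ) : Commute Q (res Q r) :=
  commute_res ((Commute.refl Q).mul_right (Commute.refl Q)) r

/-- Both bounds come from pairing `y = x + r Q² x` with `x = (1 + r Q²)⁻¹ y`. -/
lemma norm_res_le {Q : V →L[ℂ] V} (hQ : IsSelfAdjoint Q) {r : ℝ} (hr : 0 ≤ r) (y : V) :
    ‖res Q r y‖ ≤ ‖y‖ ∧ r * ‖Q (res Q r y)‖ ^ 2 ≤ ‖y‖ ^ 2 := by
  set x := res Q r y with hx
  have h1 : y = x + (r : ℂ) • Q (Q x) := by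
    have := congrArg (fun T : V →L[ℂ] V => T y) (mul_res_cancel hQ hr)
    simpa [← hx] using this.symm
  have h2 : RCLike.re (inner ℂ y x) = ‖x‖ ^ 2 + r * ‖Q x‖ ^ 2 := by
    have h3 : inner ℂ (Q (Q x)) x = inner ℂ (Q x) (Q x) := by
      rw [← ContinuousLinearMap.adjoint_inner_right]
      rw [← ContinuousLinearMap.star_eq_adjoint, hQ.star_eq]
    rw [h1, inner_add_left, inner_smul_left, h3, map_add, inner_self_eq_norm_sq_to_K,
      inner_self_eq_norm_sq_to_K]
    simp [← Complex.ofReal_pow]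
  have h3 : ‖x‖ ^ 2 + r * ‖Q x‖ ^ 2 ≤ ‖y‖ * ‖x‖ := h2 ▸ re_inner_le_norm y x
  have h4 : 0 ≤ r * ‖Q x‖ ^ 2 := by positivity
  have h5 : ‖x‖ ≤ ‖y‖ := by
    by_contra! h
    nlinarith [norm_nonneg x, norm_nonneg y]
  exact ⟨h5, by nlinarith [norm_nonneg x, norm_nonneg y]⟩

lemma norm_damp_le {Q : V →L[ℂ] V} (hQ : IsSelfAdjoint Q) {r : ℝ} (hr : 0 < r) :
    ‖damp Q r‖ ≤ (√r)⁻¹ := by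
  refine ContinuousLinearMap.opNorm_le_bound _ (by positivity) fun y => ?_
  have h := (norm_res_le hQ hr.le y).2
  have hs : 0 < √r := Real.sqrt_pos.2 hr
  have h2 : √r * ‖Q (res Q r y)‖ ≤ ‖y‖ := by
    refine abs_le_of_sq_le_sq' ?_ (norm_nonneg _) |>.2
    rw [mul_pow, Real.sq_sqrt hr.le]
    exact h
  change ‖Q (res Q r y)‖ ≤ _
  rw [inv_mul_eq_div, le_div_iff₀ hs, mul_comm]
  exact h2

lemma norm_dampSq_le {γ : V →ₗᵢ[ℂ] V} {Q : V →L[ℂ] V} (hQ : IsSelfAdjoint Q) {r : ℝ}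
    (hr : 0 < r) : ‖dampSq γ Q r‖ ≤ 2 / r := by
  refine ContinuousLinearMap.opNorm_le_bound _ (by positivity) fun y => ?_
  change ‖γ (Q (Q (res Q r y)))‖ ≤ _
  rw [γ.norm_map]
  have h := (norm_res_le hQ hr.le y).1
  have h1 : (r : ℂ) • Q (Q (res Q r y)) = y - res Q r y := by
    have := congrArg (fun T : V →L[ℂ] V => T y) (mul_res_cancel hQ hr.le)
    rw [eq_sub_iff_add_eq']
    simpa using this
  have h2 := congrArg norm h1
  rw [norm_smul, Complex.norm_real, Real.norm_of_nonneg hr.le] at h2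
  have h3 := norm_sub_le y (res Q r y)
  rw [div_mul_eq_mul_div, le_div_iff₀ hr]
  nlinarith

lemma continuousAt_damp {Q : V →L[ℂ] V} (hQ : IsSelfAdjoint Q) {r : ℝ} (hr : 0 ≤ r) :
    ContinuousAt (fun q : (V →L[ℂ] V) × ℝ => damp q.1 q.2) (Q, r) := by
  obtain ⟨u, hu⟩ := isUnit_one_add_smul_sq hQ hr
  have h1 : ContinuousAt (fun q : (V →L[ℂ] V) × ℝ => 1 + (q.2 : ℂ) • (q.1 * q.1)) (Q, r) := by
    fun_prop
  have h2 : ContinuousAt Ring.inverse ((fun q : (V →L[ℂ] V) × ℝ =>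
      1 + (q.2 : ℂ) • (q.1 * q.1)) (Q, r)) := by
    simp only [← hu]
    exact NormedRing.inverse_continuousAt u
  exact continuousAt_fst.mul (ContinuousAt.comp (f := fun q : (V →L[ℂ] V) × ℝ =>
    1 + (q.2 : ℂ) • (q.1 * q.1)) h2 h1)

lemma continuousAt_dampSq (γ : V →ₗᵢ[ℂ] V) {Q : V →L[ℂ] V} (hQ : IsSelfAdjoint Q) {r : ℝ}
    (hr : 0 ≤ r) : ContinuousAt (fun q : (V →L[ℂ] V) × ℝ => dampSq γ q.1 q.2) (Q, r) :=
  (continuousAt_const.mul continuousAt_fst).mul (continuousAt_damp hQ hr)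

@[simp] lemma damp_zero_left (r : ℝ) : damp (0 : V →L[ℂ] V) r = 0 := by
  simp [damp]

@[simp] lemma dampSq_zero_left (γ : V →ₗᵢ[ℂ] V) (r : ℝ) : dampSq γ 0 r = 0 := by
  simp [dampSq]

/-- A grading operator: a self-adjoint involution. -/
structure IsGrading (γ : V →ₗᵢ[ℂ] V) : Prop where
  sq : γ.toContinuousLinearMap * γ.toContinuousLinearMap = 1
  selfAdjoint : IsSelfAdjoint γ.toContinuousLinearMap

variable {γ : V →ₗᵢ[ℂ] V} {Q : V →L[ℂ] V}

lemma commute_grading_sq (hγ : IsGrading γ) (hQ : Q ∈ KSpace γ) :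
    Commute γ.toContinuousLinearMap (Q * Q) := by
  have h := hQ.2.2
  have h1 : (2 : ℂ) • (γ.toContinuousLinearMap * (Q * Q)) =
      (2 : ℂ) • ((Q * Q) * γ.toContinuousLinearMap) := by
    rw [← mul_smul_comm, ← smul_mul_assoc (2 : ℂ) (Q * Q), h, mul_add, add_mul, ← mul_assoc _ _ Q, hγ.sq,
      one_mul,
      mul_assoc Q, hγ.sq, mul_one, add_comm, mul_assoc]
  exact smul_right_injective _ (two_ne_zero (α := ℂ)) h1

lemma commute_grading_res (hγ : IsGrading γ) (hQ : Q ∈ KSpace γ) (r : ℝ) :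
    Commute γ.toContinuousLinearMap (res Q r) :=
  commute_res (commute_grading_sq hγ hQ) r

lemma dampSq_eq (hγ : IsGrading γ) (hQ : Q ∈ KSpace γ) (r : ℝ) :
    dampSq γ Q r = (Q * Q * res Q r) * γ.toContinuousLinearMap := by
  rw [dampSq, damp_eq, mul_assoc, ← mul_assoc Q, mul_assoc _ (res Q r),
    ← (commute_grading_res hγ hQ r).eq, ← mul_assoc, ← mul_assoc, mul_assoc _ Q Q,
    (commute_grading_sq hγ hQ).eq, mul_assoc]

lemma grading_mul_dampSq (hγ : IsGrading γ) (r : ℝ) :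
    γ.toContinuousLinearMap * dampSq γ Q r = Q * Q * res Q r := by
  rw [dampSq, damp_eq, ← mul_assoc, ← mul_assoc, ← mul_assoc, hγ.sq, one_mul]

lemma dampSq_mul_grading (hγ : IsGrading γ) (hQ : Q ∈ KSpace γ) (r : ℝ) :
    dampSq γ Q r * γ.toContinuousLinearMap = Q * Q * res Q r := by
  rw [dampSq_eq hγ hQ, mul_assoc, hγ.sq, mul_one]

lemma damp_mul_grading_add (hγ : IsGrading γ) (hQ : Q ∈ KSpace γ) (r : ℝ) :
    damp Q r * γ.toContinuousLinearMap + γ.toContinuousLinearMap * damp Q r =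
      (2 : ℂ) • (Q * Q * res Q r) := by
  rw [damp_eq, mul_assoc, ← (commute_grading_res hγ hQ r).eq, ← mul_assoc, ← mul_assoc, ← add_mul,
    ← hQ.2.2, smul_mul_assoc]

lemma damp_mul_damp (Q : V →L[ℂ] V) (r t : ℝ) :
    damp Q r * damp Q t = Q * Q * (res Q r * res Q t) := by
  rw [damp_eq, damp_eq, mul_assoc, ← mul_assoc (res Q r), ← (commute_self_res Q r).eq]
  simp only [mul_assoc]

lemma dampSq_mul_dampSq (hγ : IsGrading γ) (hQ : Q ∈ KSpace γ) (r t : ℝ) :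
    dampSq γ Q r * dampSq γ Q t = Q * Q * (Q * Q) * (res Q r * res Q t) := by
  have hc : Commute (Q * Q) (res Q r) := (commute_self_res Q r).mul_left (commute_self_res Q r)
  rw [dampSq_eq hγ hQ r, mul_assoc, grading_mul_dampSq hγ, mul_assoc (Q * Q),
    ← mul_assoc (res Q r), ← hc.eq]
  simp only [mul_assoc]

/-- The coefficient of `1` in a product of two dampings of an external product with `d² = r`; see
`extK_mul_extK`. -/
lemma damp_mul_damp_add (hγ : IsGrading γ) (hQ : Q ∈ KSpace γ) {r : ℝ} (hr : 0 ≤ r) (t : ℝ) :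
    damp Q r * damp Q t + (r : ℂ) • (dampSq γ Q r * dampSq γ Q t) = Q * Q * res Q t := by
  have h := mul_res_cancel hQ.2.1 hr
  rw [damp_mul_damp, dampSq_mul_dampSq hγ hQ]
  calc _ = Q * Q * (((1 + (r : ℂ) • (Q * Q)) * res Q r) * res Q t) := by
        simp only [mul_add, add_mul, one_mul, smul_mul_assoc, mul_smul_comm, mul_assoc]
    _ = _ := by rw [h, one_mul]

/-- This makes the coefficient of `d + g - 1` vanish in a product of two dampings of an external
product; see `extK_mul_extK`. -/
lemma damp_mul_dampSq_add (hγ : IsGrading γ) (hQ : Q ∈ KSpace γ) (r t : ℝ) :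
    damp Q r * dampSq γ Q t + dampSq γ Q r * damp Q t =
      (2 : ℂ) • (dampSq γ Q r * dampSq γ Q t) := by
  have hc : Commute (Q * Q) (res Q r) := (commute_self_res Q r).mul_left (commute_self_res Q r)
  have hg := (commute_grading_res hγ hQ r).eq
  have hs := (commute_grading_sq hγ hQ).eq
  have h1 : damp Q r * dampSq γ Q t =
      Q * γ.toContinuousLinearMap * (Q * Q * (res Q r * res Q t)) := by
    rw [damp_eq, dampSq, damp_eq]
    calc _ = Q * (res Q r * γ.toContinuousLinearMap) * (Q * Q) * res Q t := by
          simp only [mul_assoc]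
      _ = Q * γ.toContinuousLinearMap * (res Q r * (Q * Q)) * res Q t := by
          rw [← hg]; simp only [mul_assoc]
      _ = _ := by rw [← hc.eq]; simp only [mul_assoc]
  have h2 : dampSq γ Q r * damp Q t =
      γ.toContinuousLinearMap * Q * (Q * Q * (res Q r * res Q t)) := by
    rw [dampSq, damp_eq, damp_eq]
    calc _ = γ.toContinuousLinearMap * (Q * Q) * (res Q r * Q) * res Q t := by
          simp only [mul_assoc]
      _ = _ := by rw [← (commute_self_res Q r).eq]; simp only [mul_assoc]
  rw [h1, h2, ← add_mul, ← hQ.2.2, dampSq_mul_dampSq hγ hQ, smul_mul_assoc]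
  simp only [mul_assoc]

/-- The identity behind the additivity of damping parameters in `damp_extK`; there `Q² (1 + r Q²)⁻¹`
is the square of an external product. -/
lemma res_add_mul {Q : V →L[ℂ] V} (hQ : IsSelfAdjoint Q) {r t : ℝ} (hr : 0 ≤ r) (ht : 0 ≤ t) :
    res Q (r + t) * (1 + (t : ℂ) • (Q * Q * res Q r)) = res Q r := by
  have h1 := mul_res_cancel hQ hr
  have h2 := res_mul_cancel hQ (add_nonneg hr ht)
  have h3 : 1 + (t : ℂ) • (Q * Q * res Q r) =
      (1 + ((r + t : ℝ) : ℂ) • (Q * Q)) * res Q r := by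
    rw [Complex.ofReal_add, add_smul, ← add_assoc, add_mul, h1, smul_mul_assoc]
  rw [h3, ← mul_assoc, h2, one_mul]

lemma isSelfAdjoint_res {Q : V →L[ℂ] V} (hQ : IsSelfAdjoint Q) (r : ℝ) :
    IsSelfAdjoint (res Q r) := by
  refine IsSelfAdjoint.ringInverse ?_
  refine (IsSelfAdjoint.one _).add ?_
  refine IsSelfAdjoint.smul (by simp [isSelfAdjoint_iff]) ?_
  rw [isSelfAdjoint_iff, star_mul, hQ.star_eq]

lemma isSelfAdjoint_damp {Q : V →L[ℂ] V} (hQ : IsSelfAdjoint Q) (r : ℝ) :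
    IsSelfAdjoint (damp Q r) := by
  rw [isSelfAdjoint_iff, damp_eq, star_mul, hQ.star_eq, (isSelfAdjoint_res hQ r).star_eq,
    (commute_self_res Q r).eq]

lemma isSelfAdjoint_dampSq (hγ : IsGrading γ) (hQ : Q ∈ KSpace γ) (r : ℝ) :
    IsSelfAdjoint (dampSq γ Q r) := by
  have hc : Commute (Q * Q) (res Q r) := (commute_self_res Q r).mul_left (commute_self_res Q r)
  rw [isSelfAdjoint_iff, dampSq_eq hγ hQ]
  simp only [star_mul, hQ.2.1.star_eq, (isSelfAdjoint_res hQ.2.1 r).star_eq,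
    hγ.selfAdjoint.star_eq]
  rw [← hc.eq, ← mul_assoc, (commute_grading_sq hγ hQ).eq, mul_assoc,
    (commute_grading_res hγ hQ r).eq, ← mul_assoc]

lemma isCompactOperator_mul {A B : V →L[ℂ] V} (hA : IsCompactOperator A) :
    IsCompactOperator (A * B) :=
  hA.comp_clm B

lemma isCompactOperator_mul_right {A B : V →L[ℂ] V} (hB : IsCompactOperator B) :
    IsCompactOperator (A * B) :=
  hB.clm_comp A

lemma isCompactOperator_damp (hQ : IsCompactOperator Q) (r : ℝ) :
    IsCompactOperator (damp Q r) :=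
  isCompactOperator_mul hQ

lemma isCompactOperator_dampSq (hQ : IsCompactOperator Q) (r : ℝ) :
    IsCompactOperator (dampSq γ Q r) :=
  isCompactOperator_mul_right (isCompactOperator_damp hQ r)

end Damp

/-! ### Operators transported by a frame of isometries -/

section Tens

set_option linter.unusedSectionVars false

variable {V W : Type} [NormedAddCommGroup V] [InnerProductSpace ℂ V] [CompleteSpace V]
  [NormedAddCommGroup W] [InnerProductSpace ℂ W] [CompleteSpace W]
  {ι : Type} [Fintype ι] [DecidableEq ι]

/-- The operator `M ⊗ X` on `ℂ^ι ⊗ V`, transported to `W` along `e_i ⊗ x ↦ u i x`. -/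
def tens (u : ι → V →L[ℂ] W) (M : Matrix ι ι ℂ) (X : V →L[ℂ] V) : W →L[ℂ] W :=
  ∑ i, ∑ j, M i j • (u i ∘L X ∘L (u j).adjoint)

/-- The map `ℂ^ι ⊗ V → W`, `e_i ⊗ x ↦ u i x`, is isometric. -/
def IsFrame (u : ι → V →L[ℂ] W) : Prop :=
  ∀ i j, (u i).adjoint ∘L u j = if i = j then 1 else 0

variable {u : ι → V →L[ℂ] W}

lemma tens_add_left (u : ι → V →L[ℂ] W) (M M' : Matrix ι ι ℂ) (X : V →L[ℂ] V) :
    tens u (M + M') X = tens u M X + tens u M' X := by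
  simp only [tens, Matrix.add_apply, add_smul, Finset.sum_add_distrib]

lemma tens_smul_left (u : ι → V →L[ℂ] W) (c : ℂ) (M : Matrix ι ι ℂ) (X : V →L[ℂ] V) :
    tens u (c • M) X = c • tens u M X := by
  simp only [tens, Matrix.smul_apply, Finset.smul_sum, smul_smul, smul_eq_mul]

lemma tens_sub_left (u : ι → V →L[ℂ] W) (M M' : Matrix ι ι ℂ) (X : V →L[ℂ] V) :
    tens u (M - M') X = tens u M X - tens u M' X := by
  simp only [tens, Matrix.sub_apply, sub_smul, Finset.sum_sub_distrib]

lemma tens_add_right (u : ι → V →L[ℂ] W) (M : Matrix ι ι ℂ) (X Y : V →L[ℂ] V) :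
    tens u M (X + Y) = tens u M X + tens u M Y := by
  simp only [tens, ContinuousLinearMap.add_comp, ContinuousLinearMap.comp_add, smul_add,
    Finset.sum_add_distrib]

lemma tens_smul_right (u : ι → V →L[ℂ] W) (c : ℂ) (M : Matrix ι ι ℂ) (X : V →L[ℂ] V) :
    tens u M (c • X) = c • tens u M X := by
  simp only [tens, ContinuousLinearMap.smul_comp, ContinuousLinearMap.comp_smul, Finset.smul_sum]
  exact Finset.sum_congr rfl fun i _ => Finset.sum_congr rfl fun j _ => smul_comm _ _ _

@[simp] lemma tens_zero_right (u : ι → V →L[ℂ] W) (M : Matrix ι ι ℂ) : tens u M 0 = 0 := by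
  simp [tens]

lemma tens_mul (hu : IsFrame u) (M M' : Matrix ι ι ℂ) (X X' : V →L[ℂ] V) :
    tens u M X * tens u M' X' = tens u (M * M') (X * X') := by
  have h : ∀ i j k l, (M i j • (u i ∘L X ∘L (u j).adjoint)) *
      (M' k l • (u k ∘L X' ∘L (u l).adjoint)) =
      if j = k then (M i j * M' k l) • (u i ∘L (X * X') ∘L (u l).adjoint) else 0 := by
    intro i j k l
    have h1 : (u i ∘L X ∘L (u j).adjoint) * (u k ∘L X' ∘L (u l).adjoint) =
        u i ∘L X ∘L ((u j).adjoint ∘L u k) ∘L X' ∘L (u l).adjoint := rfl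
    rw [smul_mul_smul_comm, h1, hu j k]
    split_ifs with h
    · rfl
    · ext x; simp
  rw [tens, tens, tens, Finset.sum_mul]
  refine Finset.sum_congr rfl fun i _ => ?_
  simp only [Finset.sum_mul, Matrix.mul_apply, Finset.sum_smul]
  conv_rhs => rw [Finset.sum_comm]
  refine Finset.sum_congr rfl fun j _ => ?_
  simp only [Finset.mul_sum, h]
  rw [Finset.sum_comm]
  simp

lemma tens_adjoint (u : ι → V →L[ℂ] W) (M : Matrix ι ι ℂ) (X : V →L[ℂ] V) :
    star (tens u M X) = tens u M.conjTranspose (star X) := by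
  simp only [tens, star_sum, star_smul, ContinuousLinearMap.star_eq_adjoint,
    ContinuousLinearMap.adjoint_comp, ContinuousLinearMap.adjoint_adjoint,
    Matrix.conjTranspose_apply, ContinuousLinearMap.comp_assoc]
  rw [Finset.sum_comm]

lemma isCompactOperator_sum {κ : Type*} (s : Finset κ) {f : κ → W →L[ℂ] W}
    (h : ∀ i ∈ s, IsCompactOperator (f i)) : IsCompactOperator (∑ i ∈ s, f i : W →L[ℂ] W) := by
  classical
  induction s using Finset.induction_on with
  | empty => simpa using isCompactOperator_zero
  | insert i s hi ih =>
    rw [Finset.sum_insert hi]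
    exact (h i (Finset.mem_insert_self _ _)).add (ih fun j hj => h j (Finset.mem_insert_of_mem hj))

lemma isCompactOperator_tens (u : ι → V →L[ℂ] W) (M : Matrix ι ι ℂ) {X : V →L[ℂ] V}
    (hX : IsCompactOperator X) : IsCompactOperator (tens u M X) :=
  isCompactOperator_sum _ fun i _ => isCompactOperator_sum _ fun j _ =>
    IsCompactOperator.smul ((hX.comp_clm (u j).adjoint).clm_comp (u i)) (M i j)

lemma IsFrame.norm_le (hu : IsFrame u) (i : ι) : ‖u i‖ ≤ 1 := by
  refine ContinuousLinearMap.opNorm_le_bound _ zero_le_one fun x => ?_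
  have h := congrArg (fun T : V →L[ℂ] V => T x) (hu i i)
  simp only [if_true, ContinuousLinearMap.comp_apply, one_apply_eq_self] at h
  have h2 : ‖u i x‖ ^ 2 = ‖x‖ ^ 2 := by
    have h3 : inner ℂ (u i x) (u i x) = (inner ℂ x x : ℂ) := by
      rw [← ContinuousLinearMap.adjoint_inner_right, h]
    rw [inner_self_eq_norm_sq_to_K, inner_self_eq_norm_sq_to_K] at h3
    exact_mod_cast h3
  rw [one_mul]
  exact ((pow_left_inj₀ (norm_nonneg _) (norm_nonneg _) two_ne_zero).1 h2).le

lemma norm_tens_le (hu : IsFrame u) (M : Matrix ι ι ℂ) (X : V →L[ℂ] V) :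
    ‖tens u M X‖ ≤ (∑ i, ∑ j, ‖M i j‖) * ‖X‖ := by
  rw [tens, Finset.sum_mul]
  refine (norm_sum_le _ _).trans (Finset.sum_le_sum fun i _ => ?_)
  rw [Finset.sum_mul]
  refine (norm_sum_le _ _).trans (Finset.sum_le_sum fun j _ => ?_)
  rw [norm_smul]
  refine mul_le_mul_of_nonneg_left ?_ (norm_nonneg _)
  have h1 : ‖(u j).adjoint‖ ≤ 1 := by
    rw [LinearIsometryEquiv.norm_map]
    exact hu.norm_le j
  calc ‖u i ∘L X ∘L (u j).adjoint‖ ≤ ‖u i‖ * (‖X‖ * ‖(u j).adjoint‖) :=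
        (ContinuousLinearMap.opNorm_comp_le _ _).trans
          (mul_le_mul_of_nonneg_left (ContinuousLinearMap.opNorm_comp_le _ _) (norm_nonneg _))
    _ ≤ 1 * (‖X‖ * 1) := by
        gcongr
        exact hu.norm_le i
    _ = ‖X‖ := by ring

/-- The external product of `Q` with a matrix complex, on the range of a frame. Here `k` stands for
`d + g - 1` with `d` the odd operator and `g` the grading of the complex. -/
def extK (u : ι → V →L[ℂ] W) (γ : V →ₗᵢ[ℂ] V) (Q : V →L[ℂ] V) (k : Matrix ι ι ℂ) (r : ℝ) :
    W →L[ℂ] W :=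
  tens u 1 (damp Q r) + tens u k (dampSq γ Q r)

@[simp] lemma extK_zero (u : ι → V →L[ℂ] W) (γ : V →ₗᵢ[ℂ] V) (k : Matrix ι ι ℂ) (r : ℝ) :
    extK u γ 0 k r = 0 := by
  simp [extK]

variable {γ : V →ₗᵢ[ℂ] V} {Q : V →L[ℂ] V} {Γ : W →ₗᵢ[ℂ] W} {ε : ι → ℂ} {k : Matrix ι ι ℂ}

lemma grading_mul_tens (hΓ : ∀ i, Γ.toContinuousLinearMap ∘L u i =
    ε i • (u i ∘L γ.toContinuousLinearMap)) (M : Matrix ι ι ℂ) (X : V →L[ℂ] V) :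
    Γ.toContinuousLinearMap * tens u M X =
      tens u (Matrix.diagonal ε * M) (γ.toContinuousLinearMap * X) := by
  simp only [tens, Finset.mul_sum, Matrix.diagonal_mul]
  refine Finset.sum_congr rfl fun i _ => Finset.sum_congr rfl fun j _ => ?_
  rw [mul_smul_comm]
  have : Γ.toContinuousLinearMap * (u i ∘L X ∘L (u j).adjoint) =
      (Γ.toContinuousLinearMap ∘L u i) ∘L X ∘L (u j).adjoint := rfl
  rw [this, hΓ, ContinuousLinearMap.smul_comp, smul_smul, mul_comm]
  rfl

lemma tens_mul_grading (hγ : IsGrading γ) (hΓ' : IsGrading Γ)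
    (hΓ : ∀ i, Γ.toContinuousLinearMap ∘L u i = ε i • (u i ∘L γ.toContinuousLinearMap))
    (hε : ∀ i, star (ε i) = ε i) (M : Matrix ι ι ℂ) (X : V →L[ℂ] V) :
    tens u M X * Γ.toContinuousLinearMap =
      tens u (M * Matrix.diagonal ε) (X * γ.toContinuousLinearMap) := by
  have h := congrArg star (grading_mul_tens hΓ M.conjTranspose (star X))
  have hd : (Matrix.diagonal ε).conjTranspose = Matrix.diagonal ε := by
    rw [Matrix.diagonal_conjTranspose]
    congr 1
    ext i
    exact hε i
  rw [star_mul, tens_adjoint, tens_adjoint, Matrix.conjTranspose_mul, star_mul,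
    Matrix.conjTranspose_conjTranspose, star_star, hΓ'.selfAdjoint.star_eq,
    hγ.selfAdjoint.star_eq, hd] at h
  exact h

/-- The square of `γ ⊗ g + D ⊗ 1 + γ ⊗ d` is `1 + D² + r`, a scalar on the matrix factor. The
hypothesis `hk` expresses `(d + g)² = r + 1` in terms of `k = d + g - 1`. -/
lemma extK_mul_extK (hu : IsFrame u) (hγ : IsGrading γ) (hQ : Q ∈ KSpace γ) {r : ℝ} (hr : 0 ≤ r)
    (hk : k * k = (r : ℂ) • 1 - (2 : ℂ) • k) (t : ℝ) :
    extK u γ Q k r * extK u γ Q k t = tens u 1 (Q * Q * res Q t) := by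
  have h1 := damp_mul_damp_add hγ hQ hr t
  have h2 := damp_mul_dampSq_add hγ hQ r t
  rw [← h1, extK, extK, add_mul, mul_add, mul_add, tens_mul hu, tens_mul hu, tens_mul hu,
    tens_mul hu, hk, tens_add_right, tens_smul_right, tens_sub_left, tens_smul_left,
    tens_smul_left, one_mul, one_mul, mul_one]
  have h3 := congrArg (tens u k) h2
  rw [tens_add_right, tens_smul_right] at h3
  rw [← h3]
  abel

lemma isSelfAdjoint_extK (hγ : IsGrading γ) (hQ : Q ∈ KSpace γ) (hk : k.conjTranspose = k)
    (r : ℝ) : IsSelfAdjoint (extK u γ Q k r) := by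
  rw [isSelfAdjoint_iff, extK, star_add, tens_adjoint, tens_adjoint, hk,
    Matrix.conjTranspose_one, (isSelfAdjoint_damp hQ.2.1 r).star_eq,
    (isSelfAdjoint_dampSq hγ hQ r).star_eq]

/-- The external product is a point of `KSpace`. The hypothesis `hkε` says that the grading `g`,
with diagonal `ε`, anticommutes with `d`. -/
lemma extK_mem_KSpace (hu : IsFrame u) (hγ : IsGrading γ) (hΓ' : IsGrading Γ)
    (hΓ : ∀ i, Γ.toContinuousLinearMap ∘L u i = ε i • (u i ∘L γ.toContinuousLinearMap))
    (hε : ∀ i, star (ε i) = ε i) (hQ : Q ∈ KSpace γ) {r : ℝ} (hr : 0 ≤ r)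
    (hk : k * k = (r : ℂ) • 1 - (2 : ℂ) • k) (hk' : k.conjTranspose = k)
    (hkε : k * Matrix.diagonal ε + Matrix.diagonal ε * k =
      -((2 : ℂ) • (Matrix.diagonal ε - 1))) :
    extK u γ Q k r ∈ KSpace Γ := by
  refine ⟨?_, isSelfAdjoint_extK hγ hQ hk' r, ?_⟩
  · exact (isCompactOperator_tens _ _ (isCompactOperator_damp hQ.1 r)).add
      (isCompactOperator_tens _ _ (isCompactOperator_dampSq hQ.1 r))
  · rw [extK_mul_extK hu hγ hQ hr hk, extK, add_mul, mul_add, tens_mul_grading hγ hΓ' hΓ hε,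
      tens_mul_grading hγ hΓ' hΓ hε, grading_mul_tens hΓ, grading_mul_tens hΓ, one_mul, mul_one,
      dampSq_mul_grading hγ hQ, grading_mul_dampSq hγ]
    have h1 := congrArg (tens u (Matrix.diagonal ε)) (damp_mul_grading_add hγ hQ r)
    have h2 := congrArg (fun M => tens u M (Q * Q * res Q r)) hkε
    simp only [tens_add_right, tens_add_left, tens_smul_right, ← neg_smul, tens_smul_left,
      tens_sub_left] at h1 h2
    rw [add_add_add_comm, h1, h2]
    module

/-- Damping an external product by `t` adds `t` to its damping parameter. -/
lemma damp_extK (hu : IsFrame u) (hγ : IsGrading γ) (hQ : Q ∈ KSpace γ) {r : ℝ} (hr : 0 ≤ r)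
    (hk : k * k = (r : ℂ) • 1 - (2 : ℂ) • k) (hk' : k.conjTranspose = k) {t : ℝ} (ht : 0 ≤ t) :
    damp (extK u γ Q k r) t = extK u γ Q k (r + t) := by
  have hA := isSelfAdjoint_extK (u := u) hγ hQ hk' r
  have h : extK u γ Q k (r + t) * (1 + (t : ℂ) • (extK u γ Q k r * extK u γ Q k r)) =
      extK u γ Q k r := by
    have h1 := res_add_mul hQ.2.1 hr ht
    have h2 : damp Q (r + t) + (t : ℂ) • (damp Q (r + t) * (Q * Q * res Q r)) = damp Q r := by
      have h4 := congrArg (Q * ·) h1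
      simp only [mul_add, mul_one, mul_smul_comm] at h4
      simpa only [damp_eq, mul_assoc] using h4
    have h3 : dampSq γ Q (r + t) + (t : ℂ) • (dampSq γ Q (r + t) * (Q * Q * res Q r)) =
        dampSq γ Q r := by
      have h4 := congrArg (γ.toContinuousLinearMap * Q * ·) h2
      simp only [mul_add, mul_smul_comm] at h4
      simpa only [dampSq, mul_assoc] using h4
    rw [extK_mul_extK hu hγ hQ hr hk, mul_add, mul_one, mul_smul_comm]
    simp only [extK]
    rw [add_mul, tens_mul hu, tens_mul hu, mul_one, mul_one, ← h2, ← h3, tens_add_right,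
      tens_add_right, tens_smul_right, tens_smul_right]
    module
  calc damp (extK u γ Q k r) t = extK u γ Q k r * res (extK u γ Q k r) t := rfl
    _ = extK u γ Q k (r + t) * ((1 + (t : ℂ) • (extK u γ Q k r * extK u γ Q k r)) *
          res (extK u γ Q k r) t) := by rw [← mul_assoc, h]
    _ = _ := by rw [mul_res_cancel hA ht, mul_one]

lemma dampSq_extK (hu : IsFrame u) (hγ : IsGrading γ)
    (hΓ : ∀ i, Γ.toContinuousLinearMap ∘L u i = ε i • (u i ∘L γ.toContinuousLinearMap))
    (hQ : Q ∈ KSpace γ) {r : ℝ} (hr : 0 ≤ r)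
    (hk : k * k = (r : ℂ) • 1 - (2 : ℂ) • k) (hk' : k.conjTranspose = k) {t : ℝ} (ht : 0 ≤ t) :
    dampSq Γ (extK u γ Q k r) t = tens u (Matrix.diagonal ε) (dampSq γ Q (r + t)) := by
  rw [dampSq, damp_extK hu hγ hQ hr hk hk' ht, mul_assoc, extK_mul_extK hu hγ hQ hr hk,
    grading_mul_tens hΓ, mul_one, dampSq, damp_eq]
  simp only [mul_assoc]

end Tens

/-! ### Hilbert sums, their gradings and real structures -/

section HilbertSum

set_option linter.unusedSectionVars false

variable {ι V : Type} [NormedAddCommGroup V] [InnerProductSpace ℂ V] [CompleteSpace V]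

open Classical in
lemma ins_apply_self (i : ι) (x : V) : (ins i x : L2 ι V) i = x := by
  rw [ins, lp.singleContinuousLinearMap_apply, lp.coeFn_single, Pi.single_eq_same]

open Classical in
lemma ins_apply_of_ne {i j : ι} (x : V) (h : j ≠ i) : (ins i x : L2 ι V) j = 0 := by
  rw [ins, lp.singleContinuousLinearMap_apply, lp.coeFn_single, Pi.single_eq_of_ne h]

lemma ins_apply [DecidableEq ι] (i : ι) (x : V) (j : ι) :
    (ins i x : L2 ι V) j = if j = i then x else 0 := by
  split_ifs with h
  · rw [h, ins_apply_self]
  · rw [ins_apply_of_ne _ h]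

@[simp] lemma prj_apply (i : ι) (f : L2 ι V) : prj i f = f i := rfl

lemma ins_adjoint (i : ι) : (ins i : V →L[ℂ] L2 ι V).adjoint = prj i := by
  classical
  symm
  rw [ContinuousLinearMap.eq_adjoint_iff]
  intro f x
  rw [ins, lp.singleContinuousLinearMap_apply, lp.inner_single_right]
  rfl

lemma prj_comp_ins [DecidableEq ι] (i j : ι) :
    (prj i : L2 ι V →L[ℂ] V) ∘L ins j = if i = j then 1 else 0 := by
  ext x
  rw [ContinuousLinearMap.comp_apply, prj_apply, ins_apply]
  split_ifs <;> rfl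

lemma diagOp_apply (A : ι → V →ₗᵢ[ℂ] V) (f : L2 ι V) (i : ι) : diagOp A f i = A i (f i) := rfl

lemma diagOp_comp_ins (A : ι → V →ₗᵢ[ℂ] V) (i : ι) :
    (diagOp A).toContinuousLinearMap ∘L ins i = ins i ∘L (A i).toContinuousLinearMap := by
  classical
  ext x j
  change diagOp A (ins i x) j = (ins i (A i x) : L2 ι V) j
  rw [diagOp_apply, ins_apply, ins_apply]
  split_ifs with h
  · rw [h]
  · simp

lemma isGrading_iff {γ : V →ₗᵢ[ℂ] V} : IsGrading γ ↔ ∀ x, γ (γ x) = x := by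
  constructor
  · intro h x
    exact congrArg (fun T : V →L[ℂ] V => T x) h.sq
  · intro h
    refine ⟨by ext x; exact h x, ?_⟩
    rw [isSelfAdjoint_iff, ContinuousLinearMap.star_eq_adjoint, eq_comm,
      ContinuousLinearMap.eq_adjoint_iff]
    intro x y
    change inner ℂ (γ x) y = inner ℂ x (γ y)
    rw [← γ.inner_map_map, h]

lemma isGrading_diagOp {A : ι → V →ₗᵢ[ℂ] V} (hA : ∀ i, IsGrading (A i)) :
    IsGrading (diagOp A) := by
  rw [isGrading_iff]
  intro f
  ext i
  rw [diagOp_apply, diagOp_apply, isGrading_iff.1 (hA i)]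

lemma signed_apply (k : ℕ) (A : V →ₗᵢ[ℂ] V) (x : V) : signed k A x = (-1 : ℂ) ^ k • A x := by
  rw [signed]
  split_ifs with h
  · rw [h.neg_one_pow, one_smul]
  · rw [(Nat.not_even_iff_odd.1 h).neg_one_pow, neg_one_smul]
    rfl

lemma isGrading_signed {A : V →ₗᵢ[ℂ] V} (hA : IsGrading A) (k : ℕ) :
    IsGrading (signed k A) := by
  rw [isGrading_iff] at hA ⊢
  intro x
  rw [signed_apply, signed_apply, map_smul, hA, smul_smul, ← mul_pow]
  simp

lemma isGrading_gradK : IsGrading gradK :=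
  isGrading_diagOp fun _ => isGrading_signed (isGrading_iff.2 fun _ => rfl) _

lemma isGrading_gradU : IsGrading gradU :=
  isGrading_diagOp fun _ => isGrading_signed isGrading_gradK _

lemma isGrading_gradN (N : ℕ) : IsGrading (gradN N) :=
  isGrading_diagOp fun _ => isGrading_signed isGrading_gradU _

lemma signed_toContinuousLinearMap (k : ℕ) (A : V →ₗᵢ[ℂ] V) :
    (signed k A).toContinuousLinearMap = (-1 : ℂ) ^ k • A.toContinuousLinearMap := by
  ext x
  exact signed_apply k A x

/-- `T` and `T'` are conjugate under the real structures. -/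
def IsConj {V W : Type} [NormedAddCommGroup V] [NormedSpace ℂ V] [Star V]
    [NormedAddCommGroup W] [NormedSpace ℂ W] [Star W] (T T' : V →L[ℂ] W) : Prop :=
  ∀ x, T' (star x) = star (T x)

section Conj

variable {V W X : Type} [NormedAddCommGroup V] [InnerProductSpace ℂ V] [StarAddMonoid V]
  [NormedStarGroup V] [StarModule ℂ V]
  [NormedAddCommGroup W] [InnerProductSpace ℂ W] [StarAddMonoid W] [StarModule ℂ W]
  [NormedAddCommGroup X] [InnerProductSpace ℂ X] [StarAddMonoid X] [StarModule ℂ X]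

lemma IsConj.comp {S S' : W →L[ℂ] X} {T T' : V →L[ℂ] W} (hS : IsConj S S') (hT : IsConj T T') :
    IsConj (S ∘L T) (S' ∘L T') := fun x => by
  rw [ContinuousLinearMap.comp_apply, hT, hS]; rfl

lemma IsConj.add {S S' T T' : V →L[ℂ] W} (hS : IsConj S S') (hT : IsConj T T') :
    IsConj (S + T) (S' + T') := fun x => by
  rw [add_apply, hT, hS, add_apply, star_add]

lemma IsConj.sub {S S' T T' : V →L[ℂ] W} (hS : IsConj S S') (hT : IsConj T T') :
    IsConj (S - T) (S' - T') := fun x => by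
  rw [sub_apply, hT, hS, sub_apply, star_sub]

lemma IsConj.smul {T T' : V →L[ℂ] W} (hT : IsConj T T') (c : ℂ) :
    IsConj (c • T) (star c • T') := fun x => by
  rw [smul_apply, hT, smul_apply, star_smul]

lemma isConj_one : IsConj (1 : V →L[ℂ] V) 1 := fun x => by simp

lemma isConj_sum {κ : Type*} (s : Finset κ) {f f' : κ → V →L[ℂ] W}
    (h : ∀ i ∈ s, IsConj (f i) (f' i)) : IsConj (∑ i ∈ s, f i) (∑ i ∈ s, f' i) := fun x => by
  rw [sum_apply, sum_apply, star_sum]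
  exact Finset.sum_congr rfl fun i hi => h i hi x

variable [CompleteSpace V]

lemma isConj_ins (i : ι) : IsConj (ins i : V →L[ℂ] L2 ι V) (ins i) := fun x => by
  classical
  ext j
  rw [lp.star_apply, ins_apply, ins_apply]
  split_ifs <;> simp

lemma isConj_prj (i : ι) : IsConj (prj i : L2 ι V →L[ℂ] V) (prj i) := fun _ => rfl

lemma isConj_res {Q : V →L[ℂ] V} (hQ : IsSelfAdjoint Q) (hc : IsConj Q Q) {r : ℝ} (hr : 0 ≤ r) :
    IsConj (res Q r) (res Q r) := fun y => by
  have h1 := congrArg (fun T : V →L[ℂ] V => T y) (mul_res_cancel hQ hr)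
  have h2 : ∀ x, res Q r ((1 + (r : ℂ) • (Q * Q)) x) = x := fun x =>
    congrArg (fun T : V →L[ℂ] V => T x) (res_mul_cancel hQ hr)
  have h3 : IsConj (1 + (r : ℂ) • (Q * Q)) (1 + (r : ℂ) • (Q * Q)) := by
    have := (isConj_one (V := V)).add ((hc.comp hc).smul (r : ℂ))
    rwa [Complex.star_def, Complex.conj_ofReal] at this
  rw [← h2 (star (res Q r y)), h3]
  congr 1
  exact congrArg star h1.symm

lemma isConj_damp {Q : V →L[ℂ] V} (hQ : IsSelfAdjoint Q) (hc : IsConj Q Q) {r : ℝ} (hr : 0 ≤ r) :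
    IsConj (damp Q r) (damp Q r) :=
  hc.comp (isConj_res hQ hc hr)

lemma isConj_dampSq {γ : V →ₗᵢ[ℂ] V} (hγ : IsConj γ.toContinuousLinearMap γ.toContinuousLinearMap)
    {Q : V →L[ℂ] V} (hQ : IsSelfAdjoint Q) (hc : IsConj Q Q) {r : ℝ} (hr : 0 ≤ r) :
    IsConj (dampSq γ Q r) (dampSq γ Q r) :=
  (hγ.comp hc).comp (isConj_damp hQ hc hr)

lemma isConj_diagOp {A : ι → V →ₗᵢ[ℂ] V}
    (hA : ∀ i, IsConj (A i).toContinuousLinearMap (A i).toContinuousLinearMap) :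
    IsConj (diagOp A).toContinuousLinearMap (diagOp A).toContinuousLinearMap := fun x => by
  ext i
  exact hA i (x i)

lemma isConj_signed {A : V →ₗᵢ[ℂ] V}
    (hA : IsConj A.toContinuousLinearMap A.toContinuousLinearMap) (k : ℕ) :
    IsConj (signed k A).toContinuousLinearMap (signed k A).toContinuousLinearMap := by
  rw [signed_toContinuousLinearMap]
  have := hA.smul ((-1) ^ k)
  simpa using this

variable [NormedStarGroup W] [CompleteSpace W] {κ : Type} [Fintype κ] [DecidableEq κ]

lemma isConj_tens {u : κ → V →L[ℂ] W} (hu : ∀ i, IsConj (u i) (u i))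
    (hu' : ∀ i, IsConj (u i).adjoint (u i).adjoint) {M M' : Matrix κ κ ℂ}
    (hM : ∀ i j, M' i j = star (M i j)) {X : V →L[ℂ] V} (hX : IsConj X X) :
    IsConj (tens u M X) (tens u M' X) := by
  refine isConj_sum _ fun i _ => isConj_sum _ fun j _ => ?_
  rw [hM]
  exact ((hu i).comp (hX.comp (hu' j))).smul (M i j)

lemma isConj_extK {u : κ → V →L[ℂ] W} (hu : ∀ i, IsConj (u i) (u i))
    (hu' : ∀ i, IsConj (u i).adjoint (u i).adjoint) {k k' : Matrix κ κ ℂ}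
    (hk : ∀ i j, k' i j = star (k i j)) {γ : V →ₗᵢ[ℂ] V}
    (hγ : IsConj γ.toContinuousLinearMap γ.toContinuousLinearMap)
    {Q : V →L[ℂ] V} (hQ : IsSelfAdjoint Q) (hc : IsConj Q Q) {r : ℝ} (hr : 0 ≤ r) :
    IsConj (extK u γ Q k r) (extK u γ Q k' r) := by
  refine (isConj_tens hu hu' (fun i j => ?_) (isConj_damp hQ hc hr)).add
    (isConj_tens hu hu' hk (isConj_dampSq hγ hQ hc hr))
  rw [Matrix.one_apply]
  split_ifs <;> simp

end Conj

lemma isConj_gradK : IsConj gradK.toContinuousLinearMap gradK.toContinuousLinearMap :=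
  isConj_diagOp fun _ => isConj_signed (fun _ => rfl) _

end HilbertSum

/-! ### The frame of `HK ⊗ Λ^•ℂᴺ` in `HK ⊗ Λ^•ℂ^∞ ⊗ Λ^•ℂᴺ` defined by an isometry -/

section Frame

variable {N : ℕ}

/-- The inclusion of the summand of `HK ⊗ Λ^•ℂ^∞ ⊗ Λ^•ℂᴺ` of a pair of basis vectors. -/
def insN (a : Finset (Fin N) × Finset (Fin N)) : HK →L[ℂ] HN N :=
  ins a.2 ∘L ins (a.1.map Fin.valEmbedding)

lemma insN_adjoint (a : Finset (Fin N) × Finset (Fin N)) :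
    (insN a).adjoint = prj (a.1.map Fin.valEmbedding) ∘L prj a.2 := by
  rw [insN, ContinuousLinearMap.adjoint_comp, ins_adjoint, ins_adjoint]

lemma isFrame_insN : IsFrame (insN (N := N)) := by
  classical
  intro a b
  rw [insN_adjoint]
  have : (prj (a.1.map Fin.valEmbedding) ∘L prj a.2) ∘L insN b =
      prj (a.1.map Fin.valEmbedding) ∘L ((prj a.2 ∘L ins b.2) ∘L
        ins (b.1.map Fin.valEmbedding) : HK →L[ℂ] HU) := rfl
  rw [this, prj_comp_ins]
  by_cases h2 : a.2 = b.2
  · rw [if_pos h2, show (1 : HU →L[ℂ] HU) ∘L (ins (b.1.map Fin.valEmbedding) : HK →L[ℂ] HU) =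
      ins (b.1.map Fin.valEmbedding) from rfl, prj_comp_ins]
    simp [Prod.ext_iff, h2]
  · rw [if_neg h2, ContinuousLinearMap.zero_comp, ContinuousLinearMap.comp_zero, if_neg]
    exact fun h => h2 (congrArg Prod.snd h)

lemma gradN_comp_insN (a : Finset (Fin N) × Finset (Fin N)) :
    (gradN N).toContinuousLinearMap ∘L insN a =
      ((-1 : ℂ) ^ a.1.card * (-1) ^ a.2.card) • (insN a ∘L gradK.toContinuousLinearMap) := by
  have h1 : (gradN N).toContinuousLinearMap ∘L insN a =
      ((gradN N).toContinuousLinearMap ∘L ins a.2) ∘L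
        (ins (a.1.map Fin.valEmbedding) : HK →L[ℂ] HU) := rfl
  have h2 : (ins a.2 : HU →L[ℂ] HN N) ∘L gradU.toContinuousLinearMap ∘L
      (ins (a.1.map Fin.valEmbedding) : HK →L[ℂ] HU) =
      ins a.2 ∘L (gradU.toContinuousLinearMap ∘L ins (a.1.map Fin.valEmbedding)) := rfl
  rw [h1, gradN, diagOp_comp_ins, signed_toContinuousLinearMap, ContinuousLinearMap.comp_smul,
    ContinuousLinearMap.smul_comp, ContinuousLinearMap.comp_assoc, h2, gradU, diagOp_comp_ins,
    signed_toContinuousLinearMap, ContinuousLinearMap.comp_smul, ContinuousLinearMap.comp_smul,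
    smul_smul, Finset.card_map, mul_comm]
  rfl

/-- The frame with `e_S ⊗ x ↦ ∑ M_{aS} e_a ⊗ x`. -/
def frameU (M : Matrix (Finset (Fin N) × Finset (Fin N)) (Finset (Fin N)) ℂ)
    (S : Finset (Fin N)) : HK →L[ℂ] HN N :=
  ∑ a, M a S • insN a

lemma frameU_adjoint (M : Matrix (Finset (Fin N) × Finset (Fin N)) (Finset (Fin N)) ℂ)
    (S : Finset (Fin N)) : (frameU M S).adjoint = ∑ a, star (M a S) • (insN a).adjoint := by
  simp [frameU, map_sum, LinearIsometryEquiv.map_smulₛₗ]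

lemma isFrame_frameU {M : Matrix (Finset (Fin N) × Finset (Fin N)) (Finset (Fin N)) ℂ}
    (hM : M.conjTranspose * M = 1) : IsFrame (frameU M) := by
  intro S T
  have h : ∀ a b, (star (M a S) • (insN a).adjoint) ∘L (M b T • insN b) =
      if a = b then (star (M a S) * M b T) • (1 : HK →L[ℂ] HK) else 0 := by
    intro a b
    rw [ContinuousLinearMap.smul_comp, ContinuousLinearMap.comp_smul, smul_smul,
      isFrame_insN a b]
    split_ifs <;> simp
  have h2 : (frameU M S).adjoint ∘L frameU M T = ∑ a, ∑ b,
      (star (M a S) • (insN a).adjoint) ∘L (M b T • insN b) := by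
    rw [frameU_adjoint, frameU]
    ext1 x
    simp only [ContinuousLinearMap.comp_apply, sum_apply, map_sum]
    exact Finset.sum_comm
  rw [h2]
  simp only [h, Finset.sum_ite_eq, Finset.mem_univ, if_true, ← Finset.sum_smul]
  have h3 := congrFun (congrFun hM S) T
  simp only [Matrix.mul_apply, Matrix.conjTranspose_apply] at h3
  rw [h3, Matrix.one_apply]
  split_ifs <;> simp

lemma gradN_comp_frameU {M : Matrix (Finset (Fin N) × Finset (Fin N)) (Finset (Fin N)) ℂ}
    (hM : (gradExt N ⊗ₖ gradExt N) * M = M * gradExt N) (S : Finset (Fin N)) :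
    (gradN N).toContinuousLinearMap ∘L frameU M S =
      (-1 : ℂ) ^ S.card • (frameU M S ∘L gradK.toContinuousLinearMap) := by
  have h : ∀ a, (-1 : ℂ) ^ a.1.card * (-1) ^ a.2.card * M a S = (-1) ^ S.card * M a S := by
    intro a
    have := congrFun (congrFun hM a) S
    rw [gradExt, Matrix.diagonal_kronecker_diagonal, Matrix.diagonal_mul, Matrix.mul_diagonal]
      at this
    rw [this, mul_comm]
  have h1 : (gradN N).toContinuousLinearMap ∘L frameU M S =
      ∑ a, M a S • ((gradN N).toContinuousLinearMap ∘L insN a) := by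
    ext1 x
    simp only [frameU, ContinuousLinearMap.comp_apply, sum_apply, map_sum,
      smul_apply, map_smul]
  have h2 : frameU M S ∘L gradK.toContinuousLinearMap =
      ∑ a, M a S • (insN a ∘L gradK.toContinuousLinearMap) := by
    ext1 x
    simp only [frameU, ContinuousLinearMap.comp_apply, sum_apply,
      smul_apply]
  rw [h1, h2, Finset.smul_sum]
  refine Finset.sum_congr rfl fun a _ => ?_
  rw [gradN_comp_insN, smul_smul, smul_smul, ← h a, mul_comm]

lemma isConj_insN (a : Finset (Fin N) × Finset (Fin N)) : IsConj (insN a) (insN a) :=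
  (isConj_ins _).comp (isConj_ins _)

lemma isConj_insN_adjoint (a : Finset (Fin N) × Finset (Fin N)) :
    IsConj (insN a).adjoint (insN a).adjoint := by
  rw [insN_adjoint]
  exact (isConj_prj _).comp (isConj_prj _)

lemma isConj_frameU {M : Matrix (Finset (Fin N) × Finset (Fin N)) (Finset (Fin N)) ℂ}
    (hM : ∀ a S, star (M a S) = M a S) (S : Finset (Fin N)) :
    IsConj (frameU M S) (frameU M S) := by
  refine isConj_sum _ fun a _ => ?_
  have := (isConj_insN a).smul (M a S)
  rwa [hM] at this

lemma isConj_frameU_adjoint {M : Matrix (Finset (Fin N) × Finset (Fin N)) (Finset (Fin N)) ℂ}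
    (hM : ∀ a S, star (M a S) = M a S) (S : Finset (Fin N)) :
    IsConj (frameU M S).adjoint (frameU M S).adjoint := by
  rw [frameU_adjoint]
  refine isConj_sum _ fun a _ => ?_
  rw [hM]
  have := (isConj_insN_adjoint a).smul (M a S)
  rwa [hM] at this

lemma tens_frameU (M : Matrix (Finset (Fin N) × Finset (Fin N)) (Finset (Fin N)) ℂ)
    (A : Matrix (Finset (Fin N)) (Finset (Fin N)) ℂ) (X : HK →L[ℂ] HK) :
    tens (frameU M) A X = tens insN (M * A * M.conjTranspose) X := by
  have h : ∀ S T, frameU M S ∘L X ∘L (frameU M T).adjoint =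
      ∑ a, ∑ b, (M a S * star (M b T)) • (insN a ∘L X ∘L (insN b).adjoint) := by
    intro S T
    rw [frameU_adjoint, frameU]
    ext1 x
    simp only [ContinuousLinearMap.comp_apply, sum_apply, map_sum,
      smul_apply, map_smul, mul_smul, Finset.smul_sum]
    rw [Finset.sum_comm]
    simp only [smul_comm (star _)]
  simp only [tens, h, Matrix.mul_apply, Matrix.conjTranspose_apply, Finset.smul_sum,
    Finset.sum_smul, Finset.sum_mul, smul_smul]
  calc _ = ∑ S, ∑ a, ∑ T, ∑ b, (A S T * (M a S * star (M b T))) •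
        (insN a ∘L X ∘L (insN b).adjoint) :=
        Finset.sum_congr rfl fun S _ => Finset.sum_comm
    _ = ∑ a, ∑ S, ∑ T, ∑ b, (A S T * (M a S * star (M b T))) •
        (insN a ∘L X ∘L (insN b).adjoint) := Finset.sum_comm
    _ = ∑ a, ∑ S, ∑ b, ∑ T, (A S T * (M a S * star (M b T))) •
        (insN a ∘L X ∘L (insN b).adjoint) :=
        Finset.sum_congr rfl fun a _ => Finset.sum_congr rfl fun S _ => Finset.sum_comm
    _ = ∑ a, ∑ b, ∑ S, ∑ T, (A S T * (M a S * star (M b T))) •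
        (insN a ∘L X ∘L (insN b).adjoint) :=
        Finset.sum_congr rfl fun a _ => Finset.sum_comm
    _ = _ := by
        refine Finset.sum_congr rfl fun a _ => Finset.sum_congr rfl fun b _ => ?_
        rw [Finset.sum_comm]
        exact Finset.sum_congr rfl fun S _ => Finset.sum_congr rfl fun T _ => by
          congr 1; ring

lemma incE_comp_ins (S : Finset (Fin N)) : incE N ∘L ins S = ins (castS S) := by
  classical
  ext1 x
  simp only [incE, ContinuousLinearMap.comp_apply, sum_apply, prj_apply,
    ins_apply]
  rw [Finset.sum_eq_single S]
  · rw [if_pos rfl]; rfl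
  · intro T _ hT
    rw [if_neg hT, map_zero]
  · simp

lemma incO_comp_ins (S : Finset (Fin N)) : incO N ∘L ins S = ins (lastS S) := by
  classical
  ext1 x
  simp only [incO, ContinuousLinearMap.comp_apply, sum_apply, prj_apply,
    ins_apply]
  rw [Finset.sum_eq_single S]
  · rw [if_pos rfl]; rfl
  · intro T _ hT
    rw [if_neg hT, map_zero]
  · simp

lemma incE_comp_insN (a : Finset (Fin N) × Finset (Fin N)) :
    incE N ∘L insN a = insN (castS a.1, castS a.2) := by
  rw [insN, insN, ← ContinuousLinearMap.comp_assoc, incE_comp_ins, map_val_castS]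

lemma incO_comp_insN (a : Finset (Fin N) × Finset (Fin N)) :
    incO N ∘L insN a = insN (castS a.1, lastS a.2) := by
  rw [insN, insN, ← ContinuousLinearMap.comp_assoc, incO_comp_ins, map_val_castS]

lemma comp_frameU (T : HN N →L[ℂ] HN (N + 1)) (M) (S : Finset (Fin N)) :
    T ∘L frameU M S = ∑ a, M a S • (T ∘L insN a) := by
  ext1 x
  simp only [frameU, ContinuousLinearMap.comp_apply, sum_apply, map_sum,
    smul_apply, map_smul]

/-- The frame over `ℂᴺ⁺¹` extends that over `ℂᴺ`, on `Λ^•ℂᴺ` (with `σ = castS`) and on `Λ^•ℂᴺ ∧ e_N`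
(with `σ = lastS`). -/
lemma rotFrame_stab {p : Matrix (Fin N) (Fin N) ℝ} {p' : Matrix (Fin (N + 1)) (Fin (N + 1)) ℝ}
    (hp : IsExtend p p') (s : ℝ) {X : Matrix (Finset (Fin (N + 1))) (Finset (Fin N)) ℂ}
    (hX : X = incM N ∨ X = lasM N) {σ : Finset (Fin N) → Finset (Fin (N + 1))}
    (hσ : ∀ b S, X b S = if b = σ S then 1 else 0) (S : Finset (Fin N)) :
    frameU (rotFrame p' s) (σ S) =
      ∑ a, rotFrame p s a S • insN (castS a.1, σ a.2) := by
  have h := rot_mul_incM_kronecker hp hX s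
  have h1 : ∀ b, rotFrame p' s b (σ S) =
      ∑ a, (if b = (castS a.1, σ a.2) then 1 else 0) * rotFrame p s a S := by
    intro b
    have := congrFun (congrFun h b) (∅, S)
    simp only [Matrix.mul_apply, Matrix.kroneckerMap_apply, incM, hσ, castS_empty] at this
    rw [Finset.sum_eq_single (∅, σ S)] at this
    · rw [if_pos rfl, if_pos rfl, mul_one, mul_one] at this
      refine this.trans (Finset.sum_congr rfl fun a _ => ?_)
      simp only [rotFrame, Prod.ext_iff, ite_and]
      split_ifs <;> simp
    · rintro ⟨c, d⟩ - hcd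
      simp only [ne_eq, Prod.mk.injEq, not_and] at hcd
      by_cases hc : c = ∅
      · rw [if_neg (show ¬ (c, d).2 = σ S from hcd hc), mul_zero, mul_zero]
      · rw [if_neg (show ¬ (c, d).1 = ∅ from hc), zero_mul, mul_zero]
    · simp
  rw [frameU]
  simp only [h1, Finset.sum_smul]
  rw [Finset.sum_comm]
  refine Finset.sum_congr rfl fun a _ => ?_
  simp

lemma incE_comp_frameU {p : Matrix (Fin N) (Fin N) ℝ}
    {p' : Matrix (Fin (N + 1)) (Fin (N + 1)) ℝ} (hp : IsExtend p p') (s : ℝ)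
    (S : Finset (Fin N)) :
    incE N ∘L frameU (rotFrame p s) S = frameU (rotFrame p' s) (castS S) := by
  rw [rotFrame_stab hp s (Or.inl rfl) (fun _ _ => rfl), comp_frameU]
  simp only [incE_comp_insN]

lemma incO_comp_frameU {p : Matrix (Fin N) (Fin N) ℝ}
    {p' : Matrix (Fin (N + 1)) (Fin (N + 1)) ℝ} (hp : IsExtend p p') (s : ℝ)
    (S : Finset (Fin N)) :
    incO N ∘L frameU (rotFrame p s) S = frameU (rotFrame p' s) (lastS S) := by
  rw [rotFrame_stab hp s (Or.inr rfl) (fun _ _ => rfl), comp_frameU]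
  simp only [incO_comp_insN]

/-- The external product with the Bott class of the last coordinate of `ℂᴺ⁺¹` turns the external
product with a Koszul complex on `ℂᴺ` into that with a Koszul complex on `ℂᴺ⁺¹`. -/
lemma bottMul_extK {u : Finset (Fin N) → HK →L[ℂ] HN N}
    {u' : Finset (Fin (N + 1)) → HK →L[ℂ] HN (N + 1)} (hu : IsFrame u)
    (hE : ∀ S, incE N ∘L u S = u' (castS S)) (hO : ∀ S, incO N ∘L u S = u' (lastS S))
    (hΓ : ∀ S, (gradN N).toContinuousLinearMap ∘L u S =
      (-1 : ℂ) ^ S.card • (u S ∘L gradK.toContinuousLinearMap))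
    {Q : HK →L[ℂ] HK} (hQ : Q ∈ KSpace gradK) {v : Fin (N + 1) → ℂ} {r : ℝ} (hr : 0 ≤ r)
    (hv : ∑ k : Fin N, v k.castSucc * star (v k.castSucc) = (r : ℂ)) :
    bottMul (extK u gradK Q (kosz fun i => v i.castSucc) r) (v (Fin.last N)) =
      extK u' gradK Q (kosz v) (r + ‖v (Fin.last N)‖ ^ 2) := by
  have hk : (kosz fun i => v i.castSucc) * (kosz fun i => v i.castSucc) =
      (r : ℂ) • 1 - (2 : ℂ) • (kosz fun i => v i.castSucc) := by rw [kosz_mul_self, hv]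
  have hk' := kosz_conjTranspose fun i : Fin N => v i.castSucc
  have ht : 0 ≤ ‖v (Fin.last N)‖ ^ 2 := by positivity
  have hg : (Matrix.diagonal fun S : Finset (Fin N) => (-1 : ℂ) ^ S.card) = gradExt N := rfl
  have hb : ∀ (A B C D : Matrix (Finset (Fin N)) (Finset (Fin N)) ℂ) (X : HK →L[ℂ] HK),
      tens u' (blocks A B C D) X =
        incE N ∘L tens u A X ∘L (incE N).adjoint + incE N ∘L tens u B X ∘L (incO N).adjoint +
        (incO N ∘L tens u C X ∘L (incE N).adjoint +
          incO N ∘L tens u D X ∘L (incO N).adjoint) := by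
    have h1 : ∀ (S T : HN N →L[ℂ] HN (N + 1)) (A : Matrix (Finset (Fin N)) (Finset (Fin N)) ℂ)
        (X : HK →L[ℂ] HK), S ∘L tens u A X ∘L T.adjoint =
        ∑ i, ∑ j, A i j • ((S ∘L u i) ∘L X ∘L (T ∘L u j).adjoint) := by
      intro S T A X
      ext1 x
      simp only [tens, ContinuousLinearMap.comp_apply, sum_apply, map_sum,
        smul_apply, map_smul, ContinuousLinearMap.adjoint_comp]
    intro A B C D X
    simp only [h1, hE, hO]
    rw [tens, sum_splitS]
    simp only [sum_splitS, blocks_cc, blocks_cl, blocks_lc, blocks_ll, Finset.sum_add_distrib]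
  have hD : damp (extK u gradK Q (kosz fun i => v i.castSucc) r) (‖v (Fin.last N)‖ ^ 2) =
      extK u gradK Q (kosz fun i => v i.castSucc) (r + ‖v (Fin.last N)‖ ^ 2) :=
    damp_extK hu isGrading_gradK hQ hr hk hk' ht
  have hDS : dampSq (gradN N) (extK u gradK Q (kosz fun i => v i.castSucc) r)
      (‖v (Fin.last N)‖ ^ 2) = tens u (gradExt N) (dampSq gradK Q (r + ‖v (Fin.last N)‖ ^ 2)) :=
    dampSq_extK hu isGrading_gradK hΓ hQ hr hk hk' ht
  simp only [bottMul, hD, hDS]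
  rw [extK, extK, kosz_succ, ← blocks_one, hb, hb]
  have hz : ∀ X : HK →L[ℂ] HK, tens u 0 X = 0 := fun X => by simp [tens]
  simp only [hz, tens_sub_left, tens_smul_left, ContinuousLinearMap.zero_comp,
    ContinuousLinearMap.comp_zero, ContinuousLinearMap.comp_add, ContinuousLinearMap.add_comp,
    ContinuousLinearMap.comp_sub, ContinuousLinearMap.sub_comp, ContinuousLinearMap.comp_smul,
    ContinuousLinearMap.smul_comp, starRingEnd_apply]
  abel

end Frame

/-! ### Projections onto spans of independent vectors -/

section SpanProjection

set_option linter.unusedSectionVars false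

variable {H : Type*} [NormedAddCommGroup H] [InnerProductSpace ℂ H] [CompleteSpace H] {n : ℕ}

/-- The map `z ↦ ∑ zᵢ yᵢ`. -/
def combo (y : Fin n → H) : EuclideanSpace ℂ (Fin n) →L[ℂ] H :=
  ∑ i, (EuclideanSpace.proj i : EuclideanSpace ℂ (Fin n) →L[ℂ] ℂ).smulRight (y i)

/-- The formula `A (A^* A)⁻¹ A^*` for the orthogonal projection onto the span of independent
vectors `yᵢ`, with `A` the map `z ↦ ∑ zᵢ yᵢ`. -/
def spanProj (y : Fin n → H) : H →L[ℂ] H :=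
  combo y ∘L Ring.inverse ((combo y).adjoint ∘L combo y) ∘L (combo y).adjoint

lemma combo_apply (y : Fin n → H) (z : EuclideanSpace ℂ (Fin n)) :
    combo y z = ∑ i, z i • y i := by
  simp [combo]

/-- The Gram matrix of independent vectors is invertible. -/
lemma isUnit_gram {y : Fin n → H} (hy : LinearIndependent ℂ y) :
    IsUnit ((combo y).adjoint ∘L combo y) := by
  rw [ContinuousLinearMap.isUnit_iff_bijective]
  have hi : Function.Injective ((combo y).adjoint ∘L combo y) := by
    rw [injective_iff_map_eq_zero]
    intro z hz
    have h1 : combo y z = 0 := by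
      rw [← inner_self_eq_zero (𝕜 := ℂ), ← ContinuousLinearMap.adjoint_inner_right]
      change inner ℂ z (((combo y).adjoint ∘L combo y) z) = 0
      rw [hz, inner_zero_right]
    rw [combo_apply] at h1
    ext i
    exact Fintype.linearIndependent_iff.1 hy _ h1 i
  exact ⟨hi, (LinearMap.injective_iff_surjective
    (f := ((combo y).adjoint ∘L combo y).toLinearMap)).1 hi⟩

lemma spanProj_eq {y : Fin n → H} (hy : LinearIndependent ℂ y) {K : Submodule ℂ H}
    (hK : K = Submodule.span ℂ (Set.range y)) :
    K.topologicalClosure.starProjection = spanProj y := by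
  have : FiniteDimensional ℂ K := by
    rw [hK]
    exact FiniteDimensional.span_of_finite ℂ (Set.finite_range y)
  have hc : K.topologicalClosure = K :=
    (Submodule.closed_of_finiteDimensional K).submodule_topologicalClosure_eq
  ext v
  refine Submodule.eq_starProjection_of_mem_of_inner_eq_zero ?_ ?_
  · rw [hc, hK]
    change combo y _ ∈ _
    rw [combo_apply]
    exact Submodule.sum_mem _ fun i _ => Submodule.smul_mem _ _ (Submodule.subset_span ⟨i, rfl⟩)
  · intro w hw
    rw [hc, hK] at hw
    obtain ⟨c, rfl⟩ := (Submodule.mem_span_range_iff_exists_fun ℂ).1 hw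
    have h1 : ∑ i, c i • y i = combo y (WithLp.toLp 2 c) := by rw [combo_apply]
    have h2 : ((combo y).adjoint ∘L combo y) (Ring.inverse ((combo y).adjoint ∘L combo y)
        ((combo y).adjoint v)) = (combo y).adjoint v :=
      congrArg (fun T : EuclideanSpace ℂ (Fin n) →L[ℂ] _ => T ((combo y).adjoint v))
        (Ring.mul_inverse_cancel _ (isUnit_gram hy))
    rw [h1, ← ContinuousLinearMap.adjoint_inner_left, map_sub]
    change inner ℂ (_ - ((combo y).adjoint ∘L combo y) (Ring.inverse
      ((combo y).adjoint ∘L combo y) ((combo y).adjoint v))) _ = 0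
    rw [h2, sub_self, inner_zero_left]

lemma continuousAt_spanProj {y : Fin n → H} (hy : LinearIndependent ℂ y) :
    ContinuousAt (spanProj : (Fin n → H) → H →L[ℂ] H) y := by
  have hA : Continuous (combo : (Fin n → H) → EuclideanSpace ℂ (Fin n) →L[ℂ] H) := by
    refine continuous_finsetSum _ fun i _ => ?_
    exact ((ContinuousLinearMap.smulRightL ℂ (EuclideanSpace ℂ (Fin n)) H
      (EuclideanSpace.proj i)).continuous).comp (continuous_apply i)
  have hA' : Continuous fun y : Fin n → H => (combo y).adjoint :=
    (ContinuousLinearMap.adjoint (𝕜 := ℂ) (E := EuclideanSpace ℂ (Fin n))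
      (F := H)).continuous.comp hA
  have hG : Continuous fun y : Fin n → H => (combo y).adjoint ∘L combo y := hA'.clm_comp hA
  obtain ⟨u, hu⟩ := isUnit_gram hy
  have hI : ContinuousAt Ring.inverse ((combo y).adjoint ∘L combo y) := by
    rw [← hu]
    exact NormedRing.inverse_continuousAt u
  have hI' : ContinuousAt (fun y : Fin n → H => Ring.inverse ((combo y).adjoint ∘L combo y)) y :=
    ContinuousAt.comp (f := fun y : Fin n → H => (combo y).adjoint ∘L combo y) hI hG.continuousAt
  exact hA.continuousAt.clm_comp (hI'.clm_comp hA'.continuousAt)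

lemma isCompactOperator_spanProj (y : Fin n → H) : IsCompactOperator (spanProj y) := by
  have h := isCompactOperator_of_locallyCompactSpace_rng (combo y)
  exact h.comp_clm _

end SpanProjection

/-! ### The class of a difference of vector spaces -/

/-- The complexification `HR → HC`. -/
def toC (y : HR) : HC := ⟨fun k => ((y k : ℝ) : ℂ), by
  refine (memℓp_gen_iff (by norm_num)).2 ?_
  have h := (memℓp_gen_iff (by norm_num)).1 (lp.memℓp y)
  simpa using h⟩

lemma toC_apply (y : HR) (k : ℕ) : toC y k = ((y k : ℝ) : ℂ) := rfl

lemma isometry_toC : Isometry toC := by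
  refine Isometry.of_dist_eq fun x y => ?_
  rw [dist_eq_norm, dist_eq_norm, lp.norm_eq_tsum_rpow (by norm_num),
    lp.norm_eq_tsum_rpow (by norm_num)]
  congr 1
  refine tsum_congr fun k => ?_
  rw [lp.coeFn_sub, lp.coeFn_sub, Pi.sub_apply, Pi.sub_apply, toC_apply, toC_apply,
    ← Complex.ofReal_sub, Complex.norm_real]

lemma lp_sum_apply {ι : Type*} {V : Type*} [NormedAddCommGroup V] {n : ℕ}
    (f : Fin n → lp (fun _ : ι => V) 2) (k : ι) :
    (∑ i, f i : lp (fun _ : ι => V) 2) k = ∑ i, f i k := by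
  rw [lp.coeFn_sum, Finset.sum_apply]

lemma linearIndependent_toC {n : ℕ} {y : Fin n → HR} (hy : LinearIndependent ℝ y) :
    LinearIndependent ℂ fun i => toC (y i) := by
  rw [Fintype.linearIndependent_iff] at hy ⊢
  intro z hz
  have h : ∀ k, ∑ i, z i * ((y i k : ℝ) : ℂ) = 0 := by
    intro k
    have := congrArg (fun x : HC => x k) hz
    rw [lp_sum_apply] at this
    exact this
  have hre : ∑ i, (z i).re • y i = 0 := by
    ext k
    have := congrArg Complex.re (h k)
    rw [lp_sum_apply]
    simpa using this
  have him : ∑ i, (z i).im • y i = 0 := by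
    ext k
    have := congrArg Complex.im (h k)
    rw [lp_sum_apply]
    simpa using this
  intro i
  exact Complex.ext (hy _ hre i) (hy _ him i)

lemma span_toC {n : ℕ} (y : Fin n → HR) {W : Submodule ℝ HR}
    (hW : W = Submodule.span ℝ (Set.range y)) :
    Submodule.span ℂ {x : HC | ∃ y ∈ W, ∀ k, x k = ((y k : ℝ) : ℂ)} =
      Submodule.span ℂ (Set.range fun i => toC (y i)) := by
  apply le_antisymm
  · rw [Submodule.span_le]
    rintro x ⟨w, hw, hx⟩
    rw [hW] at hw
    obtain ⟨c, rfl⟩ := (Submodule.mem_span_range_iff_exists_fun ℝ).1 hw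
    have : x = ∑ i, (c i : ℂ) • toC (y i) := by
      ext k
      rw [hx k, lp_sum_apply, lp_sum_apply, Complex.ofReal_sum]
      refine Finset.sum_congr rfl fun i _ => ?_
      exact Complex.ofReal_mul _ _
    rw [this]
    exact Submodule.sum_mem _ fun i _ => Submodule.smul_mem _ _ (Submodule.subset_span ⟨i, rfl⟩)
  · refine Submodule.span_mono ?_
    rintro _ ⟨i, rfl⟩
    exact ⟨y i, by rw [hW]; exact Submodule.subset_span ⟨i, rfl⟩, fun k => rfl⟩

lemma projC_eq_spanProj {n : ℕ} {y : Fin n → HR} (hy : LinearIndependent ℝ y)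
    {W : Submodule ℝ HR} (hW : W = Submodule.span ℝ (Set.range y)) :
    projC W = spanProj fun i => toC (y i) :=
  spanProj_eq (linearIndependent_toC hy) (span_toC y hW)

lemma isCompactOperator_projC (W : Submodule ℝ HR) [FiniteDimensional ℝ W] :
    IsCompactOperator (projC W) := by
  let b := Module.finBasis ℝ W
  have hy : LinearIndependent ℝ fun i => (b i : HR) :=
    b.linearIndependent.map' W.subtype W.ker_subtype
  have hW : W = Submodule.span ℝ (Set.range fun i => (b i : HR)) := by
    have := congrArg (Submodule.map W.subtype) b.span_eq
    rw [Submodule.map_span, ← Set.range_comp, Submodule.map_top, Submodule.range_subtype] at this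
    exact this.symm
  rw [projC_eq_spanProj hy hW]
  exact isCompactOperator_spanProj _

lemma projC_mul_self (W : Submodule ℝ HR) : projC W * projC W = projC W :=
  Submodule.isIdempotentElem_starProjection _

lemma isSelfAdjoint_projC (W : Submodule ℝ HR) : IsSelfAdjoint (projC W) :=
  isSelfAdjoint_starProjection _

lemma inner_star_star (x y : HC) : inner ℂ (star x) (star y) = star (inner ℂ x y : ℂ) := by
  have h1 := lp.hasSum_inner (𝕜 := ℂ) (star x) (star y)
  have h2 := (lp.hasSum_inner (𝕜 := ℂ) x y).star
  refine h1.unique (h2.congr_fun ?_)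
  intro k
  simp

lemma isConj_projC (W : Submodule ℝ HR) : IsConj (projC W) (projC W) := by
  set K := Submodule.span ℂ {x : HC | ∃ y ∈ W, ∀ k, x k = ((y k : ℝ) : ℂ)} with hK
  have h1 : ∀ x ∈ K, star x ∈ K := by
    intro x hx
    induction hx using Submodule.span_induction with
    | mem x hx =>
      obtain ⟨y, hy, h⟩ := hx
      refine Submodule.subset_span ⟨y, hy, fun k => ?_⟩
      rw [lp.star_apply, h k, Complex.star_def, Complex.conj_ofReal]
    | zero => simp
    | add x y _ _ hx hy => rw [star_add]; exact K.add_mem hx hy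
    | smul c x _ hx => rw [star_smul]; exact K.smul_mem _ hx
  have h2 : ∀ x ∈ K.topologicalClosure, star x ∈ K.topologicalClosure := fun x hx =>
    map_mem_closure continuous_star hx h1
  intro v
  refine Submodule.eq_starProjection_of_mem_of_inner_eq_zero
    (h2 _ (K.topologicalClosure.starProjection_apply_mem v)) fun w hw => ?_
  change inner ℂ (star v - star (K.topologicalClosure.starProjection v)) w = 0
  rw [← star_star w, ← star_sub, inner_star_star,
    K.topologicalClosure.starProjection_inner_eq_zero v _ (h2 _ hw), star_zero]

/-- The embedding `x ↦ ((1 - p₀) x, p₀ x)` of `HC` in `HK`. -/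
def splitT (W₀ : Submodule ℝ HR) : HC →L[ℂ] HK :=
  ins false ∘L (1 - projC W₀) + ins true ∘L projC W₀

lemma diffClass_eq (W W₀ : Submodule ℝ HR) :
    diffClass W W₀ = splitT W₀ ∘L (projC W - projC W₀) ∘L (splitT W₀).adjoint := rfl

lemma splitT_adjoint (W₀ : Submodule ℝ HR) :
    (splitT W₀).adjoint = (1 - projC W₀) ∘L prj false + projC W₀ ∘L prj true := by
  have h : (projC W₀).adjoint = projC W₀ := (isSelfAdjoint_projC W₀).adjoint_eq
  have h' : (1 - projC W₀).adjoint = 1 - projC W₀ :=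
    ((IsSelfAdjoint.one _).sub (isSelfAdjoint_projC W₀)).adjoint_eq
  rw [splitT, map_add, ContinuousLinearMap.adjoint_comp, ContinuousLinearMap.adjoint_comp,
    ins_adjoint, ins_adjoint, h, h']

lemma splitT_adjoint_comp_self (W₀ : Submodule ℝ HR) :
    (splitT W₀).adjoint ∘L splitT W₀ = 1 := by
  have h := projC_mul_self W₀
  have e : ∀ b c : Bool, ∀ S T : HC →L[ℂ] HC, (S ∘L (prj b : HK →L[ℂ] HC)) ∘L (ins c ∘L T) =
      if b = c then S * T else 0 := by
    intro b c S T
    have : (S ∘L (prj b : HK →L[ℂ] HC)) ∘L (ins c ∘L T) =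
      S ∘L ((prj b : HK →L[ℂ] HC) ∘L ins c) ∘L T := rfl
    rw [this, prj_comp_ins]
    split_ifs
    · rfl
    · ext1 x; simp
  rw [splitT_adjoint, splitT, ContinuousLinearMap.add_comp, ContinuousLinearMap.comp_add,
    ContinuousLinearMap.comp_add, e, e, e, e]
  simp only [if_true, mul_sub, sub_mul, h, one_mul, mul_one]
  simp

lemma gradK_comp_splitT (W₀ : Submodule ℝ HR) :
    gradK.toContinuousLinearMap ∘L splitT W₀ = splitT W₀ ∘L (1 - (2 : ℂ) • projC W₀) := by
  have h := projC_mul_self W₀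
  have e : ∀ S T : HC →L[ℂ] HC, S ∘L T = S * T := fun _ _ => rfl
  have e1 : (LinearIsometry.id : HC →ₗᵢ[ℂ] HC).toContinuousLinearMap = 1 := rfl
  rw [splitT, ContinuousLinearMap.comp_add, ContinuousLinearMap.add_comp,
    ← ContinuousLinearMap.comp_assoc, ← ContinuousLinearMap.comp_assoc, gradK, diagOp_comp_ins,
    diagOp_comp_ins, signed_toContinuousLinearMap, signed_toContinuousLinearMap,
    ContinuousLinearMap.comp_assoc, ContinuousLinearMap.comp_assoc,
    ContinuousLinearMap.comp_assoc, ContinuousLinearMap.comp_assoc, e, e, e, e, e1]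
  congr 2
  · simp only [mul_sub, sub_mul, mul_smul_comm, h, one_mul, mul_one, Bool.false_eq_true,
      if_false, pow_zero, one_smul]
    module
  · simp only [mul_sub, mul_smul_comm, h, mul_one, if_true, pow_one, smul_mul_assoc, one_mul]
    module

lemma diffClass_mem_KSpace (W W₀ : Submodule ℝ HR) [FiniteDimensional ℝ W]
    [FiniteDimensional ℝ W₀] : diffClass W W₀ ∈ KSpace gradK := by
  rw [diffClass_eq]
  set T := splitT W₀
  set p := projC W
  set q := projC W₀
  have hp : p * p = p := projC_mul_self W
  have hq : q * q = q := projC_mul_self W₀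
  have hT := splitT_adjoint_comp_self W₀
  have hγ := gradK_comp_splitT W₀
  have hγ' : T.adjoint ∘L gradK.toContinuousLinearMap = (1 - (2 : ℂ) • q) ∘L T.adjoint := by
    have := congrArg ContinuousLinearMap.adjoint hγ
    rw [ContinuousLinearMap.adjoint_comp, ContinuousLinearMap.adjoint_comp,
      isGrading_gradK.selfAdjoint.adjoint_eq] at this
    rw [this]
    congr 1
    refine IsSelfAdjoint.adjoint_eq ((IsSelfAdjoint.one _).sub ?_)
    exact IsSelfAdjoint.smul (by simp) (isSelfAdjoint_projC W₀)
  refine ⟨?_, ?_, ?_⟩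
  · exact (((isCompactOperator_projC W).sub (isCompactOperator_projC W₀)).comp_clm
      T.adjoint).clm_comp T
  · have : (p - q).adjoint = p - q :=
      ((isSelfAdjoint_projC W).sub (isSelfAdjoint_projC W₀)).adjoint_eq
    rw [ContinuousLinearMap.isSelfAdjoint_iff', ContinuousLinearMap.adjoint_comp,
      ContinuousLinearMap.adjoint_comp, this, ContinuousLinearMap.adjoint_adjoint]
    rfl
  · have e1 : (T ∘L (p - q) ∘L T.adjoint) * (T ∘L (p - q) ∘L T.adjoint) =
        T ∘L ((p - q) * (p - q)) ∘L T.adjoint := by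
      have : (T ∘L (p - q) ∘L T.adjoint) * (T ∘L (p - q) ∘L T.adjoint) =
        T ∘L (p - q) ∘L (T.adjoint ∘L T) ∘L (p - q) ∘L T.adjoint := rfl
      rw [this, hT]
      rfl
    have e2 : (T ∘L (p - q) ∘L T.adjoint) * gradK.toContinuousLinearMap =
        T ∘L ((p - q) * (1 - (2 : ℂ) • q)) ∘L T.adjoint := by
      have : (T ∘L (p - q) ∘L T.adjoint) * gradK.toContinuousLinearMap =
        T ∘L (p - q) ∘L (T.adjoint ∘L gradK.toContinuousLinearMap) := rfl
      rw [this, hγ']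
      rfl
    have e3 : gradK.toContinuousLinearMap * (T ∘L (p - q) ∘L T.adjoint) =
        T ∘L ((1 - (2 : ℂ) • q) * (p - q)) ∘L T.adjoint := by
      have : gradK.toContinuousLinearMap * (T ∘L (p - q) ∘L T.adjoint) =
        (gradK.toContinuousLinearMap ∘L T) ∘L (p - q) ∘L T.adjoint := rfl
      rw [this, hγ]
      rfl
    rw [e1, e2, e3, ← ContinuousLinearMap.comp_add, ← ContinuousLinearMap.add_comp,
      ← ContinuousLinearMap.comp_smul, ← ContinuousLinearMap.smul_comp]
    congr 2
    simp only [mul_sub, sub_mul, mul_smul_comm, smul_mul_assoc, hp, hq, one_mul, mul_one]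
    module

lemma isConj_diffClass (W W₀ : Submodule ℝ HR) :
    IsConj (diffClass W W₀) (diffClass W W₀) := by
  have h1 : IsConj (1 - projC W₀) (1 - projC W₀) := isConj_one.sub (isConj_projC W₀)
  rw [diffClass_eq, splitT_adjoint, splitT]
  exact (((isConj_ins _).comp h1).add ((isConj_ins _).comp (isConj_projC _))).comp
    (((isConj_projC W).sub (isConj_projC W₀)).comp
      ((h1.comp (isConj_prj _)).add ((isConj_projC _).comp (isConj_prj _))))

lemma diffClass_self (W : Submodule ℝ HR) : diffClass W W = 0 := by
  rw [diffClass_eq, sub_self, ContinuousLinearMap.zero_comp, ContinuousLinearMap.comp_zero]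

/-! ### The embedded adjoint bundle -/

section AdjointBundle

variable {E : Type*} [NormedAddCommGroup E] [NormedSpace ℝ E]
  {G : Type*} [TopologicalSpace G] [ChartedSpace E G] [Group G]
  {P : Type*} [TopologicalSpace P] [MulAction G P]
  {φ : P → GroupLieAlgebra 𝓘(ℝ, E) G →L[ℝ] HR}

lemma adFibre_mk (hφ : IsAdjointEmbedding φ) (p : P) :
    adFibre φ (Quotient.mk _ p) = LinearMap.range (φ p).toLinearMap := by
  have h : ∀ (g : G) (p : P), LinearMap.range (φ p).toLinearMap ≤
      LinearMap.range (φ (g • p)).toLinearMap := by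
    rintro g p _ ⟨v, rfl⟩
    exact ⟨Ad g v, hφ.equivariant g p v⟩
  apply le_antisymm
  · refine iSup₂_le fun p' hp' => ?_
    obtain ⟨g, rfl⟩ := MulAction.orbitRel_apply.1 (Quotient.exact hp')
    have := h g⁻¹ (g • p)
    rwa [inv_smul_smul] at this
  · exact le_iSup₂_of_le p rfl le_rfl

variable [FiniteDimensional ℝ E]

lemma adFibre_finiteDimensional (hφ : IsAdjointEmbedding φ)
    (b : MulAction.orbitRel.Quotient G P) : FiniteDimensional ℝ (adFibre φ b) := by
  obtain ⟨p, rfl⟩ := Quotient.exists_rep b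
  rw [adFibre_mk hφ]
  have : FiniteDimensional ℝ (GroupLieAlgebra 𝓘(ℝ, E) G) :=
    inferInstanceAs (FiniteDimensional ℝ E)
  infer_instance

/-- Upstairs on `P` the fibre has the frame given by `φ p` on a basis of the Lie algebra, so that
the projection is continuous there; it descends to the quotient. -/
lemma continuous_projC_adFibre (hφ : IsAdjointEmbedding φ) :
    Continuous fun b : MulAction.orbitRel.Quotient G P => projC (adFibre φ b) := by
  have : FiniteDimensional ℝ (GroupLieAlgebra 𝓘(ℝ, E) G) :=
    inferInstanceAs (FiniteDimensional ℝ E)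
  let v := Module.finBasis ℝ (GroupLieAlgebra 𝓘(ℝ, E) G)
  have hy : ∀ p, LinearIndependent ℝ fun i => φ p (v i) := fun p =>
    v.linearIndependent.map' (φ p).toLinearMap (LinearMap.ker_eq_bot.2 (hφ.injective p))
  have hW : ∀ p, adFibre φ (Quotient.mk _ p) =
      Submodule.span ℝ (Set.range fun i => φ p (v i)) := by
    intro p
    rw [adFibre_mk hφ, LinearMap.range_eq_map, ← v.span_eq, Submodule.map_span, ← Set.range_comp]
    rfl
  have h : (fun b : MulAction.orbitRel.Quotient G P => projC (adFibre φ b)) ∘ Quot.mk _ =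
      fun p => spanProj fun i => toC (φ p (v i)) := by
    funext p
    exact projC_eq_spanProj (hy p) (hW p)
  have h2 : Continuous fun p => spanProj fun i => toC (φ p (v i)) := by
    rw [continuous_iff_continuousAt]
    intro p
    refine ContinuousAt.comp (f := fun p => fun i => toC (φ p (v i)))
      (continuousAt_spanProj (linearIndependent_toC (hy p))) ?_
    refine Continuous.continuousAt (continuous_pi fun i => isometry_toC.continuous.comp ?_)
    exact (continuous_eval_const (v i)).comp hφ.continuous
  rw [← h] at h2
  exact isQuotientMap_quot_mk.continuous_iff.2 h2

lemma continuous_diffClass_adFibre (hφ : IsAdjointEmbedding φ)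
    (W₀ : Submodule ℝ HR) :
    Continuous fun b : MulAction.orbitRel.Quotient G P => diffClass (adFibre φ b) W₀ := by
  simp only [diffClass_eq]
  exact continuous_const.clm_comp
    (((continuous_projC_adFibre hφ).sub continuous_const).clm_comp continuous_const)

end AdjointBundle

/-! ### Neighbourhoods of infinity -/

section Infinity

set_option linter.unusedSectionVars false

variable {Z Z' Y : Type*} [TopologicalSpace Z] [TopologicalSpace Z'] [TopologicalSpace Y]

/-- The points of the one-point compactification at which `ν` exceeds `R`, with `ν = ∞` at `∞`. -/
def far (ν : Z → ℝ) (R : ℝ) : Set (OnePoint Z) :=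
  {z | OnePoint.elim z True fun p => R < ν p}

@[simp] lemma some_mem_far {ν : Z → ℝ} {R : ℝ} {p : Z} : OnePoint.some p ∈ far ν R ↔ R < ν p :=
  Iff.rfl

lemma tendsto_infty_of_far {α : Type*} {l : Filter α} {h : α → OnePoint Z} {ν : Z → ℝ}
    (hν : Continuous ν) (hh : ∀ R, ∀ᶠ y in l, h y ∈ far ν R) :
    Filter.Tendsto h l (𝓝 OnePoint.infty) := by
  rw [OnePoint.hasBasis_nhds_infty.tendsto_right_iff]
  rintro s ⟨-, hs⟩
  obtain ⟨R, hR⟩ := (hs.image hν).bddAbove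
  filter_upwards [hh R] with y hy
  induction hz : h y using OnePoint.rec with
  | infty => exact Or.inr rfl
  | coe p =>
    rw [hz] at hy
    refine Or.inl ⟨p, fun hp => ?_, rfl⟩
    exact absurd (hR ⟨p, hp, rfl⟩) (not_le.2 (some_mem_far.1 hy))

lemma far_mem_nhds {ν : Z → ℝ} (hν : Continuous ν) (hc : ∀ R, IsCompact {z | ν z ≤ R}) (R : ℝ) :
    far ν R ∈ 𝓝 (OnePoint.infty : OnePoint Z) := by
  refine OnePoint.hasBasis_nhds_infty.mem_iff.2
    ⟨{z | ν z ≤ R}, ⟨isClosed_le hν continuous_const, hc R⟩, ?_⟩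
  rintro _ (⟨p, hp, rfl⟩ | rfl)
  · exact some_mem_far.2 (not_le.1 hp)
  · trivial

/-- A continuous map extends by `∞ ↦ ∞` if it does not decrease a function with compact sublevel
sets. -/
lemma continuous_onePoint_of_le {ν : Z → ℝ} {ν' : Z' → ℝ} (hν : Continuous ν)
    (hc : ∀ R, IsCompact {z | ν z ≤ R}) (hν' : Continuous ν') {g : Z → Z'} (hg : Continuous g)
    (hle : ∀ z, ν z ≤ ν' (g z)) :
    Continuous fun z : OnePoint Z => z.elim OnePoint.infty fun p => OnePoint.some (g p) := by
  rw [continuous_iff_continuousAt]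
  intro z
  induction z using OnePoint.rec with
  | infty =>
    refine tendsto_infty_of_far hν' fun R => ?_
    filter_upwards [far_mem_nhds hν hc R] with z hz
    induction z using OnePoint.rec with
    | infty => trivial
    | coe p => exact lt_of_lt_of_le (some_mem_far.1 hz) (hle p)
  | coe p =>
    rw [OnePoint.continuousAt_coe]
    exact (OnePoint.continuous_coe.comp hg).continuousAt

lemma continuousAt_coe_prod {X : Type*} [TopologicalSpace X] {h : OnePoint Z × Y → X} {p : Z}
    {y : Y} : ContinuousAt h (OnePoint.some p, y) ↔
      ContinuousAt (fun q : Z × Y => h (OnePoint.some q.1, q.2)) (p, y) :=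
  ((OnePoint.isOpenEmbedding_coe (X := Z)).prodMap
    (Topology.IsOpenEmbedding.id (X := Y))).continuousAt_iff (g := h) (x := (p, y)) |>.symm

end Infinity

/-! ### Grassmannians -/

section Grassmannian

variable {n N : ℕ}

lemma isClosed_orthonormal : IsClosed {f : Fin n → Eu N | Orthonormal ℝ f} := by
  have : {f : Fin n → Eu N | Orthonormal ℝ f} =
      ⋂ i, ⋂ j, {f | inner ℝ (f i) (f j) = if i = j then (1 : ℝ) else 0} := by
    ext f
    simp only [Set.mem_ofPred_eq, Set.mem_iInter, orthonormal_iff_ite]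
  rw [this]
  exact isClosed_iInter fun i => isClosed_iInter fun j =>
    isClosed_eq (by fun_prop) continuous_const

instance : CompactSpace (Frame n N) := by
  refine isCompact_iff_compactSpace.1 ?_
  refine Metric.isCompact_of_isClosed_isBounded isClosed_orthonormal ?_
  refine (Metric.isBounded_closedBall (x := (0 : Fin n → Eu N)) (r := 1)).subset fun f hf => ?_
  rw [mem_closedBall_zero_iff, pi_norm_le_iff_of_nonneg zero_le_one]
  exact fun i => (hf.1 i).le

instance : CompactSpace (Gr n N) := inferInstanceAs (CompactSpace (Quot (frameRel n N)))

lemma starProjection_span_frame (f : Frame n N) (v : Eu N) :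
    (Submodule.span ℝ (Set.range f.1)).starProjection v = ∑ i, inner ℝ (f.1 i) v • f.1 i := by
  refine Submodule.eq_starProjection_of_mem_orthogonal
    (K := Submodule.span ℝ (Set.range f.1)) ?_ ?_
  · exact Submodule.sum_mem _ fun i _ => Submodule.smul_mem _ _ (Submodule.subset_span ⟨i, rfl⟩)
  · rw [mem_span_orth]
    intro i
    rw [inner_sub_right, inner_sum]
    simp only [inner_smul_right, orthonormal_iff_ite.1 f.2]
    simp

lemma continuous_gr_iff {X : Type*} [TopologicalSpace X] {h : Gr n N → X} :
    Continuous h ↔ Continuous fun f : Frame n N => h (Quot.mk _ f) :=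
  (isQuotientMap_quot_mk (r := frameRel n N)).continuous_iff

lemma projMat_plane_mk (f : Frame n N) (i j : Fin N) :
    projMat (plane (Quot.mk _ f : Gr n N)) i j = ∑ k, f.1 k j * f.1 k i := by
  change (Submodule.span ℝ (Set.range f.1)).starProjection (EuclideanSpace.single j 1) i = _
  rw [starProjection_span_frame]
  simp [EuclideanSpace.inner_single_right]

lemma continuous_frame_apply (k : Fin n) : Continuous fun f : Frame n N => f.1 k :=
  (continuous_apply k).comp continuous_subtype_val

lemma continuous_projMat_plane : Continuous fun L : Gr n N => projMat (plane L) := by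
  rw [continuous_gr_iff]
  refine continuous_matrix fun i j => ?_
  have h : ∀ k i, Continuous fun f : Frame n N => (f.1 k i : ℝ) := fun k i =>
    (PiLp.continuous_apply 2 (fun _ : Fin N => ℝ) i).comp (continuous_frame_apply k)
  have h2 : Continuous fun f : Frame n N => ∑ k, (f.1 k j : ℝ) * f.1 k i :=
    continuous_finsetSum _ fun k _ => Continuous.mul (h k j) (h k i)
  exact h2.congr fun f => (projMat_plane_mk f i j).symm

lemma isExtend_projMat (L : Gr n N) : IsExtend (projMat (plane L)) (projMat (plane L.incl)) := by
  obtain ⟨f⟩ := L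
  have h : ∀ i j, projMat (plane (Gr.incl (Quot.mk _ f))) i j =
      ∑ k, (Frame.incl f).1 k j * (Frame.incl f).1 k i := projMat_plane_mk (Frame.incl f)
  refine ⟨fun i j => ?_, fun i => ?_, fun i => ?_⟩
  · rw [h, projMat_plane_mk]
    simp [Frame.incl, snocE]
  · rw [h]
    simp [Frame.incl, snocE]
  · rw [h]
    simp [Frame.incl, snocE]

lemma isCompact_norm_le_gr (R : ℝ) : IsCompact {z : Gr n N × Eu N | ‖z.2‖ ≤ R} := by
  have : {z : Gr n N × Eu N | ‖z.2‖ ≤ R} = Set.univ ×ˢ Metric.closedBall 0 R := by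
    ext z; simp
  rw [this]
  exact isCompact_univ.prod (isCompact_closedBall 0 R)

lemma isClosed_qTot : IsClosed {p : Gr n N × Eu N | p.2 ∈ (plane p.1)ᗮ} := by
  have : {p : Gr n N × Eu N | p.2 ∈ (plane p.1)ᗮ} =
      ⋂ i, {p | ∑ j, projMat (plane p.1) i j * p.2 j = 0} := by
    ext p
    simp only [Set.mem_ofPred_eq, Set.mem_iInter, sum_projMat]
    rw [← Submodule.starProjection_apply_eq_zero_iff]
    exact ⟨fun h i => by rw [h]; rfl, fun h => by ext i; exact h i⟩
  rw [this]
  refine isClosed_iInter fun i => isClosed_eq ?_ continuous_const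
  refine continuous_finsetSum _ fun j _ => Continuous.mul ?_ (by fun_prop)
  exact ((continuous_apply_apply i j).comp continuous_projMat_plane).comp continuous_fst

lemma isCompact_norm_le_qTot (R : ℝ) : IsCompact {z : QTot n N | ‖z.1.2‖ ≤ R} :=
  isClosed_qTot.isClosedEmbedding_subtypeVal.isCompact_preimage (isCompact_norm_le_gr R)

lemma continuous_norm_gr : Continuous fun z : Gr n N × Eu N => ‖z.2‖ := by fun_prop

lemma continuous_norm_qTot : Continuous fun z : QTot n N => ‖z.1.2‖ := by fun_prop

lemma continuous_consE : Continuous fun p : ℝ × Eu N => consE p.1 p.2 := by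
  refine (PiLp.continuous_toLp 2 _).comp (continuous_pi fun i => ?_)
  refine Fin.cases ?_ (fun i => ?_) i
  · simpa using continuous_fst
  · simp only [Fin.cons_succ]; fun_prop

lemma norm_consE_sq (t : ℝ) (x : Eu N) : ‖consE t x‖ ^ 2 = t ^ 2 + ‖x‖ ^ 2 := by
  rw [← real_inner_self_eq_norm_sq, inner_consE, real_inner_self_eq_norm_sq]; ring

lemma norm_snocE_sq (x : Eu N) (t : ℝ) : ‖snocE x t‖ ^ 2 = ‖x‖ ^ 2 + t ^ 2 := by
  rw [← real_inner_self_eq_norm_sq, inner_snocE, real_inner_self_eq_norm_sq]; ring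

lemma norm_le_norm_consE (t : ℝ) (x : Eu N) : ‖x‖ ≤ ‖consE t x‖ :=
  le_of_sq_le_sq (by rw [norm_consE_sq]; nlinarith [sq_nonneg t]) (norm_nonneg _)

lemma le_norm_consE (t : ℝ) (x : Eu N) : t ≤ ‖consE t x‖ :=
  le_of_sq_le_sq (by rw [norm_consE_sq]; nlinarith [sq_nonneg ‖x‖]) (norm_nonneg _)

lemma consE_snocE (a : ℝ) (x : Eu N) (t : ℝ) : consE a (snocE x t) = snocE (consE a x) t := by
  ext k
  refine Fin.cases ?_ (fun k => ?_) k
  · have : (0 : Fin (N + 2)) = Fin.castSucc 0 := rfl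
    rw [this]
    simp only [snocE, consE, Fin.snoc_castSucc]
    rfl
  · refine Fin.lastCases ?_ (fun k => ?_) k
    · rw [Fin.succ_last]
      simp [snocE, consE]
    · simp only [consE, snocE, Fin.cons_succ, Fin.snoc_castSucc]
      rw [Fin.succ_castSucc, Fin.snoc_castSucc, Fin.cons_succ]

lemma continuous_addLine : Continuous (Gr.addLine : Gr n N → Gr (n + 1) (N + 1)) := by
  rw [continuous_gr_iff]
  refine continuous_quot_mk.comp (Continuous.subtype_mk (continuous_pi fun i => ?_) _)
  refine Fin.cases ?_ (fun i => ?_) i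
  · exact continuous_const
  · exact continuous_consE.comp (continuous_const.prodMk (continuous_frame_apply i))

lemma addLine_incl (L : Gr n N) : L.incl.addLine = L.addLine.incl := by
  obtain ⟨f⟩ := L
  refine congrArg (Quot.mk _) (Subtype.ext (funext fun i => ?_))
  refine Fin.cases ?_ (fun i => ?_) i
  · change consE 1 0 = snocE (consE 1 0) 0
    rw [← consE_snocE]
    congr 1
    ext k
    refine Fin.lastCases ?_ (fun k => ?_) k <;> simp [snocE]
  · exact consE_snocE 0 (f.1 i) 0

end Grassmannian

/-! ### The cofibre sequence of Madsen–Tillmann spectra -/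

section Smash

variable {E F : Spec} {B : Type*} [TopologicalSpace B] (b₀ : B)

lemma IsMap.smash {f : ∀ N, E.X N → F.X N} (hf : IsMap E F f) :
    IsMap (smash E B b₀) (smash F B b₀) fun N p => (f N p.1, p.2) := by
  intro N
  obtain ⟨c, m, bs, st⟩ := hf N
  refine ⟨?_, fun p hp => ⟨m hp.1, trivial⟩, fun p hp => ?_, fun p hp t => ?_⟩
  · exact (c.comp continuousOn_fst fun p hp => hp.1).prodMk continuousOn_snd
  · exact hp.imp (fun h => bs h) fun h => ⟨m h.1, h.2⟩
  · exact Prod.ext (st p.1 hp.1 t) rfl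

lemma IsNullHomotopy.smash {h : ∀ N, E.X N → unitInterval → F.X N} {f : ∀ N, E.X N → F.X N}
    (hh : IsNullHomotopy E F h f) :
    IsNullHomotopy (smash E B b₀) (smash F B b₀) (fun N p s => (h N p.1 s, p.2))
      fun N p => (f N p.1, p.2) := by
  refine ⟨⟨fun N => ?_, fun s => (hh.1.2.1 s).smash b₀, fun N p hp => ?_⟩, fun N p hp => ?_⟩
  · refine ContinuousOn.prodMk ?_ (continuous_snd.comp continuous_fst).continuousOn
    refine (hh.1.1 N).comp (f := fun q : (E.X N × B) × unitInterval => (q.1.1, q.2))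
      (Continuous.continuousOn ?_) fun p hp => ⟨hp.1.1, trivial⟩
    exact (continuous_fst.comp continuous_fst).prodMk continuous_snd
  · exact Prod.ext (hh.1.2.2 N p.1 hp.1) rfl
  · exact Or.inl (hh.2 N p.1 hp.1)

end Smash

section Cofibre

variable (n : ℕ)

/-- The map `Σ⁻¹MTSO n → MTSO (n+1)` induced by `L ↦ ℝe ⊕ L`. -/
def bSpec : ∀ N, (desusp (MTSO n)).X N → (MTSO (n + 1)).X N
  | 0, _ => OnePoint.infty
  | _ + 1, z => OnePoint.elim z OnePoint.infty fun (z : QTot n _) =>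
      OnePoint.some ⟨(z.1.1.addLine, consE 0 z.1.2), cons_mem z⟩

/-- The null homotopy of `Σ⁻¹MTSO n → MTSO (n+1) → (BSO (n+1))₊`. -/
def qbSpec : ∀ N, (desusp (MTSO n)).X N → unitInterval → (BSOplus (n + 1)).X N
  | 0, _, _ => OnePoint.infty
  | _ + 1, z, s => OnePoint.elim z OnePoint.infty fun (z : QTot n _) =>
      if (s : ℝ) = 1 then OnePoint.infty
      else OnePoint.some (z.1.1.addLine, consE ((s : ℝ) / (1 - s)) z.1.2)

/-- The map `MTSO n → (BSO n)₊` induced by the inclusion of the quotient bundle. -/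
def qSpec : ∀ N, (MTSO n).X N → (BSOplus n).X N :=
  fun _ z => OnePoint.elim z OnePoint.infty fun z => OnePoint.some z.1

lemma isMap_qSpec : IsMap (MTSO n) (BSOplus n) (qSpec n) := by
  intro N
  refine ⟨Continuous.continuousOn ?_, fun _ _ => trivial, ?_, ?_⟩
  · exact continuous_onePoint_of_le continuous_norm_qTot isCompact_norm_le_qTot
      continuous_norm_gr continuous_subtype_val fun _ => le_rfl
  · rintro _ rfl
    rfl
  · rintro z - t
    cases z using OnePoint.rec with
    | infty => rfl
    | coe p => cases t using OnePoint.rec <;> rfl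

lemma continuous_bSpec_succ (N : ℕ) : Continuous (bSpec n (N + 1)) := by
  refine continuous_onePoint_of_le (ν' := fun z : QTot (n + 1) (N + 1) => ‖z.1.2‖)
    (g := fun z : QTot n N => (⟨(z.1.1.addLine, consE 0 z.1.2), cons_mem z⟩ :
      QTot (n + 1) (N + 1)))
    continuous_norm_qTot isCompact_norm_le_qTot continuous_norm_qTot ?_
    fun z => norm_le_norm_consE 0 z.1.2
  refine Continuous.subtype_mk (Continuous.prodMk ?_ ?_) _
  · exact continuous_addLine.comp (continuous_fst.comp continuous_subtype_val)
  · exact continuous_consE.comp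
      (continuous_const.prodMk (continuous_snd.comp continuous_subtype_val))

lemma isMap_bSpec : IsMap (desusp (MTSO n)) (MTSO (n + 1)) (bSpec n) := by
  intro N
  cases N with
  | zero =>
    refine ⟨continuousOn_const, fun _ _ => trivial, fun _ _ => rfl, ?_⟩
    rintro z - t
    rfl
  | succ N =>
    refine ⟨(continuous_bSpec_succ n N).continuousOn, fun _ _ => trivial, ?_, ?_⟩
    · rintro _ rfl
      rfl
    · rintro z - t
      cases z using OnePoint.rec with
      | infty => rfl
      | coe p =>
        cases t using OnePoint.rec with
        | infty => rfl
        | coe t =>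
          refine congrArg OnePoint.some (Subtype.ext (Prod.ext ?_ ?_))
          · exact addLine_incl p.1.1
          · exact consE_snocE 0 p.1.2 t

/-- At `s = 1` the added coordinate `s / (1 - s)` tends to infinity, uniformly over the base. -/
lemma continuous_qbSpec_succ (N : ℕ) :
    Continuous fun p : OnePoint (QTot n N) × unitInterval => qbSpec n (N + 1) p.1 p.2 := by
  rw [continuous_iff_continuousAt]
  rintro ⟨z, s⟩
  induction z using OnePoint.rec with
  | infty =>
    refine tendsto_infty_of_far continuous_norm_gr fun R => ?_
    have h := (continuous_fst (X := OnePoint (QTot n N)) (Y := unitInterval)).continuousAt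
      (x := (OnePoint.infty, s)) (far_mem_nhds continuous_norm_qTot isCompact_norm_le_qTot R)
    filter_upwards [h] with ⟨z, s⟩ hz
    induction z using OnePoint.rec with
    | infty => trivial
    | coe p =>
      change (if (s : ℝ) = 1 then _ else _) ∈ _
      split_ifs
      · trivial
      · exact lt_of_lt_of_le (some_mem_far.1 hz) (norm_le_norm_consE _ _)
  | coe p =>
    rw [continuousAt_coe_prod]
    change ContinuousAt (fun q : QTot n N × unitInterval => if (q.2 : ℝ) = 1 then OnePoint.infty
      else OnePoint.some (q.1.1.1.addLine, consE ((q.2 : ℝ) / (1 - q.2)) q.1.1.2)) (p, s)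
    have hs' : ContinuousAt (fun q : QTot n N × unitInterval => (q.2 : ℝ)) (p, s) :=
      (continuous_subtype_val.comp continuous_snd).continuousAt
    by_cases hs : (s : ℝ) = 1
    · rw [ContinuousAt, if_pos (show (((p, s) : QTot n N × unitInterval).2 : ℝ) = 1 from hs)]
      refine tendsto_infty_of_far continuous_norm_gr fun R => ?_
      -- `s / (1 - s) > R` if `s > |R| / (|R| + 1)`
      have h1 : |R| / (|R| + 1) < (s : ℝ) := by
        rw [hs, div_lt_one (by positivity)]; linarith
      filter_upwards [hs'.eventually (lt_mem_nhds h1)] with ⟨z, t⟩ ht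
      change |R| / (|R| + 1) < (t : ℝ) at ht
      change (if (t : ℝ) = 1 then _ else _) ∈ _
      split_ifs with ht1
      · trivial
      · have ht2 : (t : ℝ) < 1 := lt_of_le_of_ne t.2.2 ht1
        refine lt_of_lt_of_le ?_ (le_norm_consE _ _)
        rw [lt_div_iff₀ (by linarith)]
        rw [div_lt_iff₀ (by positivity)] at ht
        have := mul_le_mul_of_nonneg_right (le_abs_self R) (sub_nonneg.2 ht2.le)
        linarith
    · have h1 : ∀ᶠ q : QTot n N × unitInterval in 𝓝 (p, s), (q.2 : ℝ) ≠ 1 :=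
        hs'.eventually_ne hs
      refine ContinuousAt.congr (f := fun q : QTot n N × unitInterval =>
        (OnePoint.some (q.1.1.1.addLine, consE ((q.2 : ℝ) / (1 - q.2)) q.1.1.2) :
          OnePoint (Gr (n + 1) (N + 1) × Eu (N + 1)))) ?_ ?_
      · refine OnePoint.continuous_coe.continuousAt.comp (ContinuousAt.prodMk ?_ ?_)
        · exact (continuous_addLine.comp (continuous_fst.comp
            (continuous_subtype_val.comp continuous_fst))).continuousAt
        · refine continuous_consE.continuousAt.comp (f := fun q : QTot n N × unitInterval =>
            ((q.2 : ℝ) / (1 - q.2), q.1.1.2)) (ContinuousAt.prodMk ?_ ?_)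
          · exact hs'.div (continuousAt_const.sub hs') (sub_ne_zero.2 (Ne.symm hs))
          · exact (continuous_snd.comp (continuous_subtype_val.comp continuous_fst)).continuousAt
      · filter_upwards [h1] with q hq
        exact (if_neg hq).symm

lemma isNullHomotopy_qbSpec : IsNullHomotopy (desusp (MTSO n)) (BSOplus (n + 1)) (qbSpec n)
    fun N z => qSpec (n + 1) N (bSpec n N z) := by
  have hc : ∀ N, Continuous fun p : (desusp (MTSO n)).X N × unitInterval =>
      qbSpec n N p.1 p.2 := by
    intro N
    cases N with
    | zero => exact continuous_const
    | succ N => exact continuous_qbSpec_succ n N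
  refine ⟨⟨fun N => (hc N).continuousOn, fun s N => ⟨?_, fun _ _ => trivial, ?_, ?_⟩, ?_⟩, ?_⟩
  · exact ((hc N).comp (continuous_id.prodMk continuous_const)).continuousOn
  · cases N with
    | zero => exact fun _ _ => rfl
    | succ N => rintro _ rfl; rfl
  · cases N with
    | zero =>
      rintro z - t
      rfl
    | succ N =>
      rintro z - t
      cases z using OnePoint.rec with
      | infty => rfl
      | coe p =>
        cases t using OnePoint.rec with
        | infty =>
          change OnePoint.infty = OnePoint.elim (ite _ _ _) _ _
          split_ifs <;> rfl
        | coe t =>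
          change (if (s : ℝ) = 1 then OnePoint.infty else OnePoint.some
            (p.1.1.incl.addLine, consE ((s : ℝ) / (1 - s)) (snocE p.1.2 t))) =
            OnePoint.elim (if (s : ℝ) = 1 then OnePoint.infty else OnePoint.some
              (p.1.1.addLine, consE ((s : ℝ) / (1 - s)) p.1.2)) OnePoint.infty _
          split_ifs
          · rfl
          · rw [addLine_incl, consE_snocE]
            rfl
  · rintro (_ | N) z -
    · rfl
    · cases z using OnePoint.rec with
      | infty => rfl
      | coe p =>
        change (if ((0 : unitInterval) : ℝ) = 1 then OnePoint.infty else OnePoint.some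
          (p.1.1.addLine, consE (((0 : unitInterval) : ℝ) / (1 - ((0 : unitInterval) : ℝ))) p.1.2)) =
          OnePoint.some (p.1.1.addLine, consE 0 p.1.2)
        simp
  · rintro (_ | N) z -
    · rfl
    · cases z using OnePoint.rec with
      | infty => rfl
      | coe p => exact if_pos rfl

variable {B : Type*} [TopologicalSpace B] (b₀ : B)

lemma bMap_eq : bMap n b₀ = fun N p => (bSpec n N p.1, p.2) := by
  funext N p
  cases N <;> rfl

lemma qbNull_eq : qbNull n b₀ = fun N p s => (qbSpec n N p.1 s, p.2) := by
  funext N p s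
  cases N <;> rfl

lemma isMap_bMap :
    IsMap (smash (desusp (MTSO n)) B b₀) (smash (MTSO (n + 1)) B b₀) (bMap n b₀) := by
  rw [bMap_eq]
  exact (isMap_bSpec n).smash b₀

lemma isMap_qMap : IsMap (smash (MTSO n) B b₀) (smash (BSOplus n) B b₀) (qMap n b₀) :=
  (isMap_qSpec n).smash b₀

lemma isNullHomotopy_qbNull :
    IsNullHomotopy (smash (desusp (MTSO n)) B b₀) (smash (BSOplus (n + 1)) B b₀) (qbNull n b₀)
      fun N x => qMap (n + 1) b₀ N (bMap n b₀ N x) := by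
  rw [qbNull_eq, bMap_eq]
  exact (isNullHomotopy_qbSpec n).smash b₀

end Cofibre

/-! ### The map to connective K-theory -/

/-- A family of maps which is `c` at infinity is continuous if it is so over finite points and
tends to `c` locally uniformly in the parameter. -/
lemma continuous_onePoint_prod {Z Y F : Type*} [TopologicalSpace Z] [TopologicalSpace Y]
    [TopologicalSpace F] {ν : Z → ℝ} (hν : Continuous ν) (hc : ∀ R, IsCompact {z | ν z ≤ R})
    {A : Z × Y → F} (hA : Continuous A) {c : F}
    (h : ∀ y, ∀ U ∈ 𝓝 c, ∃ R, ∀ᶠ y' in 𝓝 y, ∀ z, R < ν z → A (z, y') ∈ U) :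
    Continuous fun q : OnePoint Z × Y => q.1.elim c fun z => A (z, q.2) := by
  rw [continuous_iff_continuousAt]
  rintro ⟨z, y⟩
  induction z using OnePoint.rec with
  | infty =>
    intro U hU
    have hU' : U ∈ 𝓝 c := hU
    obtain ⟨R, hR⟩ := h y U hU'
    have h1 := (far_mem_nhds hν hc R)
    rw [Filter.mem_map]
    filter_upwards [prod_mem_nhds h1 hR] with ⟨z, y'⟩ ⟨hz, hy'⟩
    induction z using OnePoint.rec with
    | infty => exact (mem_of_mem_nhds hU' : c ∈ U)
    | coe p => exact hy' p hz
  | coe p =>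
    rw [continuousAt_coe_prod]
    exact hA.continuousAt

lemma exists_forall_norm_lt {N : ℕ} (f : ZeroAtInftyContinuousMap (Eu N) ℝ) {ε : ℝ} (hε : 0 < ε) :
    ∃ R, ∀ x, R < ‖x‖ → ‖f x‖ < ε := by
  have h := f.zero_at_infty'
  rw [← Metric.cobounded_eq_cocompact] at h
  obtain ⟨R, -, hR⟩ := (Filter.hasBasis_cobounded_norm.tendsto_left_iff).1 h _
    (Metric.ball_mem_nhds 0 hε)
  exact ⟨R, fun x hx => mem_ball_zero_iff.1 (hR (show R ≤ ‖x‖ from hx.le))⟩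

/-- The operator `X` on the summand `HK ⊗ Λ⁰` of `HU`. -/
def vacU (X : HK →L[ℂ] HK) : HU →L[ℂ] HU := ins ∅ ∘L X ∘L prj ∅

lemma vacU_eq_tens (X : HK →L[ℂ] HK) :
    vacU X = tens (fun _ : Unit => (ins ∅ : HK →L[ℂ] HU)) 1 X := by
  simp [tens, vacU, ins_adjoint]

lemma isFrame_ins_empty : IsFrame fun _ : Unit => (ins ∅ : HK →L[ℂ] HU) := by
  classical
  intro i j
  rw [ins_adjoint, prj_comp_ins, if_pos rfl, if_pos rfl]

lemma gradU_comp_ins_empty :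
    gradU.toContinuousLinearMap ∘L (ins ∅ : HK →L[ℂ] HU) =
      (1 : ℂ) • (ins ∅ ∘L gradK.toContinuousLinearMap) := by
  rw [gradU, diagOp_comp_ins, signed_toContinuousLinearMap, Finset.card_empty, pow_zero, one_smul,
    one_smul]

lemma damp_zero_right (X : HK →L[ℂ] HK) : damp X 0 = X := by
  simp [damp]

lemma vacU_eq_extK (Q : HK →L[ℂ] HK) :
    vacU Q = extK (fun _ : Unit => (ins ∅ : HK →L[ℂ] HU)) gradK Q 0 0 := by
  rw [extK, damp_zero_right, vacU_eq_tens]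
  simp [tens]

section Vacuum

variable {Q : HK →L[ℂ] HK} (hQ : Q ∈ KSpace gradK)

include hQ

lemma vacU_mem_KSpace : vacU Q ∈ KSpace gradU := by
  rw [vacU_eq_extK]
  refine extK_mem_KSpace (ε := fun _ => 1) isFrame_ins_empty isGrading_gradK isGrading_gradU
    (fun _ => gradU_comp_ins_empty) (fun _ => star_one _) hQ le_rfl ?_ ?_ ?_
  · simp
  · simp
  · have : Matrix.diagonal (fun _ : Unit => (1 : ℂ)) = 1 := Matrix.diagonal_one
    rw [this]; simp

lemma damp_vacU {r : ℝ} (hr : 0 ≤ r) : damp (vacU Q) r = vacU (damp Q r) := by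
  rw [vacU_eq_extK, damp_extK isFrame_ins_empty isGrading_gradK hQ le_rfl (by simp) (by simp) hr,
    zero_add, vacU_eq_tens, extK]
  simp [tens]

lemma dampSq_vacU {r : ℝ} (hr : 0 ≤ r) :
    dampSq gradU (vacU Q) r = vacU (dampSq gradK Q r) := by
  have : Matrix.diagonal (fun _ : Unit => (1 : ℂ)) = 1 := Matrix.diagonal_one
  rw [vacU_eq_extK, dampSq_extK (ε := fun _ => 1) isFrame_ins_empty isGrading_gradK
    (fun _ => gradU_comp_ins_empty) hQ le_rfl (by simp) (by simp) hr, zero_add, vacU_eq_tens, this]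

end Vacuum

lemma vacU_zero : vacU 0 = 0 := by
  rw [vacU, ContinuousLinearMap.zero_comp, ContinuousLinearMap.comp_zero]

lemma continuous_vacU : Continuous vacU := by
  unfold vacU
  exact continuous_const.clm_comp (continuous_id.clm_comp continuous_const)

lemma eq_snocE_iff {N : ℕ} (y : Eu (N + 1)) (x : Eu N) (t : ℝ) :
    y = snocE x t ↔ y (Fin.last N) = t ∧
      WithLp.toLp 2 (Fin.init (α := fun _ => ℝ) y.ofLp) = x := by
  constructor
  · rintro rfl
    refine ⟨by simp [snocE], ?_⟩
    ext k
    simp [snocE, Fin.init]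
  · rintro ⟨rfl, rfl⟩
    ext k
    refine Fin.lastCases ?_ (fun k => ?_) k <;> simp [snocE, Fin.init]

section SigmaBar

variable {n : ℕ} {B : Type*} [TopologicalSpace B] {b₀ : B} {W : B → Submodule ℝ HR}

lemma sigmaBar'_infty (N : ℕ) (b : B) : sigmaBar' n b₀ W N (OnePoint.infty, b) = fun _ => 0 := rfl

open Classical in
lemma sigmaBar'_some (N : ℕ) (z : Gr n N × Eu N) (b : B) :
    sigmaBar' n b₀ W N (OnePoint.some z, b) =
      fun x => if x = z.2 then vacU (diffClass (W b) (W b₀)) else 0 := by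
  funext x
  change (if x = z.2 then _ else _) = _
  split_ifs <;> rfl

/-- The configuration of `σ̄'` has at most one point. -/
lemma finsum_sigmaBar' {M : Type*} [AddCommMonoid M] (N : ℕ) (g : Eu N → (HU →L[ℂ] HU) → M)
    (hg : ∀ x, g x 0 = 0)
    (p : (smash (BSOplus n) B b₀).X N) :
    ∑ᶠ x, g x (sigmaBar' n b₀ W N p x) =
      OnePoint.elim p.1 0 fun z => g z.2 (vacU (diffClass (W p.2) (W b₀))) := by
  classical
  obtain ⟨z, b⟩ := p
  induction z using OnePoint.rec with
  | infty => exact (finsum_congr fun x => hg x).trans finsum_zero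
  | coe z =>
    rw [finsum_eq_single _ z.2]
    · exact congrArg (g z.2) (if_pos rfl)
    · exact fun x hx => (congrArg (g x) (if_neg hx)).trans (hg x)

lemma isMap_sigmaBar' (hW : ∀ b, FiniteDimensional ℝ (W b))
    (hc : Continuous fun b => diffClass (W b) (W b₀)) :
    IsMap (smash (BSOplus n) B b₀) ko (sigmaBar' n b₀ W) := by
  classical
  have hK : ∀ b, diffClass (W b) (W b₀) ∈ KSpace gradK := fun b =>
    have := hW b; have := hW b₀; diffClass_mem_KSpace _ _
  intro N
  refine ⟨Continuous.continuousOn ?_, ?_, ?_, ?_⟩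
  · refine continuous_induced_rng.2 (continuous_pi fun f => ?_)
    have h1 : (fun p : (smash (BSOplus n) B b₀).X N =>
        ∑ᶠ x, ((f x : ℝ) : ℂ) • sigmaBar' n b₀ W N p x) = fun p : OnePoint (Gr n N × Eu N) × B =>
        OnePoint.elim p.1 0 fun z => ((f z.2 : ℝ) : ℂ) • vacU (diffClass (W p.2) (W b₀)) := by
      funext p
      exact finsum_sigmaBar' N (fun x T => ((f x : ℝ) : ℂ) • T) (fun x => smul_zero _) p
    have hv : Continuous fun b : B => vacU (diffClass (W b) (W b₀)) :=
      continuous_vacU.comp hc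
    have h2 : Continuous fun p : OnePoint (Gr n N × Eu N) × B =>
        OnePoint.elim p.1 0 fun z => ((f z.2 : ℝ) : ℂ) • vacU (diffClass (W p.2) (W b₀)) := by
      refine continuous_onePoint_prod (A := fun q : (Gr n N × Eu N) × B =>
        ((f q.1.2 : ℝ) : ℂ) • vacU (diffClass (W q.2) (W b₀))) continuous_norm_gr
        isCompact_norm_le_gr ?_ ?_
      · refine Continuous.smul (f := fun q : (Gr n N × Eu N) × B => ((f q.1.2 : ℝ) : ℂ))
          (g := fun q => vacU (diffClass (W q.2) (W b₀))) ?_ (hv.comp continuous_snd)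
        exact Complex.continuous_ofReal.comp
          (f.continuous.comp (continuous_snd.comp continuous_fst))
      · intro b U hU
        obtain ⟨ε, hε, hU⟩ := Metric.mem_nhds_iff.1 hU
        set C := ‖vacU (diffClass (W b) (W b₀))‖ + 1 with hC
        have hC0 : 0 < C := by positivity
        obtain ⟨R, hR⟩ := exists_forall_norm_lt f (div_pos hε hC0)
        refine ⟨R, ?_⟩
        have h3 : ∀ᶠ b' in 𝓝 b, ‖vacU (diffClass (W b') (W b₀))‖ < C :=
          hv.norm.continuousAt.eventually (gt_mem_nhds (lt_add_one _))
        filter_upwards [h3] with b' hb' z hz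
        refine hU (mem_ball_zero_iff.2 ?_)
        rw [norm_smul, Complex.norm_real]
        calc _ ≤ ‖f z.2‖ * C := by gcongr
          _ < ε / C * C := by gcongr; exact hR _ hz
          _ = ε := div_mul_cancel₀ _ hC0.ne'
    rw [← h1] at h2
    exact h2
  · rintro ⟨z, b⟩ -
    induction z using OnePoint.rec with
    | infty =>
      rw [sigmaBar'_infty]
      refine ⟨?_, fun x => ?_, fun x v => ?_, fun x y _ => mul_zero _⟩
      · rw [Function.support_fun_zero]; exact Set.finite_empty
      · rw [← vacU_zero, ← diffClass_self (W b₀)]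
        exact vacU_mem_KSpace (hK b₀)
      · simp
    | coe z =>
      rw [sigmaBar'_some]
      refine ⟨(Set.finite_singleton z.2).subset fun x hx => ?_, fun x => ?_, fun x => ?_,
        fun x y hxy => ?_⟩
      · by_contra h
        exact hx (if_neg h)
      · beta_reduce
        split_ifs
        · exact vacU_mem_KSpace (hK b)
        · rw [← vacU_zero, ← diffClass_self (W b₀)]
          exact vacU_mem_KSpace (hK b₀)
      · beta_reduce
        split_ifs
        · exact (isConj_ins _).comp ((isConj_diffClass _ _).comp (isConj_prj _))
        · intro v; simp
      · beta_reduce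
        by_cases hx : x = z.2
        · rw [if_neg (fun hy : y = z.2 => hxy (hx.trans hy.symm)), mul_zero]
        · rw [if_neg hx, zero_mul]
  · rintro ⟨z, b⟩ (hz | ⟨-, hb⟩)
    · have : z = OnePoint.infty := hz
      subst this
      rfl
    · have : b = b₀ := hb
      subst this
      refine Set.mem_singleton_iff.2 ?_
      induction z using OnePoint.rec with
      | infty => rfl
      | coe z =>
        rw [sigmaBar'_some, diffClass_self, vacU_zero]
        funext x
        exact ite_self _
  · rintro ⟨z, b⟩ - t
    funext y
    induction z using OnePoint.rec with
    | infty =>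
      cases t using OnePoint.rec with
      | infty => rfl
      | coe t => exact (ite_self _).symm
    | coe z =>
      cases t using OnePoint.rec with
      | infty => rfl
      | coe t =>
        rw [sigmaBar'_some]
        refine (congrFun (sigmaBar'_some (b₀ := b₀) (W := W) (N + 1)
          (z.1.incl, snocE z.2 t) b) y).trans ?_
        change (if y = snocE z.2 t then _ else _) = if y (Fin.last N) = t then
          (if WithLp.toLp 2 (Fin.init (α := fun _ => ℝ) y.ofLp) = z.2 then _ else _) else _
        rw [← ite_and]
        exact if_congr (eq_snocE_iff y z.2 t) rfl rfl

end SigmaBar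

/-! ### The rotated external product -/

section Continuity

set_option linter.unusedSectionVars false

variable {V W : Type} [NormedAddCommGroup V] [InnerProductSpace ℂ V] [CompleteSpace V]
  [NormedAddCommGroup W] [InnerProductSpace ℂ W] [CompleteSpace W]
  {ι : Type} [Fintype ι] [DecidableEq ι] {Y : Type*} [TopologicalSpace Y]

lemma continuousAt_tens {u : Y → ι → V →L[ℂ] W} {M : Y → Matrix ι ι ℂ} {X : Y → V →L[ℂ] V} {y : Y}
    (hu : ∀ i, ContinuousAt (fun y => u y i) y) (hM : ∀ i j, ContinuousAt (fun y => M y i j) y)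
    (hX : ContinuousAt X y) : ContinuousAt (fun y => tens (u y) (M y) (X y)) y := by
  have ha : ∀ i, ContinuousAt (fun y => (u y i).adjoint) y := fun i =>
    ContinuousAt.comp (f := fun y => u y i)
      (ContinuousLinearMap.adjoint (𝕜 := ℂ) (E := V) (F := W)).continuous.continuousAt (hu i)
  have h : ∀ i j, ContinuousAt (fun y => M y i j • (u y i ∘L X y ∘L (u y j).adjoint)) y :=
    fun i j => ContinuousAt.smul (hM i j) ((hu i).clm_comp (hX.clm_comp (ha j)))
  exact tendsto_finsetSum _ fun i _ => tendsto_finsetSum _ fun j _ => h i j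

lemma continuousAt_extK {u : Y → ι → V →L[ℂ] W} (γ : V →ₗᵢ[ℂ] V) {Q : Y → V →L[ℂ] V}
    {k : Y → Matrix ι ι ℂ} {r : Y → ℝ} {y : Y} (hu : ∀ i, ContinuousAt (fun y => u y i) y)
    (hQ : ContinuousAt Q y) (hsa : IsSelfAdjoint (Q y))
    (hk : ∀ i j, ContinuousAt (fun y => k y i j) y) (hr : ContinuousAt r y) (h0 : 0 ≤ r y) :
    ContinuousAt (fun y => extK (u y) γ (Q y) (k y) (r y)) y := by
  have h1 : ContinuousAt (fun y => damp (Q y) (r y)) y :=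
    ContinuousAt.comp (f := fun y => (Q y, r y)) (continuousAt_damp hsa h0) (hQ.prodMk hr)
  have h2 : ContinuousAt (fun y => dampSq γ (Q y) (r y)) y :=
    ContinuousAt.comp (f := fun y => (Q y, r y)) (continuousAt_dampSq γ hsa h0) (hQ.prodMk hr)
  have h3 : ContinuousAt (fun y => tens (u y) (1 : Matrix ι ι ℂ) (damp (Q y) (r y))) y :=
    continuousAt_tens hu (fun _ _ => continuousAt_const) h1
  have h4 := continuousAt_tens hu hk h2
  exact ContinuousAt.add h3 h4

end Continuity

section Bounds

variable {N : ℕ}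

lemma norm_koszul_apply_le (x y : Eu N) (S T : Finset (Fin N)) :
    ‖koszul (cplx x y) S T‖ ≤ √(‖x‖ ^ 2 + ‖y‖ ^ 2) := by
  -- the rows of a self-adjoint matrix with square `r` have length `√r`
  set k := koszul (cplx x y) with hk
  have h : ∑ T, ‖k S T‖ ^ 2 = ‖x‖ ^ 2 + ‖y‖ ^ 2 := by
    have h1 := congrFun (congrFun (koszul_mul_self (cplx x y)) S) S
    rw [sum_cplx, Matrix.mul_apply, Matrix.smul_apply, Matrix.one_apply_eq, smul_eq_mul,
      mul_one] at h1
    have h2 : ∀ T, k S T * k T S = ((‖k S T‖ ^ 2 : ℝ) : ℂ) := by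
      intro T
      have h3 : k T S = star (k S T) := by
        conv_lhs => rw [hk, ← koszul_conjTranspose, Matrix.conjTranspose_apply]
      rw [h3, Complex.star_def, Complex.mul_conj, Complex.normSq_eq_norm_sq]
    rw [← hk, Finset.sum_congr rfl fun T _ => h2 T, ← Complex.ofReal_sum] at h1
    exact_mod_cast h1
  refine Real.le_sqrt_of_sq_le ?_
  rw [← h]
  exact Finset.single_le_sum (f := fun T => ‖k S T‖ ^ 2) (fun _ _ => by positivity)
    (Finset.mem_univ T)

lemma norm_one_apply_le (S T : Finset (Fin N)) :
    ‖(1 : Matrix (Finset (Fin N)) (Finset (Fin N)) ℂ) S T‖ ≤ 1 := by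
  rw [Matrix.one_apply]; split_ifs <;> simp

lemma norm_kosz_apply_le (x y : Eu N) (S T : Finset (Fin N)) :
    ‖kosz (cplx x y) S T‖ ≤ √(‖x‖ ^ 2 + ‖y‖ ^ 2) + 2 := by
  have h1 : ‖gradExt N S T‖ ≤ 1 := by
    rw [gradExt, Matrix.diagonal_apply]; split_ifs <;> simp
  have h2 := norm_koszul_apply_le x y S T
  have h3 := norm_one_apply_le S T
  rw [kosz, Matrix.sub_apply, Matrix.add_apply]
  calc _ ≤ ‖koszul (cplx x y) S T‖ + ‖gradExt N S T‖ +
        ‖(1 : Matrix (Finset (Fin N)) (Finset (Fin N)) ℂ) S T‖ :=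
        (norm_sub_le _ _).trans (by gcongr; exact norm_add_le _ _)
    _ ≤ _ := by linarith

end Bounds

variable {N : ℕ}

/-- The external product of `Q` on `HK` with the Koszul complex at `x + iζ`, on the rotated copy of
`HK ⊗ Λ^•ℂᴺ` in `HN N`: for `s = 0` this is `HK ⊗ Λ⁰ ⊗ Λ^•ℂᴺ`, and for `s = 1`, with `p` the
projection to `L`, it is `HK ⊗ Λ^•L_ℂ ⊗ Λ^•(Lᗮ)_ℂ`. -/
def rotProd (p : Matrix (Fin N) (Fin N) ℝ) (x : Eu N) (Q : HK →L[ℂ] HK) (s : ℝ) (ζ : Eu N) :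
    HN N →L[ℂ] HN N :=
  extK (frameU (rotFrame p s)) gradK Q (kosz (cplx x ζ)) (‖x‖ ^ 2 + ‖ζ‖ ^ 2)

lemma continuous_frameU_rotFrame (S : Finset (Fin N)) :
    Continuous fun q : Matrix (Fin N) (Fin N) ℝ × ℝ => frameU (rotFrame q.1 q.2) S := by
  unfold frameU
  have h : ∀ a, Continuous fun q : Matrix (Fin N) (Fin N) ℝ × ℝ => rotFrame q.1 q.2 a S := fun a =>
    (continuous_apply_apply a (∅, S)).comp continuous_rot
  exact continuous_finsetSum _ fun a _ => (h a).smul continuous_const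

lemma continuous_cplx : Continuous fun q : Eu N × Eu N => cplx q.1 q.2 := by
  refine continuous_pi fun k => ?_
  unfold cplx
  fun_prop

lemma continuous_wedge (S T : Finset (Fin N)) : Continuous fun v : Fin N → ℂ => wedge v S T := by
  unfold wedge
  refine continuous_finsetSum _ fun i _ => ?_
  split_ifs <;> fun_prop

lemma continuous_kosz (S T : Finset (Fin N)) : Continuous fun v : Fin N → ℂ => kosz v S T := by
  simp only [kosz, koszul, Matrix.sub_apply, Matrix.add_apply, Matrix.conjTranspose_apply]
  exact (((continuous_wedge S T).add (continuous_wedge T S).star).add continuous_const).sub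
    continuous_const

lemma continuous_rotProd {Y : Type*} [TopologicalSpace Y] {p : Y → Matrix (Fin N) (Fin N) ℝ}
    {x ζ : Y → Eu N} {Q : Y → HK →L[ℂ] HK} {s : Y → ℝ} (hp : Continuous p) (hx : Continuous x)
    (hQ : Continuous Q) (hs : Continuous s) (hζ : Continuous ζ) (h : ∀ y, IsSelfAdjoint (Q y)) :
    Continuous fun y => rotProd (p y) (x y) (Q y) (s y) (ζ y) := by
  rw [continuous_iff_continuousAt]
  intro y
  refine continuousAt_extK gradK (fun S => ?_) hQ.continuousAt (h y) (fun S T => ?_) ?_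
    (by positivity)
  · exact ((continuous_frameU_rotFrame S).comp (hp.prodMk hs)).continuousAt
  · exact ((continuous_kosz S T).comp (continuous_cplx.comp (hx.prodMk hζ))).continuousAt
  · exact ((hx.norm.pow 2).add (hζ.norm.pow 2)).continuousAt

section Properties

variable (p : Matrix (Fin N) (Fin N) ℝ) (x : Eu N) {Q : HK →L[ℂ] HK} (s : ℝ) (ζ : Eu N)

@[simp] lemma rotProd_zero : rotProd p x 0 s ζ = 0 := extK_zero _ _ _ _

variable (hQ : Q ∈ KSpace gradK)

include hQ

lemma rotProd_mem_KSpace : rotProd p x Q s ζ ∈ KSpace (gradN N) := by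
  have hu := isFrame_frameU (rotFrame_conjTranspose_mul_self p s)
  have hΓ := gradN_comp_frameU (grad_mul_rotFrame p s)
  have hk : kosz (cplx x ζ) * kosz (cplx x ζ) =
      ((‖x‖ ^ 2 + ‖ζ‖ ^ 2 : ℝ) : ℂ) • 1 - (2 : ℂ) • kosz (cplx x ζ) := by
    rw [kosz_mul_self, sum_cplx]
  have hε : ∀ S : Finset (Fin N), star ((-1 : ℂ) ^ S.card) = (-1) ^ S.card := fun S => by simp
  exact extK_mem_KSpace hu isGrading_gradK (isGrading_gradN N) hΓ hε hQ (by positivity) hk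
    (kosz_conjTranspose _) (kosz_mul_gradExt _)

lemma rotProd_neg_star (hc : IsConj Q Q) :
    IsConj (rotProd p x Q s ζ) (rotProd p x Q s (-ζ)) := by
  rw [rotProd, rotProd, norm_neg, ← star_cplx]
  exact isConj_extK (isConj_frameU fun a S => star_rot p s a (∅, S))
    (isConj_frameU_adjoint fun a S => star_rot p s a (∅, S)) (kosz_star_apply _) isConj_gradK
    hQ.2.1 hc (by positivity)

/-- The decay of the rotated external product, uniformly in everything but `x` and `ζ`. -/
lemma norm_rotProd_le {R : ℝ} (hR : 1 ≤ R) (h : R ≤ ‖x‖ ∨ R ≤ ‖ζ‖) :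
    ‖rotProd p x Q s ζ‖ ≤ 7 * (Fintype.card (Finset (Fin N))) ^ 2 / R := by
  set c : ℝ := (Fintype.card (Finset (Fin N))) ^ 2 with hc
  set r := ‖x‖ ^ 2 + ‖ζ‖ ^ 2 with hr
  have hR0 : 0 < R := by linarith
  have hRr : R ^ 2 ≤ r := by
    rcases h with h | h
    · nlinarith [sq_nonneg ‖ζ‖, norm_nonneg x]
    · nlinarith [sq_nonneg ‖x‖, norm_nonneg ζ]
  have hr0 : 0 < r := by nlinarith
  have hs : R ≤ √r := Real.le_sqrt_of_sq_le hRr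
  have hs0 : 0 < √r := by linarith
  have hss : √r * √r = r := Real.mul_self_sqrt hr0.le
  have hu := isFrame_frameU (rotFrame_conjTranspose_mul_self p s)
  have hsum : ∀ (M : Matrix (Finset (Fin N)) (Finset (Fin N)) ℂ) (m : ℝ),
      (∀ S T, ‖M S T‖ ≤ m) → ∑ S, ∑ T, ‖M S T‖ ≤ c * m := by
    intro M m hM
    calc ∑ S, ∑ T, ‖M S T‖ ≤ ∑ _S : Finset (Fin N), ∑ _T : Finset (Fin N), m :=
          Finset.sum_le_sum fun S _ => Finset.sum_le_sum fun T _ => hM S T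
      _ = c * m := by
          rw [Finset.sum_const, Finset.sum_const, Finset.card_univ, nsmul_eq_mul, nsmul_eq_mul, hc]
          ring
  have h1 := norm_tens_le hu (1 : Matrix (Finset (Fin N)) (Finset (Fin N)) ℂ) (damp Q r)
  have h2 := norm_tens_le hu (kosz (cplx x ζ)) (dampSq gradK Q r)
  have h3 := hsum 1 1 norm_one_apply_le
  have h4 := hsum (kosz (cplx x ζ)) (√r + 2) (norm_kosz_apply_le x ζ)
  have h5 := norm_damp_le hQ.2.1 hr0
  have h6 := norm_dampSq_le (γ := gradK) hQ.2.1 hr0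
  have hc0 : 0 ≤ c := by positivity
  have h7 : (√r)⁻¹ ≤ R⁻¹ := inv_anti₀ hR0 hs
  -- `√r + 2 ≤ 3 √r`, so that the second term is at most `6 c / √r`
  have h8 : (√r + 2) * (2 / r) ≤ 6 * R⁻¹ := by
    have : (√r + 2) * (2 / r) ≤ (3 * √r) * (2 / r) := by gcongr; linarith
    refine this.trans ?_
    have e : (3 * √r) * (2 / r) = 6 * (√r)⁻¹ := by
      have : 2 / r = 2 / (√r * √r) := by rw [hss]
      rw [this]
      field_simp
      norm_num
    rw [e]
    gcongr
  calc ‖rotProd p x Q s ζ‖ ≤ _ + _ := norm_add_le _ _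
    _ ≤ (c * 1) * (√r)⁻¹ + (c * (√r + 2)) * (2 / r) := by
        refine add_le_add (h1.trans ?_) (h2.trans ?_)
        · gcongr
        · gcongr
    _ ≤ c * R⁻¹ + c * (6 * R⁻¹) := by
        rw [mul_one, mul_assoc c]
        gcongr
    _ = 7 * c / R := by ring

/-- The compatibility of the rotated external products with the structure maps of `KO`. -/
lemma bottMul_rotProd {p' : Matrix (Fin (N + 1)) (Fin (N + 1)) ℝ} (hp : IsExtend p p') (t : ℝ)
    (η : Eu (N + 1)) :
    bottMul (rotProd p x Q s (WithLp.toLp 2 (Fin.init (α := fun _ => ℝ) η.ofLp)))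
      ((t : ℂ) + Complex.I * (η (Fin.last N) : ℂ)) = rotProd p' (snocE x t) Q s η := by
  set ζ : Eu N := WithLp.toLp 2 (Fin.init (α := fun _ => ℝ) η.ofLp) with hζ
  have hη : η = snocE ζ (η (Fin.last N)) := (eq_snocE_iff _ _ _).2 ⟨rfl, rfl⟩
  set v := cplx (snocE x t) η with hv
  have hv1 : (fun i : Fin N => v i.castSucc) = cplx x ζ := by
    funext i
    simp [hv, cplx, snocE, hζ, Fin.init]
  have hv2 : v (Fin.last N) = (t : ℂ) + Complex.I * (η (Fin.last N) : ℂ) := by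
    simp [hv, cplx, snocE]
  have h := bottMul_extK (u' := frameU (rotFrame p' s))
    (isFrame_frameU (rotFrame_conjTranspose_mul_self p s))
    (fun S => incE_comp_frameU hp s S) (fun S => incO_comp_frameU hp s S)
    (gradN_comp_frameU (grad_mul_rotFrame p s)) hQ (v := v) (r := ‖x‖ ^ 2 + ‖ζ‖ ^ 2)
    (by positivity) (by
      have := sum_cplx x ζ
      rw [← hv1] at this
      exact this)
  rw [hv1, hv2] at h
  rw [rotProd, rotProd, h]
  congr 1
  have e1 : ‖η‖ ^ 2 = ‖ζ‖ ^ 2 + (η (Fin.last N)) ^ 2 := by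
    conv_lhs => rw [hη]
    rw [norm_snocE_sq]
  have e2 : ‖(t : ℂ) + Complex.I * (η (Fin.last N) : ℂ)‖ ^ 2 = t ^ 2 + (η (Fin.last N)) ^ 2 := by
    rw [← Complex.normSq_eq_norm_sq, mul_comm, Complex.normSq_add_mul_I]
  rw [norm_snocE_sq, e1, e2]
  ring

end Properties

/-! ### The homotopy of maps to periodic K-theory -/

/-- A family of maps on `ℝᴺ`, jointly continuous and uniformly small near infinity, is continuous in
the uniform topology. -/
lemma continuous_ofFun {N : ℕ} {Y F : Type*} [TopologicalSpace Y] [NormedAddCommGroup F]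
    {A : Y → Eu N → F} (hA : Continuous fun q : Y × Eu N => A q.1 q.2)
    (h : ∀ ε > 0, ∃ R, ∀ y ζ, R < ‖ζ‖ → ‖A y ζ‖ < ε) :
    Continuous fun y => (UniformFun.ofFun (A y) : Eu N →ᵤ F) := by
  rw [continuous_iff_continuousAt]
  intro y
  refine UniformFun.tendsto_iff_tendstoUniformly.2 (Metric.tendstoUniformly_iff.2 fun ε hε => ?_)
  obtain ⟨R, hR⟩ := h (ε / 2) (half_pos hε)
  have h1 : ∀ᶠ y' in 𝓝 y, ∀ ζ ∈ Metric.closedBall (0 : Eu N) R, dist (A y ζ) (A y' ζ) < ε := by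
    refine (isCompact_closedBall 0 R).eventually_forall_of_forall_eventually
      (P := fun y' ζ => dist (A y ζ) (A y' ζ) < ε) fun ζ _ => ?_
    have h2 : Continuous fun q : Y × Eu N => dist (A y q.2) (A q.1 q.2) :=
      (hA.comp (continuous_const.prodMk continuous_snd)).dist hA
    exact h2.continuousAt.eventually (gt_mem_nhds (by simpa using hε))
  filter_upwards [h1] with y' hy' ζ
  by_cases hζ : ‖ζ‖ ≤ R
  · exact hy' ζ (mem_closedBall_zero_iff.2 hζ)
  · have h3 := hR y ζ (not_le.1 hζ)
    have h4 := hR y' ζ (not_le.1 hζ)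
    change dist (A y ζ) (A y' ζ) < ε
    rw [dist_eq_norm]
    calc _ ≤ ‖A y ζ‖ + ‖A y' ζ‖ := norm_sub_le _ _
      _ < ε := by linarith

lemma exists_norm_rotProd_lt (N : ℕ) {ε : ℝ} (hε : 0 < ε) :
    ∃ R : ℝ, ∀ (p : Matrix (Fin N) (Fin N) ℝ) (x : Eu N) (Q : HK →L[ℂ] HK) (s : ℝ) (ζ : Eu N),
      Q ∈ KSpace gradK → R < ‖x‖ ∨ R < ‖ζ‖ → ‖rotProd p x Q s ζ‖ < ε := by
  set c : ℝ := 7 * (Fintype.card (Finset (Fin N))) ^ 2 with hc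
  have hc0 : 0 < c := by positivity
  refine ⟨max 1 (2 * c / ε), fun p x Q s ζ hQ h => ?_⟩
  have h1 := norm_rotProd_le p x s ζ hQ (le_max_left 1 (2 * c / ε)) (h.imp le_of_lt le_of_lt)
  refine h1.trans_lt ?_
  have h2 : 0 < 2 * c / ε := by positivity
  calc c / max 1 (2 * c / ε) ≤ c / (2 * c / ε) := by gcongr; exact le_max_right _ _
    _ = ε / 2 := by field_simp
    _ < ε := half_lt_self hε

/-- The homotopy, on the `N`-th space of the suspension spectrum of `(BSO n)₊`. -/
def rotClass {n : ℕ} (N : ℕ) (z : OnePoint (Gr n N × Eu N)) (Q : HK →L[ℂ] HK) (s : ℝ) : KO.X N :=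
  UniformFun.ofFun fun ζ => z.elim 0 fun z => rotProd (projMat (plane z.1)) z.2 Q s ζ

section Family

variable {n N : ℕ} {B : Type*} [TopologicalSpace B] {D : B → HK →L[ℂ] HK}

lemma rotClass_zero (z : OnePoint (Gr n N × Eu N)) (s : ℝ) :
    rotClass N z 0 s = UniformFun.ofFun 0 := by
  refine congrArg UniformFun.ofFun (funext fun ζ => ?_)
  induction z using OnePoint.rec with
  | infty => rfl
  | coe z => exact rotProd_zero _ _ _ _

lemma zero_mem_KSpace {V : Type} [NormedAddCommGroup V] [InnerProductSpace ℂ V] [CompleteSpace V]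
    (γ : V →ₗᵢ[ℂ] V) : (0 : V →L[ℂ] V) ∈ KSpace γ :=
  ⟨isCompactOperator_zero, IsSelfAdjoint.zero _, by simp⟩

lemma rotClass_mem_carrier (z : OnePoint (Gr n N × Eu N)) {Q : HK →L[ℂ] HK}
    (hQ : Q ∈ KSpace gradK) (hc : IsConj Q Q) (s : ℝ) : rotClass N z Q s ∈ KO.carrier N := by
  induction z using OnePoint.rec with
  | infty =>
    refine ⟨fun ζ => zero_mem_KSpace _, fun ζ v => ?_, continuous_const, tendsto_const_nhds⟩
    change (0 : HN N) = star 0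
    rw [star_zero]
  | coe z =>
    refine ⟨fun ζ => rotProd_mem_KSpace _ _ _ _ hQ, fun ζ v => rotProd_neg_star _ _ _ _ hQ hc v,
      ?_, ?_⟩
    · exact continuous_rotProd continuous_const continuous_const continuous_const continuous_const
        continuous_id fun _ => hQ.2.1
    · change Filter.Tendsto (fun ζ => rotProd (projMat (plane z.1)) z.2 Q s ζ) _ _
      rw [← Metric.cobounded_eq_cocompact, Metric.tendsto_nhds]
      intro ε hε
      obtain ⟨R, hR⟩ := exists_norm_rotProd_lt N hε
      have : ∀ᶠ ζ : Eu N in Bornology.cobounded (Eu N), R + 1 ≤ ‖ζ‖ :=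
        Filter.hasBasis_cobounded_norm.mem_of_mem trivial
      filter_upwards [this] with ζ hζ
      rw [dist_zero_right]
      exact hR _ _ _ _ _ hQ (Or.inr (by linarith))

lemma continuous_rotClass (hD : Continuous D) (hK : ∀ b, D b ∈ KSpace gradK) :
    Continuous fun q : OnePoint (Gr n N × Eu N) × (B × unitInterval) =>
      rotClass N q.1 (D q.2.1) (q.2.2 : ℝ) := by
  have h := continuous_onePoint_prod (Y := B × unitInterval) (F := Eu N →ᵤ (HN N →L[ℂ] HN N))
    (continuous_norm_gr (n := n)) isCompact_norm_le_gr
    (A := fun q => UniformFun.ofFun fun ζ =>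
      rotProd (projMat (plane q.1.1)) q.1.2 (D q.2.1) (q.2.2 : ℝ) ζ)
    (c := UniformFun.ofFun 0) ?_ ?_
  · refine h.congr ?_
    rintro ⟨z, y⟩
    induction z using OnePoint.rec <;> rfl
  · refine continuous_ofFun (A := fun (q : (Gr n N × Eu N) × (B × unitInterval)) ζ =>
      rotProd (projMat (plane q.1.1)) q.1.2 (D q.2.1) (q.2.2 : ℝ) ζ) ?_ ?_
    · exact continuous_rotProd
        (continuous_projMat_plane.comp (continuous_fst.comp (continuous_fst.comp continuous_fst)))
        (continuous_snd.comp (continuous_fst.comp continuous_fst))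
        (hD.comp (continuous_fst.comp (continuous_snd.comp continuous_fst)))
        (continuous_subtype_val.comp (continuous_snd.comp (continuous_snd.comp continuous_fst)))
        continuous_snd fun q => (hK _).2.1
    · intro ε hε
      obtain ⟨R, hR⟩ := exists_norm_rotProd_lt N hε
      exact ⟨R, fun q ζ hζ => hR _ _ _ _ _ (hK _) (Or.inr hζ)⟩
  · rintro y U hU
    obtain ⟨ε, hε, hU⟩ := ((UniformFun.hasBasis_nhds_of_basis (Eu N) (HN N →L[ℂ] HN N) _
      Metric.uniformity_basis_dist).mem_iff).1 hU
    obtain ⟨R, hR⟩ := exists_norm_rotProd_lt N hε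
    refine ⟨R, Filter.Eventually.of_forall fun y' z hz => hU fun ζ => ?_⟩
    change dist 0 (rotProd _ _ _ _ ζ) < ε
    rw [dist_zero_left]
    exact hR _ _ _ _ _ (hK _) (Or.inl hz)

lemma bottMul_zero (z : ℂ) : bottMul (0 : HN N →L[ℂ] HN N) z = 0 := by
  simp only [bottMul, damp_zero_left, dampSq_zero_left, ContinuousLinearMap.zero_comp,
    ContinuousLinearMap.comp_zero, smul_zero, sub_zero, add_zero]

lemma rotClass_str (z : OnePoint (Gr n N × Eu N)) {Q : HK →L[ℂ] HK} (hQ : Q ∈ KSpace gradK)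
    (s : ℝ) (t : OnePoint ℝ) :
    rotClass (N + 1) ((BSOplus n).str N z t) Q s = KO.str N (rotClass N z Q s) t := by
  refine congrArg UniformFun.ofFun (funext fun η => ?_)
  induction z using OnePoint.rec with
  | infty =>
    cases t using OnePoint.rec with
    | infty => rfl
    | coe t => exact (bottMul_zero _).symm
  | coe z =>
    cases t using OnePoint.rec with
    | infty => rfl
    | coe t => exact (bottMul_rotProd _ _ _ hQ (isExtend_projMat z.1) t η).symm

/-- The rotation is a homotopy of maps of spectra on `(BSO n)₊ ∧ B`, for every family of classes
which vanishes at the base point. -/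
lemma isHomotopyFrom_rotClass {b₀ : B} (hD : Continuous D) (hK : ∀ b, D b ∈ KSpace gradK)
    (hc : ∀ b, IsConj (D b) (D b)) (h0 : D b₀ = 0) :
    IsHomotopyFrom (smash (BSOplus n) B b₀) KO (fun N p s => rotClass N p.1 (D p.2) s)
      fun N p => rotClass N p.1 (D p.2) 0 := by
  have h : ∀ N, Continuous fun p : (smash (BSOplus n) B b₀).X N × unitInterval =>
      rotClass N p.1.1 (D p.1.2) p.2 := fun N =>
    (continuous_rotClass hD hK).comp ((continuous_fst.comp continuous_fst).prodMk
      ((continuous_snd.comp continuous_fst).prodMk continuous_snd))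
  refine ⟨fun N => (h N).continuousOn, fun s N => ⟨?_, ?_, ?_, ?_⟩, fun N p _ => rfl⟩
  · exact ((h N).comp (continuous_id.prodMk continuous_const)).continuousOn
  · exact fun p _ => rotClass_mem_carrier p.1 (hK _) (hc _) s
  · rintro ⟨z, b⟩ (hz | ⟨-, hb⟩)
    · have : z = OnePoint.infty := hz
      subst this
      rfl
    · have : b = b₀ := hb
      subst this
      change rotClass N z (D b) s = _
      rw [h0]
      exact rotClass_zero z s
  · exact fun p _ t => rotClass_str p.1 (hK _) s t

end Family

/-! ### The ends of the homotopy -/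

lemma sum_extProd {V W : Type} [NormedAddCommGroup V] [InnerProductSpace ℂ V] [CompleteSpace V]
    [NormedAddCommGroup W] [InnerProductSpace ℂ W] [CompleteSpace W] {ι : Type} [Fintype ι]
    [DecidableEq ι] (u : ι → V →L[ℂ] W) (γ : V →ₗᵢ[ℂ] V) (Q : V →L[ℂ] V) (P d g : Matrix ι ι ℂ)
    (r : ℝ) :
    ∑ i, ∑ j, u i ∘L extProd γ Q P d g r i j ∘L (u j).adjoint =
      tens u P (damp Q r) + tens u ((d + g - 1) * P) (dampSq γ Q r) := by
  simp only [tens, extProd, ContinuousLinearMap.add_comp, ContinuousLinearMap.comp_add,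
    ContinuousLinearMap.smul_comp, ContinuousLinearMap.comp_smul, Finset.sum_add_distrib]

variable {N : ℕ}

lemma frameU_vacM (S : Finset (Fin N)) : frameU (vacM N) S = insN (∅, S) := by
  rw [frameU, Finset.sum_eq_single (∅, S)]
  · rw [vacM, if_pos rfl, one_smul]
  · intro a _ ha
    rw [vacM, if_neg ha, zero_smul]
  · exact fun h => absurd (Finset.mem_univ _) h

/-- The external product of `T` with the Koszul complex at `x + iζ`. -/
def koszulProd (x ζ : Eu N) (T : HU →L[ℂ] HU) : HN N →L[ℂ] HN N :=
  ∑ S, ∑ S', ins S ∘L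
    extProd gradU T 1 (koszul (cplx x ζ)) (gradExt N) (‖x‖ ^ 2 + ‖ζ‖ ^ 2) S S' ∘L prj S'

lemma koszulProd_eq (x ζ : Eu N) (T : HU →L[ℂ] HU) :
    koszulProd x ζ T = extK (fun S => (ins S : HU →L[ℂ] HN N)) gradU T (kosz (cplx x ζ))
      (‖x‖ ^ 2 + ‖ζ‖ ^ 2) := by
  have h := sum_extProd (fun S : Finset (Fin N) => (ins S : HU →L[ℂ] HN N)) gradU T 1
    (koszul (cplx x ζ)) (gradExt N) (‖x‖ ^ 2 + ‖ζ‖ ^ 2)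
  rw [mul_one] at h
  rw [extK, kosz, ← h, koszulProd]
  simp only [ins_adjoint]

lemma koszulProd_zero (x ζ : Eu N) : koszulProd x ζ 0 = 0 := by
  rw [koszulProd_eq, extK_zero]

/-- At `s = 0` the rotated external product is that of the class on `HK ⊗ 1 ⊆ HU`. -/
lemma koszulProd_vacU (p : Matrix (Fin N) (Fin N) ℝ) (x ζ : Eu N) {Q : HK →L[ℂ] HK}
    (hQ : Q ∈ KSpace gradK) : koszulProd x ζ (vacU Q) = rotProd p x Q 0 ζ := by
  have hr : 0 ≤ ‖x‖ ^ 2 + ‖ζ‖ ^ 2 := by positivity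
  have h : ∀ (M : Matrix (Finset (Fin N)) (Finset (Fin N)) ℂ) (X : HK →L[ℂ] HK),
      tens (fun S => (ins S : HU →L[ℂ] HN N)) M (vacU X) = tens (frameU (vacM N)) M X := by
    intro M X
    refine Finset.sum_congr rfl fun S _ => Finset.sum_congr rfl fun T _ => ?_
    rw [frameU_vacM, frameU_vacM, insN_adjoint, ins_adjoint]
    rfl
  rw [koszulProd_eq, rotProd, rotFrame_zero, extK, extK, damp_vacU hQ hr, dampSq_vacU hQ hr, h, h]

lemma koToKO_sigmaBar' {n : ℕ} {B : Type*} [TopologicalSpace B] {b₀ : B}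
    {W : B → Submodule ℝ HR} (hK : ∀ b, diffClass (W b) (W b₀) ∈ KSpace gradK)
    (p : (smash (BSOplus n) B b₀).X N) :
    koToKO N (sigmaBar' n b₀ W N p) = rotClass N p.1 (diffClass (W p.2) (W b₀)) 0 := by
  refine congrArg UniformFun.ofFun (funext fun ζ => ?_)
  refine (finsum_sigmaBar' N (fun x T => koszulProd x ζ T) (fun x => koszulProd_zero x ζ)
    p).trans ?_
  obtain ⟨z, b⟩ := p
  induction z using OnePoint.rec with
  | infty => rfl
  | coe z => exact koszulProd_vacU (projMat (plane z.1)) z.2 ζ (hK b)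

/-- At `s = 1` the rotated external product is the product of the Koszul complexes of `iξ` on
`Λ^•L_ℂ` and of `x + iη` on `Λ^•(Lᗮ)_ℂ`, where `ζ = ξ + η`. -/
lemma rotProd_one {L : Submodule ℝ (Eu N)} {x : Eu N} (hx : x ∈ Lᗮ) (Q : HK →L[ℂ] HK) (ζ : Eu N) :
    rotProd (projMat L) x Q 1 ζ =
      ∑ a, ∑ a', insN a ∘L
        extProd gradK Q (extProj L ⊗ₖ extProj Lᗮ)
          (koszul (cplx 0 (L.starProjection ζ)) ⊗ₖ 1 +
            gradExt N ⊗ₖ koszul (cplx x (Lᗮ.starProjection ζ)))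
          (gradExt N ⊗ₖ gradExt N) (‖x‖ ^ 2 + ‖ζ‖ ^ 2) a a' ∘L (insN a').adjoint := by
  rw [sum_extProd, rotProd, extK, tens_frameU, tens_frameU, Matrix.mul_one, kosz, Matrix.mul_sub,
    Matrix.mul_add, ← koszul_mul_rotFrame_one hx, ← grad_mul_rotFrame, Matrix.mul_one,
    ← rotFrame_one_mul_conjTranspose]
  congr 2
  simp only [Matrix.sub_mul, Matrix.add_mul, Matrix.one_mul, Matrix.mul_assoc]

/-- At `s = 1`, and over the quotient bundle, the rotation ends in the de Rham symbol. -/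
lemma rotClass_one {n : ℕ} (W W₀ : Submodule ℝ HR) (z : OnePoint (QTot n N)) :
    rotClass N (z.elim OnePoint.infty fun q => OnePoint.some q.1) (diffClass W W₀) 1 =
      deRhamSymbol W W₀ z := by
  refine congrArg UniformFun.ofFun (funext fun ζ => ?_)
  induction z using OnePoint.rec with
  | infty => rfl
  | coe q =>
    refine (rotProd_one q.2 (diffClass W W₀) ζ).trans ?_
    simp only [insN_adjoint]
    rfl

end KOSymbol

end

theorem mainTheorem3 :
    ∃ H : ∀ N, OnePoint (QTot 2 N) → Submodule ℝ HR → Submodule ℝ HR → unitInterval → KO.X N,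
    ∀ (E : Type*) [NormedAddCommGroup E] [NormedSpace ℝ E] [FiniteDimensional ℝ E]
      (G : Type*) [TopologicalSpace G] [ChartedSpace E G] [Group G] [LieGroup 𝓘(ℝ, E) ∞ G]
      [CompactSpace G] [T2Space G]
      (P : Type*) [TopologicalSpace P] [MulAction G P] [ContinuousSMul G P]
      (_ : IsUniversalBundle G P)
      (φ : P → GroupLieAlgebra 𝓘(ℝ, E) G →L[ℝ] HR) (_ : IsAdjointEmbedding φ)
      (b₀ : MulAction.orbitRel.Quotient G P),
      -- the maps of the diagram
      IsMap (smash (desusp (MTSO 1)) _ b₀) (smash (MTSO 2) _ b₀) (bMap 1 b₀) ∧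
      IsMap (smash (MTSO 2) _ b₀) (smash (BSOplus 2) _ b₀) (qMap 2 b₀) ∧
      IsMap (smash (BSOplus 2) _ b₀) ko (sigmaBar' 2 b₀ (adFibre φ)) ∧
      IsMap (smash (MTSO 2) _ b₀) KO (sigmaBar 2 b₀ (adFibre φ)) ∧
      -- the triangle commutes
      IsHomotopy (smash (MTSO 2) _ b₀) KO
        (fun N p s => H N p.1 (adFibre φ p.2) (adFibre φ b₀) s)
        (fun N p => koToKO N (sigmaBar' 2 b₀ (adFibre φ) N (qMap 2 b₀ N p)))
        (sigmaBar 2 b₀ (adFibre φ)) ∧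
      -- the induced null homotopy
      IsNullHomotopy (smash (desusp (MTSO 1)) _ b₀) (smash (BSOplus 2) _ b₀) (qbNull 1 b₀)
        (fun N x => qMap 2 b₀ N (bMap 1 b₀ N x)) ∧
      IsNullHomotopy (smash (desusp (MTSO 1)) _ b₀) KO
        (fun N x => backThen
          (fun s => H N (bMap 1 b₀ N x).1 (adFibre φ (bMap 1 b₀ N x).2) (adFibre φ b₀) s)
          (fun s => koToKO N (sigmaBar' 2 b₀ (adFibre φ) N (qbNull 1 b₀ N x s))))
        (fun N x => sigmaBar 2 b₀ (adFibre φ) N (bMap 1 b₀ N x)) := by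
  refine ⟨fun N z W W₀ s => rotClass N (z.elim OnePoint.infty fun q => OnePoint.some q.1)
    (diffClass W W₀) s, ?_⟩
  intro E _ _ _ G _ _ _ _ _ _ P _ _ _ _ φ hφ b₀
  have hW := adFibre_finiteDimensional hφ
  have hD := continuous_diffClass_adFibre hφ (adFibre φ b₀)
  have hK : ∀ b, diffClass (adFibre φ b) (adFibre φ b₀) ∈ KSpace gradK := fun b =>
    have := hW b; have := hW b₀; diffClass_mem_KSpace _ _
  have hb := isMap_bMap 1 b₀
  have hq := isMap_qMap 2 b₀
  have hqb := isNullHomotopy_qbNull 1 b₀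
  have hrot := isHomotopyFrom_rotClass (n := 2) hD hK (fun b => isConj_diffClass _ _)
    (diffClass_self (adFibre φ b₀))
  have hstart : (fun N p => koToKO N (sigmaBar' 2 b₀ (adFibre φ) N p)) =
      fun N (p : (smash (BSOplus 2) _ b₀).X N) =>
        rotClass N p.1 (diffClass (adFibre φ p.2) (adFibre φ b₀)) 0 := by
    funext N p
    exact koToKO_sigmaBar' hK p
  have hj : IsMap (smash (BSOplus 2) _ b₀) KO
      fun N p => koToKO N (sigmaBar' 2 b₀ (adFibre φ) N p) := by
    rw [hstart]
    exact hrot.2.1 0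
  rw [← hstart] at hrot
  have hH : IsHomotopy (smash (MTSO 2) _ b₀) KO
      (fun N p s => rotClass N (OnePoint.elim p.1 OnePoint.infty fun q => OnePoint.some q.1)
        (diffClass (adFibre φ p.2) (adFibre φ b₀)) s)
      (fun N p => koToKO N (sigmaBar' 2 b₀ (adFibre φ) N (qMap 2 b₀ N p)))
      (sigmaBar 2 b₀ (adFibre φ)) :=
    ⟨hrot.comp_map hq, fun N p _ => rotClass_one _ _ p.1⟩
  refine ⟨hb, hq, isMap_sigmaBar' hW hD, hH.isMap_right fun N => Set.univ_prod_univ, hH, hqb, ?_⟩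
  exact (hH.comp_map hb).backThen (IsNullHomotopy.map_comp
    (g := fun N p => koToKO N (sigmaBar' 2 b₀ (adFibre φ) N p)) hj hqb)
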